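/- There is a universal constant $C>0$ such that the following holds. Let $d,n\ge 1$, let $\mathcal X\subseteq\mathbb R^d$ be closed and convex with $\mathbf 0\in\mathcal X$, let $\delta\in(0,1/2]$, and let $\hat L\in\mathbb R$, $\hat\ell\in\mathbb R^d$. Then there exists a parameter-free algorithm, that is, a map $\mathcal A$ sending $n$ functions $\mathbb R^d\to\mathbb R$ to a point of $\mathcal X$, which depends only on $d,n,\mathcal X,\delta,\hat L,\hat\ell$, with the following property. Let $S$ be a random variable and let $f(x;S)$ be a random loss such that $F(x):=\mathbb E[f(x;S)]$ is well defined on $\mathcal X$ with $F^\star:=\inf_{x\in\mathcal X}F(x)>-\infty$. Suppose that almost surely $f(\cdot\,;S)$ is convex on $\mathcal X$ and differentiable at every $x\in\mathcal X$, and that for some $L\in\mathbb R$ and $\ell\in\mathbb R^d$, almost surely, for all $x\in\mathcal X$ and all $j\le d$, \[ \|\nabla f(x;S)\|_2\le L\le\hat L,\qquad |\nabla_j f(x;S)|\le \ell_j\le\hat\ell_j . \] Suppose moreover that \[ \hat L\le L\sqrt{\frac{n}{\ln(1/\delta)}}\qquad\text{and}\qquad \hat\ell_j\le \ell_j\sqrt{\frac{n}{\ln(d/\delta)}}\quad\text{for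 all } j\le d . \] Let $S_1,\dots,S_n$ be independent copies of $S$ and let $z:=\mathcal A\big(f(\cdot\,;S_1),\dots,f(\cdot\,;S_n)\big)$. Then, with probability at least $1-\delta$, for every $x^\star\in\mathcal X^\star:=\operatorname{argmin}_{x\in\mathcal X}F(x)$, \[ F(z)-F^\star\le C\,\min\left\{\frac{L\|x^\star\|_2\sqrt{\ln\frac1\delta}}{\sqrt n},\ \frac{\|\ell\|_\infty\|x^\star\|_1\sqrt{\ln\frac d\delta}}{\sqrt n},\ \frac{\|\ell\|_1\|x^\star\|_\infty\sqrt{\ln\frac1\delta}}{\sqrt n}\right\}. \] -/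

import Mathlib

open MeasureTheory

noncomputable section

namespace StochOpt

/-- `ℝ^d` with the Euclidean norm. -/
abbrev Vec (d : ℕ) : Type := EuclideanSpace ℝ (Fin d)

/-- The `1`-norm of a coordinate vector. -/
def norm1 {d : ℕ} (v : Fin d → ℝ) : ℝ := ∑ j, |v j|

/-- The `∞`-norm of a coordinate vector (the norm of Mathlib on `Fin d → ℝ`). -/
def normInf {d : ℕ} (v : Fin d → ℝ) : ℝ := ‖v‖

variable {d : ℕ} {𝒮 : Type*} [MeasurableSpace 𝒮]

/-- The population risk `F(x) = 𝔼[f(x; S)]`, where `S` has law `P`. -/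
def risk (P : Measure 𝒮) (f : Vec d → 𝒮 → ℝ) (x : Vec d) : ℝ := ∫ s, f x s ∂P

/-- The optimal value `F⋆ = inf_{x ∈ X} F(x)`. -/
def optValue (X : Set (Vec d)) (P : Measure 𝒮) (f : Vec d → 𝒮 → ℝ) : ℝ :=
  sInf (risk P f '' X)

/-- The set of minimizers `X⋆ = argmin_{x ∈ X} F(x)` (possibly empty). -/
def minimizers (X : Set (Vec d)) (P : Measure 𝒮) (f : Vec d → 𝒮 → ℝ) : Set (Vec d) :=
  {x | x ∈ X ∧ ∀ y ∈ X, risk P f x ≤ risk P f y}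

/-- A stochastic convex problem on `X`: the losses are convex in `x` on `X`, the population risk
is well defined on `X`, and it is bounded below there (`F⋆ > -∞`). -/
structure IsStochConvex (X : Set (Vec d)) (P : Measure 𝒮) (f : Vec d → 𝒮 → ℝ) : Prop where
  measurable : ∀ x, Measurable (f x)
  integrable : ∀ x ∈ X, Integrable (f x) P
  convex : ∀ᵐ s ∂P, ConvexOn ℝ X (fun x => f x s)
  bddBelow : BddBelow (risk P f '' X)

/-- Upper bounds on the Lipschitz constants: `f` is differentiable in `x` and almost surely, for
all `x ∈ X` and all `j`, `‖∇f(x;S)‖₂ ≤ L ≤ Lhat` and `|∇ⱼ f(x;S)| ≤ ℓ j ≤ ℓhat j`. -/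
structure LipschitzEstimates (X : Set (Vec d)) (P : Measure 𝒮) (f : Vec d → 𝒮 → ℝ)
    (L Lhat : ℝ) (ℓ ℓhat : Fin d → ℝ) : Prop where
  differentiable : ∀ᵐ s ∂P, ∀ x ∈ X, DifferentiableAt ℝ (fun y => f y s) x
  norm_gradient_le : ∀ᵐ s ∂P, ∀ x ∈ X, ‖gradient (fun y => f y s) x‖ ≤ L
  le_Lhat : L ≤ Lhat
  abs_gradient_le : ∀ᵐ s ∂P, ∀ x ∈ X, ∀ j, |gradient (fun y => f y s) x j| ≤ ℓ j
  le_ℓhat : ∀ j, ℓ j ≤ ℓhat j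

/-- The minimum of the three known-parameter rates, for the minimizer `x` and sample size `n`. -/
def rate (n : ℕ) (δ L : ℝ) (ℓ : Fin d → ℝ) (x : Vec d) : ℝ :=
  min (L * ‖x‖ * √(Real.log (1 / δ)) / √(n : ℝ))
    (min (normInf ℓ * norm1 x * √(Real.log ((d : ℝ) / δ)) / √(n : ℝ))
      (norm1 ℓ * normInf x * √(Real.log (1 / δ)) / √(n : ℝ)))

end StochOpt

end

/-! The sample is cut into three blocks of equal length `N`. The first one measures gradients. The
hypotheses on the known bounds say that `L̂ √(ln(1/δ)/n) ≤ L`, and similarly for each `ℓ̂ j`, so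
second moments can be estimated at that resolution without exceeding the true constants by more than
a factor. The resulting scales dominate the second moments of the gradient gauges with high
probability (`Regular.measure_scale_lt_le`), and they are bounded by multiples of `L`, of `‖ℓ‖_∞`
and, summed over coordinates, of `‖ℓ‖₁` (`scaleBounds`).

The scales define one mirror geometry with three blocks (`stdGeom`): a Euclidean ball, a 1-norm ball
with an entropy, and an ellipsoid weighted so that it contains an ∞-norm ball. It is normalized so
that `ρ` times the unit body contains every point whose rate is at most `ρ / 5`
(`ScaleBounds.exists_rep`), while online learning over that body costs `O(ρ)` per sample
(`gradState_regret`) and sampled differences fluctuate by `O(ρ)` per sample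
(`Regular.measure_deviation_le`). One parameter `ρ` thus replaces the unknown norm of the minimizer,
and the minimum of the three rates comes for free.

On the second block the regularized leader is run at every dyadic scale `2 ^ k`, and online-to-batch
conversion gives one candidate per scale. The third block selects a candidate by empirical loss plus
a penalty proportional to `2 ^ k`. Three facts make the selection work. At the right scale the
candidate is good (`Regular.risk_candIdx_le`). At smaller scales the deviations shrink with `2 ^ k`,
which pays for a union bound with geometric weights. At larger scales no union bound is made: a
learner that exists only in the analysis, started at a near-minimizer, shows that no nearby point
has much smaller empirical loss (`Regular.sum_sub_le_of_feasible`), convexity extends this to all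
larger scales (`Regular.sum_sub_le_of_le_scale`), and the penalty exceeds the remaining advantage.
This avoids any additional logarithm of the range of scales.

Played points are rounded to a dense sequence in `X` and gradients to a lattice. All states of the
algorithm are then countably valued, which makes them measurable and reduces every concentration
bound to a product of one-step exponential moments (`measure_sum_pred_le`). -/

noncomputable section

namespace StochOpt

open scoped ENNReal

/-! ### Predictable countable states and exponential tail bounds. -/

section Predictable

variable {𝒮 : Type*} [MeasurableSpace 𝒮] {n : ℕ} {β β' α : Type*}

/-- A random variable with values in a (countable) type, with measurable fibres, that depends only
on the samples with index below `t`. -/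
structure Pred (t : ℕ) (h : (Fin n → 𝒮) → β) : Prop where
  congr : ∀ S S' : Fin n → 𝒮, (∀ i : Fin n, (i : ℕ) < t → S i = S' i) → h S = h S'
  meas : ∀ b, MeasurableSet {S | h S = b}

lemma Pred.const (t : ℕ) (b : β) : Pred t (fun _ : Fin n → 𝒮 => b) :=
  ⟨fun _ _ _ => rfl, fun _ => MeasurableSet.const _⟩

lemma Pred.mono {t t' : ℕ} {h : (Fin n → 𝒮) → β} (H : Pred t h) (ht : t ≤ t') : Pred t' h :=
  ⟨fun S S' hS => H.congr S S' fun i hi => hS i (hi.trans_le ht), H.meas⟩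

/-- Each fibre is a countable union of intersections of fibres, so `φ` needs no measurability. This
is what permits arbitrary choices (leaders, nearest points) inside the algorithm. -/
lemma Pred.map₂ [Countable β] [Countable β'] {t : ℕ} {h : (Fin n → 𝒮) → β}
    {h' : (Fin n → 𝒮) → β'} (H : Pred t h) (H' : Pred t h') (φ : β → β' → α) :
    Pred t (fun S => φ (h S) (h' S)) := by
  refine ⟨fun S S' hS => by rw [H.congr S S' hS, H'.congr S S' hS], fun b => ?_⟩
  have : {S | φ (h S) (h' S) = b} =
      ⋃ c, ⋃ c', ({S | h S = c} ∩ {S | h' S = c'} ∩ {_S | φ c c' = b}) := by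
    ext S; simp
  rw [this]
  exact MeasurableSet.iUnion fun c => MeasurableSet.iUnion fun c' =>
    ((H.meas c).inter (H'.meas c')).inter (MeasurableSet.const _)

lemma Pred.map [Countable β] {t : ℕ} {h : (Fin n → 𝒮) → β} (H : Pred t h) (φ : β → β') :
    Pred t (fun S => φ (h S)) :=
  H.map₂ (Pred.const t ()) fun b _ => φ b

lemma Pred.pi [Countable β] {ι : Type*} [Finite ι] {t : ℕ} {h : (Fin n → 𝒮) → ι → β}
    (H : ∀ i, Pred t (fun S => h S i)) : Pred t h := by
  refine ⟨fun S S' hS => funext fun i => (H i).congr S S' hS, fun b => ?_⟩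
  have : {S | h S = b} = ⋂ i, {S | h S i = b i} := by
    ext S; simp [funext_iff]
  rw [this]
  exact MeasurableSet.iInter fun i => (H i).meas _

lemma Pred.step [NeZero n] [Countable β] {t : ℕ} (ht : t < n) {h : (Fin n → 𝒮) → β}
    (H : Pred t h) {φ : β → 𝒮 → β'} (hφ : ∀ b b', MeasurableSet {s | φ b s = b'}) :
    Pred (t + 1) (fun S => φ (h S) (S (Fin.ofNat n t))) := by
  refine ⟨fun S S' hS => ?_, fun b' => ?_⟩
  · rw [H.congr S S' fun i hi => hS i (by omega), hS (Fin.ofNat n t)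
      (by simp [Fin.ofNat, Nat.mod_eq_of_lt ht])]
  · have : {S | φ (h S) (S (Fin.ofNat n t)) = b'} =
        ⋃ b, ({S | h S = b} ∩ {S | φ b (S (Fin.ofNat n t)) = b'}) := by
      ext S; simp
    rw [this]
    exact MeasurableSet.iUnion fun b => (H.meas b).inter
      (measurableSet_preimage (measurable_pi_apply (X := fun _ : Fin n => 𝒮) (Fin.ofNat n t))
        (hφ b b'))

lemma Pred.measurable_eval [Countable β] {t : ℕ} {h : (Fin n → 𝒮) → β} (H : Pred t h)
    {E : Type*} [MeasurableSpace E] (i : Fin n) {φ : β → 𝒮 → E} (hφ : ∀ b, Measurable (φ b)) :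
    Measurable (fun S => φ (h S) (S i)) := by
  intro A hA
  have : (fun S => φ (h S) (S i)) ⁻¹' A = ⋃ b, ({S | h S = b} ∩ {S | φ b (S i) ∈ A}) := by
    ext S; simp
  rw [this]
  exact MeasurableSet.iUnion fun b => (H.meas b).inter
    (measurableSet_preimage ((hφ b).comp (measurable_pi_apply (X := fun _ : Fin n => 𝒮) i)) hA)

variable (P : Measure 𝒮) [IsProbabilityMeasure P]

/-- A product of factors with conditional mean at most one has mean at most one. -/
lemma lintegral_prod_pred_le_one [NeZero n] [Countable β] {lo N : ℕ} (hN : lo + N ≤ n)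
    {h : ℕ → (Fin n → 𝒮) → β} (H : ∀ i < N, Pred (lo + i) (h i))
    {ζ : β → 𝒮 → ℝ≥0∞} (hζ : ∀ b, Measurable (ζ b)) (hζ1 : ∀ b, ∫⁻ s, ζ b s ∂P ≤ 1) :
    ∫⁻ S, ∏ i ∈ Finset.range N, ζ (h i S) (S (Fin.ofNat n (lo + i)))
      ∂(Measure.pi fun _ : Fin n => P) ≤ 1 := by
  induction N with
  | zero => simp
  | succ m ih =>
    refine le_trans ?_ (ih (by omega) fun i hi => H i (by omega))
    have hmeas : ∀ k ≤ m + 1, Measurable fun S : Fin n → 𝒮 =>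
        ∏ i ∈ Finset.range k, ζ (h i S) (S (Fin.ofNat n (lo + i))) := fun k hk =>
      Finset.measurable_prod _ fun i hi =>
        (H i (by simp at hi; omega)).measurable_eval _ hζ
    have hval : ∀ i ≤ m, ((Fin.ofNat n (lo + i) : Fin n) : ℕ) = lo + i := fun i hi => by
      simp [Fin.ofNat, Nat.mod_eq_of_lt (show lo + i < n by omega)]
    -- Only the newest sample is integrated out. The earlier factors and the state of the last
    -- factor do not depend on it, so the last factor contributes at most one.
    refine lintegral_le_of_lmarginal_le {Fin.ofNat n (lo + m)} (hmeas _ le_rfl)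
      (hmeas m (by omega)) ?_
    intro S
    rw [lmarginal_singleton, lmarginal_singleton]
    have hupd : ∀ (s : 𝒮) (i : ℕ), i ≤ m →
        h i (Function.update S (Fin.ofNat n (lo + m)) s) = h i S := fun s i hi => by
      refine (H i (by omega)).congr _ _ fun j hj => ?_
      rw [Function.update_of_ne]
      intro hj'
      rw [hj', hval m le_rfl] at hj
      omega
    have hprod : ∀ s : 𝒮, (∏ i ∈ Finset.range m,
        ζ (h i (Function.update S (Fin.ofNat n (lo + m)) s))
          (Function.update S (Fin.ofNat n (lo + m)) s (Fin.ofNat n (lo + i)))) =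
        ∏ i ∈ Finset.range m, ζ (h i S) (S (Fin.ofNat n (lo + i))) := fun s => by
      refine Finset.prod_congr rfl fun i hi => ?_
      have hi' : i < m := by simpa using hi
      rw [hupd s i hi'.le, Function.update_of_ne]
      intro hj'
      have := congrArg Fin.val hj'
      rw [hval m le_rfl, hval i hi'.le] at this
      omega
    simp only [Finset.prod_range_succ, hprod, hupd _ m le_rfl, Function.update_self]
    rw [lintegral_const_mul _ (hζ _), lintegral_const, measure_univ]
    gcongr
    exact hζ1 _

/-- Exponential tail bound for sums with predictable states. -/
lemma measure_sum_pred_le [NeZero n] [Countable β] {lo N : ℕ} (hN : lo + N ≤ n)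
    {h : ℕ → (Fin n → 𝒮) → β} (H : ∀ i < N, Pred (lo + i) (h i))
    {ξ : β → 𝒮 → ℝ} (hξ : ∀ b, Measurable (ξ b))
    (hξ1 : ∀ b, ∫⁻ s, ENNReal.ofReal (Real.exp (ξ b s)) ∂P ≤ 1) (c : ℝ) :
    (Measure.pi fun _ : Fin n => P)
      {S | c ≤ ∑ i ∈ Finset.range N, ξ (h i S) (S (Fin.ofNat n (lo + i)))} ≤
      ENNReal.ofReal (Real.exp (-c)) := by
  have key := lintegral_prod_pred_le_one P hN H
    (ζ := fun b s => ENNReal.ofReal (Real.exp (ξ b s)))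
    (fun b => ((hξ b).exp).ennreal_ofReal) hξ1
  have hset : {S : Fin n → 𝒮 |
      c ≤ ∑ i ∈ Finset.range N, ξ (h i S) (S (Fin.ofNat n (lo + i)))} ⊆
      {S | ENNReal.ofReal (Real.exp c) ≤ ∏ i ∈ Finset.range N,
        ENNReal.ofReal (Real.exp (ξ (h i S) (S (Fin.ofNat n (lo + i)))))} := by
    intro S hS
    simp only [Set.mem_ofPred_eq] at hS ⊢
    rw [← ENNReal.ofReal_prod_of_nonneg (fun i _ => (Real.exp_pos _).le), ← Real.exp_sum]
    exact ENNReal.ofReal_le_ofReal (Real.exp_le_exp.2 hS)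
  have hmeas : AEMeasurable (fun S : Fin n → 𝒮 => ∏ i ∈ Finset.range N,
      ENNReal.ofReal (Real.exp (ξ (h i S) (S (Fin.ofNat n (lo + i))))))
      (Measure.pi fun _ : Fin n => P) :=
    (Finset.measurable_prod _ fun i hi => (H i (by simpa using hi)).measurable_eval _
      (φ := fun b s => ENNReal.ofReal (Real.exp (ξ b s)))
      fun b => ((hξ b).exp).ennreal_ofReal).aemeasurable
  refine (measure_mono hset).trans ((meas_ge_le_lintegral_div hmeas ?_ ?_).trans ?_)
  · simp [Real.exp_pos]
  · simp
  · rw [Real.exp_neg, ENNReal.ofReal_inv_of_pos (Real.exp_pos _), ← one_div]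
    gcongr

end Predictable

/-! ### One-step exponential moments. -/

section ExpMoment

variable {𝒮 : Type*} [MeasurableSpace 𝒮] (P : Measure 𝒮) [IsProbabilityMeasure P]

lemma integrable_of_abs_le {X : 𝒮 → ℝ} (hX : Measurable X) {b : ℝ} (hb : ∀ s, |X s| ≤ b) :
    Integrable X P :=
  Integrable.of_bound hX.aestronglyMeasurable b (ae_of_all _ fun s => by simpa using hb s)

/-- A pointwise bound of `exp X` by an integrable function bounds the exponential moment. -/
lemma lintegral_exp_sub_le_one {X Y : 𝒮 → ℝ} (hXY : ∀ s, Real.exp (X s) ≤ 1 + Y s)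
    (hY : Integrable Y P) {c : ℝ} (hc : ∫ s, Y s ∂P ≤ c) :
    ∫⁻ s, ENNReal.ofReal (Real.exp (X s - c)) ∂P ≤ 1 := by
  have hint : Integrable (fun s => (1 + Y s) * Real.exp (-c)) P :=
    ((integrable_const 1).add hY).mul_const _
  calc ∫⁻ s, ENNReal.ofReal (Real.exp (X s - c)) ∂P
      ≤ ∫⁻ s, ENNReal.ofReal ((1 + Y s) * Real.exp (-c)) ∂P := by
        refine lintegral_mono fun s => ENNReal.ofReal_le_ofReal ?_
        rw [sub_eq_add_neg, Real.exp_add]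
        exact mul_le_mul_of_nonneg_right (hXY s) (Real.exp_pos _).le
    _ = ENNReal.ofReal (∫ s, (1 + Y s) * Real.exp (-c) ∂P) := by
        rw [ofReal_integral_eq_lintegral_ofReal hint]
        exact ae_of_all _ fun s =>
          mul_nonneg ((Real.exp_pos _).le.trans (hXY s)) (Real.exp_pos _).le
    _ ≤ 1 := by
        rw [ENNReal.ofReal_le_one, integral_mul_const, integral_add (integrable_const 1) hY]
        simp only [integral_const, probReal_univ, smul_eq_mul, one_mul]
        calc (1 + ∫ s, Y s ∂P) * Real.exp (-c) ≤ Real.exp c * Real.exp (-c) := by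
              gcongr
              have := Real.add_one_le_exp c
              linarith
          _ = 1 := by rw [← Real.exp_add]; simp

/-- The Bernstein step: `exp x ≤ 1 + x + x ^ 2` for `|x| ≤ 1`, followed by `1 + c ≤ exp c`. -/
lemma lintegral_exp_centered_le_one {X : 𝒮 → ℝ} (hX : Measurable X) (hb : ∀ s, |X s| ≤ 1)
    {v : ℝ} (hv : ∫ s, X s ^ 2 ∂P ≤ v) :
    ∫⁻ s, ENNReal.ofReal (Real.exp (X s - ∫ s, X s ∂P - v)) ∂P ≤ 1 := by
  have hX2 : Integrable (fun s => X s ^ 2) P :=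
    integrable_of_abs_le P (hX.pow_const 2) (b := 1) fun s => by
      rw [abs_of_nonneg (sq_nonneg _)]; exact (sq_le_one_iff_abs_le_one _).2 (hb s)
  have hX1 := integrable_of_abs_le P hX hb
  have := lintegral_exp_sub_le_one P (X := X) (Y := fun s => X s + X s ^ 2)
    (c := ∫ s, X s ∂P + v) (fun s => by
      have := (abs_le.1 (Real.abs_exp_sub_one_sub_id_le (hb s))).2
      linarith) (hX1.add hX2) (by rw [integral_add hX1 hX2]; linarith)
  simpa [sub_sub] using this

/-- For values in `[0, 1]` the quadratic term is at most the linear one, so no variance enters: a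
sum exceeds twice its mean only by a logarithmic term. -/
lemma lintegral_exp_nonneg_le_one {X : 𝒮 → ℝ} (hX : Measurable X) (h0 : ∀ s, 0 ≤ X s)
    (h1 : ∀ s, X s ≤ 1) {v : ℝ} (hv : ∫ s, X s ∂P ≤ v) :
    ∫⁻ s, ENNReal.ofReal (Real.exp (X s - 2 * v)) ∂P ≤ 1 := by
  have hb : ∀ s, |X s| ≤ 1 := fun s => by rw [abs_of_nonneg (h0 s)]; exact h1 s
  refine lintegral_exp_sub_le_one P (Y := fun s => 2 * X s) (fun s => ?_)
    ((integrable_of_abs_le P hX hb).const_mul 2) (by rw [integral_const_mul]; linarith)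
  have := (abs_le.1 (Real.abs_exp_sub_one_sub_id_le (hb s))).2
  nlinarith [h0 s, h1 s]

/-- The lower-tail counterpart, from `exp (-x / 2) ≤ 1 - x / 4` on `[0, 1]`: the mean is controlled
by twice the observed sum. -/
lemma lintegral_exp_neg_le_one {X : 𝒮 → ℝ} (hX : Measurable X) (h0 : ∀ s, 0 ≤ X s)
    (h1 : ∀ s, X s ≤ 1) :
    ∫⁻ s, ENNReal.ofReal (Real.exp ((∫ s, X s ∂P) / 4 - X s / 2)) ∂P ≤ 1 := by
  have hb : ∀ s, |X s| ≤ 1 := fun s => by rw [abs_of_nonneg (h0 s)]; exact h1 s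
  have := lintegral_exp_sub_le_one P (X := fun s => - X s / 2) (Y := fun s => -(1 / 4) * X s)
    (c := -(∫ s, X s ∂P) / 4) (fun s => ?_)
    ((integrable_of_abs_le P hX hb).const_mul _) (by rw [integral_const_mul]; linarith)
  · refine le_trans (le_of_eq ?_) this
    refine lintegral_congr fun s => ?_
    congr 2; ring
  · have h2 : |(-X s / 2)| ≤ 1 := by
      rw [abs_le]; constructor <;> linarith [h0 s, h1 s]
    have := (abs_le.1 (Real.abs_exp_sub_one_sub_id_le h2)).2
    nlinarith [h0 s, h1 s]

end ExpMoment

end StochOpt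
end

noncomputable section

namespace StochOpt

/-! ### An entropy that is strongly convex for the 1-norm. -/

section Entropy

/-- The primitive of `arsinh` that vanishes at `0`. -/
def hypent (t : ℝ) : ℝ := t * Real.arsinh t - √(1 + t ^ 2) + 1

lemma hasDerivAt_hypent (t : ℝ) : HasDerivAt hypent (Real.arsinh t) t := by
  have hpos : 0 < 1 + t ^ 2 := by positivity
  have h1 := (hasDerivAt_id t).mul (Real.hasDerivAt_arsinh t)
  have h2 : HasDerivAt (fun t : ℝ => √(1 + t ^ 2)) (2 * t / (2 * √(1 + t ^ 2))) t := by
    refine HasDerivAt.sqrt ?_ hpos.ne'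
    simpa using (hasDerivAt_pow 2 t).const_add 1
  have h3 := (h1.sub h2).add_const 1
  have e : 1 * Real.arsinh t + id t * (√(1 + t ^ 2))⁻¹ - 2 * t / (2 * √(1 + t ^ 2)) =
      Real.arsinh t := by
    rw [mul_div_mul_left _ _ two_ne_zero, div_eq_mul_inv, id]
    ring
  rw [e] at h3
  exact h3

lemma hypent_zero : hypent 0 = 0 := by simp [hypent]

/-- The derivative of `arsinh` is `1 / √(1 + t ^ 2)`, and `√(1 + t ^ 2) ≤ 1 + R` on the interval;
hence `hypent` has curvature at least `1 / (R + 1)` there. -/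
lemma arsinh_sub_mul_monotoneOn (R : ℝ) :
    MonotoneOn (fun t => Real.arsinh t - 1 / (R + 1) * t) (Set.Icc (-R) R) := by
  refine monotoneOn_of_deriv_nonneg (convex_Icc _ _) ?_ ?_ ?_
  · exact (Real.continuous_arsinh.sub (continuous_const.mul continuous_id)).continuousOn
  · exact (Real.differentiable_arsinh.sub
      ((differentiable_const _).mul differentiable_id)).differentiableOn
  · intro t ht
    rw [interior_Icc] at ht
    have hR : 0 < R := by linarith [ht.1, ht.2]
    have hd : HasDerivAt (fun t => Real.arsinh t - 1 / (R + 1) * t)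
        ((√(1 + t ^ 2))⁻¹ - 1 / (R + 1) * 1) t :=
      (Real.hasDerivAt_arsinh t).sub ((hasDerivAt_id t).const_mul _)
    rw [hd.deriv, mul_one, sub_nonneg, one_div]
    refine inv_anti₀ (Real.sqrt_pos.2 (by positivity)) ?_
    rw [Real.sqrt_le_left (by linarith)]
    nlinarith [ht.1, ht.2]

/-- Midpoint strong convexity of `hypent`. -/
lemma hypent_midpoint (x y : ℝ) :
    (x - y) ^ 2 / (8 * (|x| + |y| + 1)) ≤
      1 / 2 * hypent x + 1 / 2 * hypent y - hypent (1 / 2 * x + 1 / 2 * y) := by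
  set R := |x| + |y| with hR
  have hR0 : 0 ≤ R := by positivity
  have hcvx : ConvexOn ℝ (Set.Icc (-R) R) (fun t => hypent t - 1 / (R + 1) * (t ^ 2 / 2)) := by
    have hd : ∀ t, HasDerivAt (fun t => hypent t - 1 / (R + 1) * (t ^ 2 / 2))
        (Real.arsinh t - 1 / (R + 1) * t) t := fun t => by
      refine (hasDerivAt_hypent t).sub (HasDerivAt.const_mul _ ?_)
      simpa using (hasDerivAt_pow 2 t).div_const 2
    refine MonotoneOn.convexOn_of_deriv (convex_Icc _ _) ?_ ?_ ?_
    · exact fun t _ => (hd t).continuousAt.continuousWithinAt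
    · exact fun t _ => (hd t).differentiableAt.differentiableWithinAt
    · intro a ha b hb hab
      rw [(hd a).deriv, (hd b).deriv]
      exact arsinh_sub_mul_monotoneOn R (interior_subset ha) (interior_subset hb) hab
  have hx : x ∈ Set.Icc (-R) R := abs_le.1 (by rw [hR]; linarith [abs_nonneg y])
  have hy : y ∈ Set.Icc (-R) R := abs_le.1 (by rw [hR]; linarith [abs_nonneg x])
  have := hcvx.2 hx hy (show (0 : ℝ) ≤ 1 / 2 by norm_num) (show (0 : ℝ) ≤ 1 / 2 by norm_num)
    (by norm_num)
  simp only [smul_eq_mul] at this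
  have e : (x - y) ^ 2 / (8 * (R + 1)) = 1 / (R + 1) * ((x - y) ^ 2 / 8) := by
    field_simp
  rw [e]
  have e2 : 1 / (R + 1) * ((x - y) ^ 2 / 8) = 1 / 2 * (1 / (R + 1) * (x ^ 2 / 2)) +
      1 / 2 * (1 / (R + 1) * (y ^ 2 / 2)) -
      1 / (R + 1) * ((1 / 2 * x + 1 / 2 * y) ^ 2 / 2) := by ring
  linarith

lemma hypent_nonneg (t : ℝ) : 0 ≤ hypent t := by
  have h := hypent_midpoint t (-t)
  have hsymm : hypent (-t) = hypent t := by simp [hypent, Real.arsinh_neg]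
  have h0 : 1 / 2 * t + 1 / 2 * -t = 0 := by ring
  rw [hsymm, h0, hypent_zero] at h
  have : 0 ≤ (t - -t) ^ 2 / (8 * (|t| + |(-t)| + 1)) := by positivity
  linarith

lemma arsinh_le_log {t D : ℝ} (h0 : 0 ≤ t) (hD : t ≤ D) :
    Real.arsinh t ≤ 2 * Real.log (1 + D) := by
  have h1 : √(1 + t ^ 2) ≤ 1 + t := by
    rw [Real.sqrt_le_left (by linarith)]; nlinarith
  rw [Real.arsinh, show 2 * Real.log (1 + D) = Real.log ((1 + D) ^ 2) by
    rw [Real.log_pow]; norm_num]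
  refine Real.log_le_log ?_ ?_
  · have : 0 < √(1 + t ^ 2) := Real.sqrt_pos.2 (by positivity)
    linarith
  · nlinarith

lemma hypent_le {t D : ℝ} (hD : |t| ≤ D) : hypent t ≤ |t| * (2 * Real.log (1 + D)) := by
  have h1 : (1 : ℝ) ≤ √(1 + t ^ 2) := by
    rw [Real.one_le_sqrt]; nlinarith [sq_nonneg t]
  have h2 : t * Real.arsinh t ≤ |t| * Real.arsinh |t| := by
    rcases le_total 0 t with h | h
    · rw [abs_of_nonneg h]
    · rw [abs_of_nonpos h, Real.arsinh_neg]; linarith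
  have h3 := mul_le_mul_of_nonneg_left (arsinh_le_log (abs_nonneg t) hD) (abs_nonneg t)
  unfold hypent
  linarith

lemma continuous_hypent : Continuous hypent :=
  continuous_iff_continuousAt.2 fun t => (hasDerivAt_hypent t).continuousAt

/-- The entropy-like regularizer on the unit ball of the `1`-norm. -/
def entropy {d : ℕ} (v : Fin d → ℝ) : ℝ := ∑ j, hypent (d * v j) / d

variable {d : ℕ}

lemma continuous_entropy : Continuous (entropy (d := d)) :=
  continuous_finsetSum _ fun j _ =>
    (continuous_hypent.comp (continuous_const.mul (continuous_apply j))).div_const _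

lemma entropy_nonneg (v : Fin d → ℝ) : 0 ≤ entropy v :=
  Finset.sum_nonneg fun _ _ => div_nonneg (hypent_nonneg _) (Nat.cast_nonneg _)

lemma entropy_le (hd : 0 < d) {v : Fin d → ℝ} (hv : ∑ j, |v j| ≤ 1) :
    entropy v ≤ 2 * Real.log (1 + d) := by
  have hd' : (0 : ℝ) < d := by exact_mod_cast hd
  have hlog : 0 ≤ Real.log (1 + d) := Real.log_nonneg (by linarith)
  have h1 : ∀ j, hypent (d * v j) / d ≤ |v j| * (2 * Real.log (1 + d)) := fun j => by
    have hj : |v j| ≤ 1 :=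
      (Finset.single_le_sum (f := fun j => |v j|) (fun _ _ => abs_nonneg _)
        (Finset.mem_univ j)).trans hv
    have habs : |(d : ℝ) * v j| = d * |v j| := by rw [abs_mul, abs_of_pos hd']
    have := hypent_le (t := d * v j) (D := d) (by rw [habs]; nlinarith)
    rw [div_le_iff₀ hd']
    rw [habs] at this
    linarith
  calc entropy v ≤ ∑ j, |v j| * (2 * Real.log (1 + d)) := Finset.sum_le_sum fun j _ => h1 j
    _ = (∑ j, |v j|) * (2 * Real.log (1 + d)) := by rw [Finset.sum_mul]
    _ ≤ 1 * (2 * Real.log (1 + d)) := by gcongr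
    _ = _ := one_mul _

/-- Strong convexity of the entropy with respect to the `1`-norm. -/
lemma entropy_midpoint (hd : 0 < d) {v w : Fin d → ℝ} (hv : ∑ j, |v j| ≤ 1)
    (hw : ∑ j, |w j| ≤ 1) :
    (∑ j, |v j - w j|) ^ 2 / 24 ≤ 1 / 2 * entropy v + 1 / 2 * entropy w -
      entropy (fun j => 1 / 2 * v j + 1 / 2 * w j) := by
  have hd' : (0 : ℝ) < d := by exact_mod_cast hd
  have hterm : ∀ j, |v j - w j| ^ 2 / (8 * (|v j| + |w j| + 1 / d)) ≤
      1 / 2 * (hypent (d * v j) / d) + 1 / 2 * (hypent (d * w j) / d) -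
        hypent (d * (1 / 2 * v j + 1 / 2 * w j)) / d := fun j => by
    have := hypent_midpoint (d * v j) (d * w j)
    rw [abs_mul, abs_mul, abs_of_pos hd',
      show 1 / 2 * (d * v j) + 1 / 2 * (d * w j) = d * (1 / 2 * v j + 1 / 2 * w j) by ring] at this
    rw [show |v j - w j| ^ 2 / (8 * (|v j| + |w j| + 1 / d)) =
      (d * v j - d * w j) ^ 2 / (8 * (d * |v j| + d * |w j| + 1)) / d by
        rw [sq_abs]; field_simp]
    calc _ ≤ (1 / 2 * hypent (d * v j) + 1 / 2 * hypent (d * w j) -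
          hypent (d * (1 / 2 * v j + 1 / 2 * w j))) / d := by gcongr
      _ = _ := by ring
  -- Cauchy–Schwarz with the inverse curvatures as weights. The scaling by `d` inside `entropy`
  -- makes the offsets `1 / d`, so the weights sum to at most `8 * (1 + 1 + 1)`.
  have hcs := Finset.sq_sum_div_le_sum_sq_div Finset.univ (fun j => |v j - w j|)
    (g := fun j => 8 * (|v j| + |w j| + 1 / d)) (fun _ _ => by positivity)
  have hden : ∑ j, 8 * (|v j| + |w j| + 1 / (d : ℝ)) ≤ 24 := by
    rw [← Finset.mul_sum, Finset.sum_add_distrib, Finset.sum_add_distrib]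
    have : ∑ _j : Fin d, 1 / (d : ℝ) = 1 := by simp; field_simp
    linarith
  have hden0 : 0 < ∑ j, 8 * (|v j| + |w j| + 1 / (d : ℝ)) := by
    have : Nonempty (Fin d) := ⟨⟨0, hd⟩⟩
    exact Finset.sum_pos (fun j _ => by positivity) Finset.univ_nonempty
  calc (∑ j, |v j - w j|) ^ 2 / 24
      ≤ (∑ j, |v j - w j|) ^ 2 / ∑ j, 8 * (|v j| + |w j| + 1 / (d : ℝ)) := by gcongr
    _ ≤ ∑ j, |v j - w j| ^ 2 / (8 * (|v j| + |w j| + 1 / (d : ℝ))) := hcs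
    _ ≤ _ := Finset.sum_le_sum fun j _ => hterm j
    _ = _ := by
      simp only [entropy, Finset.sum_sub_distrib, Finset.sum_add_distrib, ← Finset.mul_sum]

end Entropy

end StochOpt
end

noncomputable section

namespace StochOpt

/-! ### The mirror geometry that combines the three norms. -/

section Geometry

/-- The space of parameters: one block for each of the three geometries. -/
abbrev Blocks (d : ℕ) : Type := (Fin d → ℝ) × (Fin d → ℝ) × (Fin d → ℝ)

/-- The product of the unit balls of the `2`-norm, the `1`-norm and the `2`-norm. -/
def unitBlocks (d : ℕ) : Set (Blocks d) :=
  {v | ∑ j, v.1 j ^ 2 ≤ 1 ∧ ∑ j, |v.2.1 j| ≤ 1 ∧ ∑ j, v.2.2 j ^ 2 ≤ 1}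

/-- A linear parametrization of `ℝ^d` by `Blocks d` with a regularizer that is strongly convex with
respect to the squared gauge `γ` of gradients. -/
structure MirrorGeom (d : ℕ) (n lam : ℝ) where
  A : Blocks d →ₗ[ℝ] Vec d
  ψ : Blocks d → ℝ
  γ : Vec d → ℝ
  a : ℝ
  τ : ℝ
  a_pos : 0 < a
  τ_pos : 0 < τ
  ψ_cont : Continuous ψ
  ψ_nonneg : ∀ v, 0 ≤ ψ v
  ψ_le : ∀ v ∈ unitBlocks d, ψ v ≤ 4 * n
  γ_nonneg : ∀ g, 0 ≤ γ g
  γ_add : ∀ g h, γ (g + h) ≤ 2 * γ g + 2 * γ h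
  -- Strong convexity in midpoint form: it requires neither a derivative of `ψ` nor a norm on the
  -- blocks.
  gap : ∀ g, ∀ v ∈ unitBlocks d, ∀ w ∈ unitBlocks d, (inner ℝ g (A (v - w))) ^ 2 ≤
    72 * γ g * (1 / 2 * ψ v + 1 / 2 * ψ w - ψ ((1 / 2 : ℝ) • v + (1 / 2 : ℝ) • w))
  gap_nonneg : ∀ v ∈ unitBlocks d, ∀ w ∈ unitBlocks d,
    ψ ((1 / 2 : ℝ) • v + (1 / 2 : ℝ) • w) ≤ 1 / 2 * ψ v + 1 / 2 * ψ w
  small : ∀ g, ∀ v ∈ unitBlocks d, (inner ℝ g (A v)) ^ 2 ≤ 4 * (n / lam) * γ g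
  norm_sq_le : ∀ g, ‖g‖ ^ 2 ≤ a ^ 2 * γ g
  γ_quant : ∀ e : Vec d, (∀ j, |e j| ≤ τ) → γ e ≤ lam / n

variable {d : ℕ}

lemma inner_eq_sum (g x : Vec d) : inner ℝ g x = ∑ j, g j * x j := by
  rw [PiLp.inner_apply]
  exact Finset.sum_congr rfl fun j _ => by simp [mul_comm]

lemma norm_sq_eq_sum (g : Vec d) : ‖g‖ ^ 2 = ∑ j, g j ^ 2 := by
  rw [EuclideanSpace.norm_sq_eq]
  exact Finset.sum_congr rfl fun j _ => by simp

/-- The maximum of the absolute values of the coordinates. -/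
def supAbs (g : Vec d) : ℝ := normInf (fun j => g j)

lemma abs_le_supAbs (g : Vec d) (j : Fin d) : |g j| ≤ supAbs g := by
  simpa [supAbs, normInf] using norm_le_pi_norm (fun j => g j) j

lemma supAbs_nonneg (g : Vec d) : 0 ≤ supAbs g := norm_nonneg _

lemma supAbs_le {g : Vec d} {r : ℝ} (hr : 0 ≤ r) (h : ∀ j, |g j| ≤ r) : supAbs g ≤ r :=
  (pi_norm_le_iff_of_nonneg hr).2 fun j => by simpa using h j

lemma zero_mem_unitBlocks : (0 : Blocks d) ∈ unitBlocks d := by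
  simp [unitBlocks]

lemma convex_unitBlocks : Convex ℝ (unitBlocks d) := by
  have hsq : ConvexOn ℝ Set.univ (fun v : Fin d → ℝ => ∑ j, v j ^ 2) := by
    refine ⟨convex_univ, fun v _ w _ a b ha hb hab => ?_⟩
    simp only [smul_eq_mul, Finset.mul_sum, ← Finset.sum_add_distrib, Pi.add_apply, Pi.smul_apply]
    refine Finset.sum_le_sum fun j _ => ?_
    have := (even_two.convexOn_pow (𝕜 := ℝ)).2 (Set.mem_univ (v j)) (Set.mem_univ (w j)) ha hb hab
    simpa using this
  have habs : ConvexOn ℝ Set.univ (fun v : Fin d → ℝ => ∑ j, |v j|) := by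
    refine ⟨convex_univ, fun v _ w _ a b ha hb hab => ?_⟩
    simp only [smul_eq_mul, Finset.mul_sum, ← Finset.sum_add_distrib, Pi.add_apply, Pi.smul_apply]
    refine Finset.sum_le_sum fun j _ => (abs_add_le _ _).trans ?_
    rw [abs_mul, abs_mul, abs_of_nonneg ha, abs_of_nonneg hb]
  intro v hv w hw a b ha hb hab
  have aux : ∀ {F : (Fin d → ℝ) → ℝ}, ConvexOn ℝ Set.univ F → ∀ {x y : Fin d → ℝ},
      F x ≤ 1 → F y ≤ 1 → F (a • x + b • y) ≤ 1 := fun hF x y hx hy => by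
    have := hF.2 (Set.mem_univ x) (Set.mem_univ y) ha hb hab
    simp only [smul_eq_mul] at this
    nlinarith
  exact ⟨aux hsq hv.1 hw.1, aux habs hv.2.1 hw.2.1, aux hsq hv.2.2 hw.2.2⟩

lemma neg_mem_unitBlocks {v : Blocks d} (hv : v ∈ unitBlocks d) : -v ∈ unitBlocks d := by
  simpa [unitBlocks] using hv

lemma isCompact_unitBlocks : IsCompact (unitBlocks d) := by
  refine Metric.isCompact_of_isClosed_isBounded ?_ ?_
  · refine IsClosed.inter ?_ (IsClosed.inter ?_ ?_)
    · exact isClosed_le (f := fun v : Blocks d => ∑ j, v.1 j ^ 2) (by fun_prop) continuous_const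
    · exact isClosed_le (f := fun v : Blocks d => ∑ j, |v.2.1 j|) (by fun_prop) continuous_const
    · exact isClosed_le (f := fun v : Blocks d => ∑ j, v.2.2 j ^ 2) (by fun_prop)
        continuous_const
  · refine (Metric.isBounded_closedBall (x := (0 : Blocks d)) (r := 1)).subset ?_
    intro v hv
    rw [mem_closedBall_zero_iff]
    have aux : ∀ x : Fin d → ℝ, ∑ j, x j ^ 2 ≤ 1 → ‖x‖ ≤ 1 := fun x hx => by
      refine (pi_norm_le_iff_of_nonneg zero_le_one).2 fun j => ?_
      rw [Real.norm_eq_abs, ← sq_le_one_iff_abs_le_one]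
      exact (Finset.single_le_sum (f := fun j => x j ^ 2) (fun _ _ => sq_nonneg _)
        (Finset.mem_univ j)).trans hx
    have aux' : ‖v.2.1‖ ≤ 1 := by
      refine (pi_norm_le_iff_of_nonneg zero_le_one).2 fun j => ?_
      rw [Real.norm_eq_abs]
      exact (Finset.single_le_sum (f := fun j => |v.2.1 j|) (fun _ _ => abs_nonneg _)
        (Finset.mem_univ j)).trans hv.2.1
    exact max_le (aux _ hv.1) (max_le aux' (aux _ hv.2.2))

/-- The linear map of the standard geometry, with scales `a`, `b` and coordinate scales `w`. -/
def blockMap (n lam lamd a b : ℝ) (w : Fin d → ℝ) : Blocks d →ₗ[ℝ] Vec d where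
  -- The square roots express the body in units of the rate: with `a` of order `L`, the first block
  -- at radius `ρ` is the ball on which `L ‖x‖ √(lam / n)` is of order at most `ρ`.
  toFun v := WithLp.toLp 2 fun j => √(n / lam) / a * v.1 j + √(n / lamd) / b * v.2.1 j +
    √(n / lam) / (√(w j) * √(∑ i, w i)) * v.2.2 j
  map_add' v v' := by ext j; simp; ring
  map_smul' c v := by ext j; simp; ring

/-- The squared gauge of gradients of the standard geometry. -/
def gauge (a b : ℝ) (w : Fin d → ℝ) (g : Vec d) : ℝ :=
  -- In the last term, `|g j| ≤ w j` bounds the sum by one. The dual ellipsoid `∑ j, w j * (∑ i, w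
  -- i) * x j ^ 2 ≤ 1` contains the ∞-norm ball of radius `1 / ∑ i, w i`, which yields the product
  -- of a 1-norm and an ∞-norm.
  ‖g‖ ^ 2 / a ^ 2 + supAbs g ^ 2 / b ^ 2 + ∑ j, g j ^ 2 / (w j * ∑ i, w i)

/-- The regularizer of the standard geometry. -/
def regularizer (n : ℝ) (v : Blocks d) : ℝ :=
  n * (∑ j, v.1 j ^ 2 + entropy v.2.1 / Real.log (1 + d) + ∑ j, v.2.2 j ^ 2)

/-- Cauchy–Schwarz on the first and third blocks, Hölder on the second; the factor 3 is from
squaring a sum of three terms. -/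
lemma inner_blockMap_sq_le {n lam lamd a b : ℝ} {w : Fin d → ℝ} (hn : 0 ≤ n) (hlam : 0 ≤ lam)
    (hlamd : 0 ≤ lamd) (hw : ∀ j, 0 < w j) (g : Vec d) (v : Blocks d) :
    (inner ℝ g (blockMap n lam lamd a b w v)) ^ 2 ≤
      3 * (n / lam * (‖g‖ ^ 2 / a ^ 2) * ∑ j, v.1 j ^ 2 +
        n / lamd * (supAbs g ^ 2 / b ^ 2) * (∑ j, |v.2.1 j|) ^ 2 +
        n / lam * (∑ j, g j ^ 2 / (w j * ∑ i, w i)) * ∑ j, v.2.2 j ^ 2) := by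
  have hW : 0 ≤ ∑ i, w i := Finset.sum_nonneg fun i _ => (hw i).le
  have e : inner ℝ g (blockMap n lam lamd a b w v) =
      √(n / lam) / a * (∑ j, g j * v.1 j) + √(n / lamd) / b * (∑ j, g j * v.2.1 j) +
        ∑ j, (√(n / lam) / (√(w j) * √(∑ i, w i)) * g j) * v.2.2 j := by
    rw [inner_eq_sum, Finset.mul_sum, Finset.mul_sum, ← Finset.sum_add_distrib,
      ← Finset.sum_add_distrib]
    refine Finset.sum_congr rfl fun j _ => ?_
    simp only [blockMap, LinearMap.coe_mk, AddHom.coe_mk]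
    ring
  have h1 : (√(n / lam) / a * (∑ j, g j * v.1 j)) ^ 2 ≤
      n / lam * (‖g‖ ^ 2 / a ^ 2) * ∑ j, v.1 j ^ 2 := by
    have := Finset.sum_mul_sq_le_sq_mul_sq Finset.univ (fun j => g j) v.1
    rw [mul_pow, div_pow, Real.sq_sqrt (by positivity), norm_sq_eq_sum]
    calc _ ≤ n / lam / a ^ 2 * ((∑ j, g j ^ 2) * ∑ j, v.1 j ^ 2) := by gcongr
      _ = _ := by ring
  have h2 : (√(n / lamd) / b * (∑ j, g j * v.2.1 j)) ^ 2 ≤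
      n / lamd * (supAbs g ^ 2 / b ^ 2) * (∑ j, |v.2.1 j|) ^ 2 := by
    have h : |∑ j, g j * v.2.1 j| ≤ supAbs g * ∑ j, |v.2.1 j| := by
      refine (Finset.abs_sum_le_sum_abs _ _).trans ?_
      rw [Finset.mul_sum]
      refine Finset.sum_le_sum fun j _ => ?_
      rw [abs_mul]
      exact mul_le_mul_of_nonneg_right (abs_le_supAbs g j) (abs_nonneg _)
    have h' : (∑ j, g j * v.2.1 j) ^ 2 ≤ (supAbs g * ∑ j, |v.2.1 j|) ^ 2 := by
      rw [← sq_abs]; gcongr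
    rw [mul_pow, div_pow, Real.sq_sqrt (by positivity)]
    calc _ ≤ n / lamd / b ^ 2 * (supAbs g * ∑ j, |v.2.1 j|) ^ 2 := by gcongr
      _ = _ := by ring
  have h3 : (∑ j, (√(n / lam) / (√(w j) * √(∑ i, w i)) * g j) * v.2.2 j) ^ 2 ≤
      n / lam * (∑ j, g j ^ 2 / (w j * ∑ i, w i)) * ∑ j, v.2.2 j ^ 2 := by
    refine (Finset.sum_mul_sq_le_sq_mul_sq Finset.univ _ _).trans (le_of_eq ?_)
    congr 1
    rw [Finset.mul_sum]
    refine Finset.sum_congr rfl fun j _ => ?_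
    rw [mul_pow, div_pow, mul_pow, Real.sq_sqrt (by positivity), Real.sq_sqrt (hw j).le,
      Real.sq_sqrt hW]
    ring
  rw [e]
  set x := √(n / lam) / a * (∑ j, g j * v.1 j)
  set y := √(n / lamd) / b * (∑ j, g j * v.2.1 j)
  set z := ∑ j, (√(n / lam) / (√(w j) * √(∑ i, w i)) * g j) * v.2.2 j
  nlinarith [sq_nonneg (x - y), sq_nonneg (y - z), sq_nonneg (x - z)]

lemma sum_sq_midpoint (x y : Fin d → ℝ) :
    (∑ j, (x j - y j) ^ 2) / 4 = 1 / 2 * ∑ j, x j ^ 2 + 1 / 2 * ∑ j, y j ^ 2 -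
      ∑ j, (1 / 2 * x j + 1 / 2 * y j) ^ 2 := by
  rw [Finset.mul_sum, Finset.mul_sum, Finset.sum_div, ← Finset.sum_add_distrib,
    ← Finset.sum_sub_distrib]
  exact Finset.sum_congr rfl fun j _ => by ring

lemma regularizer_midpoint (hd : 0 < d) {n : ℝ} (hn : 0 ≤ n) {v v' : Blocks d}
    (hv : v ∈ unitBlocks d) (hv' : v' ∈ unitBlocks d) :
    n * ((∑ j, (v.1 j - v'.1 j) ^ 2) / 4 +
      (∑ j, |v.2.1 j - v'.2.1 j|) ^ 2 / 24 / Real.log (1 + d) +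
      (∑ j, (v.2.2 j - v'.2.2 j) ^ 2) / 4) ≤
    1 / 2 * regularizer n v + 1 / 2 * regularizer n v' -
      regularizer n ((1 / 2 : ℝ) • v + (1 / 2 : ℝ) • v') := by
  have hd' : (0 : ℝ) < d := by exact_mod_cast hd
  have hl := Real.log_pos (show (1 : ℝ) < 1 + d by linarith)
  have e2' : (∑ j, |v.2.1 j - v'.2.1 j|) ^ 2 / 24 / Real.log (1 + d) ≤
      (1 / 2 * entropy v.2.1 + 1 / 2 * entropy v'.2.1 -
        entropy (fun j => 1 / 2 * v.2.1 j + 1 / 2 * v'.2.1 j)) / Real.log (1 + d) :=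
    div_le_div_of_nonneg_right (entropy_midpoint hd hv.2.1 hv'.2.1) hl.le
  rw [sum_sq_midpoint v.1 v'.1, sum_sq_midpoint v.2.2 v'.2.2]
  refine (mul_le_mul_of_nonneg_left (add_le_add (add_le_add le_rfl e2') le_rfl) hn).trans
    (le_of_eq ?_)
  have r0 : ((1 / 2 : ℝ) • v + (1 / 2 : ℝ) • v').1 =
    fun j => 1 / 2 * v.1 j + 1 / 2 * v'.1 j := rfl
  have r1 : ((1 / 2 : ℝ) • v + (1 / 2 : ℝ) • v').2.1 =
    fun j => 1 / 2 * v.2.1 j + 1 / 2 * v'.2.1 j := rfl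
  have r2 : ((1 / 2 : ℝ) • v + (1 / 2 : ℝ) • v').2.2 =
    fun j => 1 / 2 * v.2.2 j + 1 / 2 * v'.2.2 j := rfl
  simp only [regularizer, r0, r1, r2]
  ring

/-- The constant is `3 * 24`. The factor `log (1 + d)` lost by the normalized entropy is absorbed by
`lamd`, which is why only the second block carries `lamd`. -/
lemma gauge_gap (hd : 0 < d) {n lam lamd a b : ℝ} {w : Fin d → ℝ} (hn : 0 < n)
    (hlam : 1 / 2 ≤ lam) (hlamd : lam ≤ lamd) (hlog : Real.log (1 + d) ≤ lamd)
    (hw : ∀ j, 0 < w j) (g : Vec d) {v v' : Blocks d} (hv : v ∈ unitBlocks d)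
    (hv' : v' ∈ unitBlocks d) :
    (inner ℝ g (blockMap n lam lamd a b w (v - v'))) ^ 2 ≤ 72 * gauge a b w g *
      (1 / 2 * regularizer n v + 1 / 2 * regularizer n v' -
        regularizer n ((1 / 2 : ℝ) • v + (1 / 2 : ℝ) • v')) := by
  have hl0 : 0 < lam := by linarith
  have hld0 : 0 < lamd := by linarith
  have hd' : (0 : ℝ) < d := by exact_mod_cast hd
  have hl := Real.log_pos (show (1 : ℝ) < 1 + d by linarith)
  have hW : 0 ≤ ∑ i, w i := Finset.sum_nonneg fun i _ => (hw i).le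
  have hbd := inner_blockMap_sq_le (a := a) (b := b) hn.le hl0.le hld0.le hw g (v - v')
  have hG := regularizer_midpoint hd hn.le hv hv'
  have p1 : 0 ≤ ‖g‖ ^ 2 / a ^ 2 := by positivity
  have p2 : 0 ≤ supAbs g ^ 2 / b ^ 2 := by positivity
  have p3 : 0 ≤ ∑ j, g j ^ 2 / (w j * ∑ i, w i) :=
    Finset.sum_nonneg fun j _ => by have := hw j; positivity
  have q1 : 0 ≤ ∑ j, (v.1 j - v'.1 j) ^ 2 := by positivity
  have q3 : 0 ≤ ∑ j, (v.2.2 j - v'.2.2 j) ^ 2 := by positivity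
  refine hbd.trans ?_
  unfold gauge
  simp only [Prod.fst_sub, Prod.snd_sub, Pi.sub_apply]
  generalize ‖g‖ ^ 2 / a ^ 2 = γ1 at *
  generalize supAbs g ^ 2 / b ^ 2 = γ2 at *
  generalize ∑ j, g j ^ 2 / (w j * ∑ i, w i) = γ3 at *
  generalize ∑ j, (v.1 j - v'.1 j) ^ 2 = Δ1 at *
  generalize ∑ j, |v.2.1 j - v'.2.1 j| = Δ2 at *
  generalize ∑ j, (v.2.2 j - v'.2.2 j) ^ 2 = Δ3 at *
  generalize 1 / 2 * regularizer n v + 1 / 2 * regularizer n v' -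
        regularizer n ((1 / 2 : ℝ) • v + (1 / 2 : ℝ) • v') = G at *
  generalize Real.log (1 + d) = l at *
  have hE : 0 ≤ n * (Δ2 ^ 2 / 24 / l) := by positivity
  have hn1 : 0 ≤ n * Δ1 := by positivity
  have hn3 : 0 ≤ n * Δ3 := by positivity
  have g1 : n * Δ1 ≤ 4 * G := by linarith
  have g3 : n * Δ3 ≤ 4 * G := by linarith
  have hG0 : 0 ≤ G := by linarith
  have g2 : n * Δ2 ^ 2 ≤ 24 * l * G := by
    have : n * (Δ2 ^ 2 / 24 / l) ≤ G := by linarith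
    have := mul_le_mul_of_nonneg_left this (show 0 ≤ 24 * l by positivity)
    refine le_trans (le_of_eq ?_) this
    field_simp
  have f1 : n / lam * Δ1 ≤ 24 * G := by
    rw [div_mul_eq_mul_div, div_le_iff₀ hl0]; nlinarith
  have f3 : n / lam * Δ3 ≤ 24 * G := by
    rw [div_mul_eq_mul_div, div_le_iff₀ hl0]; nlinarith
  have f2 : n / lamd * Δ2 ^ 2 ≤ 24 * G := by
    rw [div_mul_eq_mul_div, div_le_iff₀ hld0]; nlinarith
  have k1 := mul_le_mul_of_nonneg_left f1 p1
  have k2 := mul_le_mul_of_nonneg_left f2 p2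
  have k3 := mul_le_mul_of_nonneg_left f3 p3
  linarith

/-- The geometry that combines the three norms. -/
def stdGeom (hd : 0 < d) {n lam lamd a b : ℝ} {w : Fin d → ℝ} (hn : 0 < n) (hlam : 1 / 2 ≤ lam)
    (hlamd : lam ≤ lamd) (hlog : Real.log (1 + d) ≤ lamd) (ha : 0 < a) (hb : 0 < b)
    (hw : ∀ j, 0 < w j) : MirrorGeom d n lam where
  A := blockMap n lam lamd a b w
  ψ := regularizer n
  γ := gauge a b w
  a := a
  -- The mesh for which coordinate errors of size `τ` have gauge at most `lam / n`.
  τ := √(lam / n / (d / a ^ 2 + 1 / b ^ 2 + ∑ j, 1 / (w j * ∑ i, w i)))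
  a_pos := ha
  τ_pos := by
    have hW : 0 ≤ ∑ i, w i := Finset.sum_nonneg fun i _ => (hw i).le
    have h3 : 0 ≤ ∑ j, 1 / (w j * ∑ i, w i) :=
      Finset.sum_nonneg fun j _ => by have := hw j; positivity
    have : 0 < lam := by linarith
    positivity
  ψ_cont := by
    have := continuous_entropy (d := d)
    unfold regularizer
    fun_prop
  ψ_nonneg v := by
    have hd' : (0 : ℝ) < d := by exact_mod_cast hd
    have := Real.log_nonneg (show (1 : ℝ) ≤ 1 + d by linarith)
    have := entropy_nonneg v.2.1
    unfold regularizer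
    positivity
  ψ_le v hv := by
    have hd' : (0 : ℝ) < d := by exact_mod_cast hd
    have hl := Real.log_pos (show (1 : ℝ) < 1 + d by linarith)
    have h2 : entropy v.2.1 / Real.log (1 + d) ≤ 2 := by
      rw [div_le_iff₀ hl]; exact entropy_le hd hv.2.1
    unfold regularizer
    nlinarith [hv.1, hv.2.2]
  γ_nonneg g := by
    have h3 : 0 ≤ ∑ j, g j ^ 2 / (w j * ∑ i, w i) :=
      Finset.sum_nonneg fun j _ => by
        have := hw j
        have hW : 0 ≤ ∑ i, w i := Finset.sum_nonneg fun i _ => (hw i).le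
        positivity
    unfold gauge
    positivity
  γ_add g h := by
    have hW : 0 ≤ ∑ i, w i := Finset.sum_nonneg fun i _ => (hw i).le
    have h1 : ‖g + h‖ ^ 2 ≤ 2 * ‖g‖ ^ 2 + 2 * ‖h‖ ^ 2 := by
      nlinarith [norm_add_le g h, norm_nonneg (g + h), sq_nonneg (‖g‖ - ‖h‖)]
    have h2 : supAbs (g + h) ^ 2 ≤ 2 * supAbs g ^ 2 + 2 * supAbs h ^ 2 := by
      have : supAbs (g + h) ≤ supAbs g + supAbs h :=
        norm_add_le (fun j => g j) (fun j => h j)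
      nlinarith [supAbs_nonneg (g + h), sq_nonneg (supAbs g - supAbs h)]
    have h3 : ∑ j, (g + h) j ^ 2 / (w j * ∑ i, w i) ≤
        2 * ∑ j, g j ^ 2 / (w j * ∑ i, w i) + 2 * ∑ j, h j ^ 2 / (w j * ∑ i, w i) := by
      rw [Finset.mul_sum, Finset.mul_sum, ← Finset.sum_add_distrib]
      refine Finset.sum_le_sum fun j _ => ?_
      have := hw j
      rw [← mul_div_assoc, ← mul_div_assoc, ← add_div]
      refine div_le_div_of_nonneg_right ?_ (by positivity)
      have e : (g + h) j = g j + h j := rfl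
      rw [e]
      nlinarith [sq_nonneg (g j - h j)]
    have h1' := div_le_div_of_nonneg_right h1 (sq_nonneg a)
    have h2' := div_le_div_of_nonneg_right h2 (sq_nonneg b)
    rw [add_div, mul_div_assoc, mul_div_assoc] at h1' h2'
    unfold gauge
    linarith
  gap g v hv v' hv' := gauge_gap hd hn hlam hlamd hlog hw g hv hv'
  gap_nonneg v hv v' hv' := by
    have hd' : (0 : ℝ) < d := by exact_mod_cast hd
    have hl := Real.log_pos (show (1 : ℝ) < 1 + d by linarith)
    refine sub_nonneg.1 (le_trans ?_ (regularizer_midpoint hd hn.le hv hv'))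
    positivity
  small g v hv := by
    have hl0 : 0 < lam := by linarith
    have hld0 : 0 < lamd := by linarith
    have hW : 0 ≤ ∑ i, w i := Finset.sum_nonneg fun i _ => (hw i).le
    have hbd := inner_blockMap_sq_le (a := a) (b := b) hn.le hl0.le hld0.le hw g v
    have hgauge : gauge a b w g = ‖g‖ ^ 2 / a ^ 2 + supAbs g ^ 2 / b ^ 2 +
      ∑ j, g j ^ 2 / (w j * ∑ i, w i) := rfl
    rw [hgauge]
    set γ1 := ‖g‖ ^ 2 / a ^ 2
    set γ2 := supAbs g ^ 2 / b ^ 2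
    set γ3 := ∑ j, g j ^ 2 / (w j * ∑ i, w i) with hγ3
    have p1 : 0 ≤ γ1 := by positivity
    have p2 : 0 ≤ γ2 := by positivity
    have p3 : 0 ≤ γ3 := Finset.sum_nonneg fun j _ => by have := hw j; positivity
    have hnl : 0 ≤ n / lam := by positivity
    have hnl2 : n / lamd ≤ n / lam := by gcongr
    have hnl3 : 0 ≤ n / lamd := by positivity
    refine hbd.trans ?_
    have k1 : n / lam * γ1 * ∑ j, v.1 j ^ 2 ≤ n / lam * γ1 :=
      mul_le_of_le_one_right (by positivity) hv.1
    have k3 : n / lam * γ3 * ∑ j, v.2.2 j ^ 2 ≤ n / lam * γ3 :=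
      mul_le_of_le_one_right (by positivity) hv.2.2
    have k2 : n / lamd * γ2 * (∑ j, |v.2.1 j|) ^ 2 ≤ n / lam * γ2 := by
      calc _ ≤ n / lamd * γ2 := mul_le_of_le_one_right (by positivity)
            (pow_le_one₀ (by positivity) hv.2.1)
        _ ≤ _ := by gcongr
    nlinarith [mul_nonneg hnl p1, mul_nonneg hnl p2, mul_nonneg hnl p3]
  norm_sq_le g := by
    have hW : 0 ≤ ∑ i, w i := Finset.sum_nonneg fun i _ => (hw i).le
    have p2 : 0 ≤ supAbs g ^ 2 / b ^ 2 := by positivity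
    have p3 : 0 ≤ ∑ j, g j ^ 2 / (w j * ∑ i, w i) :=
      Finset.sum_nonneg fun j _ => by have := hw j; positivity
    have e : ‖g‖ ^ 2 = a ^ 2 * (‖g‖ ^ 2 / a ^ 2) := by field_simp
    unfold gauge
    nlinarith [sq_nonneg a]
  γ_quant e he := by
    have hl0 : 0 < lam := by linarith
    have hW : 0 ≤ ∑ i, w i := Finset.sum_nonneg fun i _ => (hw i).le
    have h3 : 0 ≤ ∑ j, 1 / (w j * ∑ i, w i) :=
      Finset.sum_nonneg fun j _ => by have := hw j; positivity
    set κ := d / a ^ 2 + 1 / b ^ 2 + ∑ j, 1 / (w j * ∑ i, w i) with hκ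
    have hκ0 : 0 < κ := by positivity
    set t := √(lam / n / κ) with ht
    have ht0 : 0 ≤ t := Real.sqrt_nonneg _
    have ht2 : t ^ 2 * κ = lam / n := by
      rw [ht, Real.sq_sqrt (by positivity)]; field_simp
    have hej : ∀ j, e j ^ 2 ≤ t ^ 2 := fun j => by
      rw [← sq_abs]; gcongr; exact he j
    have k1 : ‖e‖ ^ 2 / a ^ 2 ≤ t ^ 2 * (d / a ^ 2) := by
      rw [norm_sq_eq_sum, ← mul_div_assoc]
      gcongr
      calc ∑ j, e j ^ 2 ≤ ∑ _j : Fin d, t ^ 2 := Finset.sum_le_sum fun j _ => hej j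
        _ = t ^ 2 * d := by simp [mul_comm]
    have k2 : supAbs e ^ 2 / b ^ 2 ≤ t ^ 2 * (1 / b ^ 2) := by
      rw [← mul_div_assoc, mul_one]
      gcongr
      · exact supAbs_nonneg e
      · exact supAbs_le ht0 he
    have k3 : ∑ j, e j ^ 2 / (w j * ∑ i, w i) ≤ t ^ 2 * ∑ j, 1 / (w j * ∑ i, w i) := by
      rw [Finset.mul_sum]
      refine Finset.sum_le_sum fun j _ => ?_
      have := hw j
      rw [← mul_div_assoc, mul_one]
      exact div_le_div_of_nonneg_right (hej j) (by positivity)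
    rw [← ht2, hκ]
    unfold gauge
    linarith

end Geometry

end StochOpt
end

noncomputable section

namespace StochOpt

/-! ### Regret of the regularized leader, with quantized gradients and rounded points. -/

section Leader

variable {d : ℕ} {n lam : ℝ}

/-- The gradient inequality of convex functions on a convex set. -/
lemma convexOn_gradient_le {X : Set (Vec d)} {f : Vec d → ℝ} (hf : ConvexOn ℝ X f) {x u : Vec d}
    (hx : x ∈ X) (hu : u ∈ X) (hd : DifferentiableAt ℝ f x) :
    f x - f u ≤ inner ℝ (gradient f x) (x - u) := by
  have hg : HasDerivAt (fun t : ℝ => f (x + t • (u - x))) (inner ℝ (gradient f x) (u - x)) 0 := by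
    have h1 : HasFDerivAt f (InnerProductSpace.toDual ℝ _ (gradient f x))
        (x + (0 : ℝ) • (u - x)) := by
      simpa using hd.hasGradientAt.hasFDerivAt
    have h2 : HasDerivAt (fun t : ℝ => x + t • (u - x)) (u - x) 0 := by
      simpa using ((hasDerivAt_id (0 : ℝ)).smul_const (u - x)).const_add x
    have h3 := h1.comp_hasDerivAt (0 : ℝ) h2
    rw [InnerProductSpace.toDual_apply_apply] at h3
    exact h3
  have hlim := hg.tendsto_slope_zero_right
  have hle : inner ℝ (gradient f x) (u - x) ≤ f u - f x := by
    refine le_of_tendsto hlim ?_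
    filter_upwards [Ioo_mem_nhdsGT (show (0 : ℝ) < 1 by norm_num)] with t ht
    have hc := hf.2 hx hu (show 0 ≤ 1 - t by linarith [ht.2]) ht.1.le (by ring)
    have e : (1 - t) • x + t • u = x + t • (u - x) := by
      rw [smul_sub, sub_smul, one_smul]; abel
    rw [e] at hc
    simp only [smul_eq_mul, zero_add, zero_smul, add_zero] at hc ⊢
    rw [inv_mul_le_iff₀ ht.1]
    linarith
  have : inner ℝ (gradient f x) (x - u) = - inner ℝ (gradient f x) (u - x) := by
    rw [← inner_neg_right, neg_sub]
  linarith

lemma convexOn_sub_le_norm {X : Set (Vec d)} {f : Vec d → ℝ} (hf : ConvexOn ℝ X f) {x u : Vec d}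
    (hx : x ∈ X) (hu : u ∈ X) (hd : DifferentiableAt ℝ f x) {L : ℝ} (hL : ‖gradient f x‖ ≤ L) :
    f x - f u ≤ L * ‖x - u‖ :=
  (convexOn_gradient_le hf hx hu hd).trans ((real_inner_le_norm _ _).trans (by gcongr))

variable (M : MirrorGeom d n lam) (X : Set (Vec d)) (D : ℕ → Vec d) (Lhat : ℝ)

/-- The parameters of points of `X` at scale `ρ` around `c`. -/
def feasible (c : Vec d) (ρ : ℝ) : Set (Blocks d) :=
  {v | v ∈ unitBlocks d ∧ c + ρ • M.A v ∈ X}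

open Classical in
/-- The regularized leader for the accumulated gradient `θ`. -/
def leader (c : Vec d) (ρ : ℝ) (θ : Vec d) : Blocks d :=
  if h : ∃ v ∈ feasible M X c ρ,
      IsMinOn (fun v => inner ℝ θ (M.A v) + M.ψ v) (feasible M X c ρ) v
  then h.choose else 0

variable {M X D Lhat}

lemma convex_feasible (hX : Convex ℝ X) (c : Vec d) (ρ : ℝ) : Convex ℝ (feasible M X c ρ) := by
  intro v hv w hw a b ha hb hab
  refine ⟨convex_unitBlocks hv.1 hw.1 ha hb hab, ?_⟩
  have := hX hv.2 hw.2 ha hb hab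
  convert this using 1
  have hc : c = a • c + b • c := by rw [← add_smul, hab, one_smul]
  rw [map_add, map_smul, map_smul, smul_add, smul_add, smul_add, smul_comm a ρ, smul_comm b ρ]
  nth_rewrite 1 [hc]
  abel

lemma zero_mem_feasible {c : Vec d} (hc : c ∈ X) (ρ : ℝ) : (0 : Blocks d) ∈ feasible M X c ρ :=
  ⟨zero_mem_unitBlocks, by simpa using hc⟩

lemma isCompact_feasible (hX : IsClosed X) (c : Vec d) (ρ : ℝ) :
    IsCompact (feasible M X c ρ) := by
  have hcont : Continuous fun v => c + ρ • M.A v :=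
    continuous_const.add ((LinearMap.continuous_of_finiteDimensional M.A).const_smul ρ)
  exact isCompact_unitBlocks.inter_right (hX.preimage hcont)

lemma leader_spec (hX : IsClosed X) {c : Vec d} (hc : c ∈ X) (ρ : ℝ) (θ : Vec d) :
    leader M X c ρ θ ∈ feasible M X c ρ ∧
      IsMinOn (fun v => inner ℝ θ (M.A v) + M.ψ v) (feasible M X c ρ) (leader M X c ρ θ) := by
  have hcont : Continuous fun v => inner ℝ θ (M.A v) + M.ψ v :=
    (continuous_const.inner (LinearMap.continuous_of_finiteDimensional M.A)).add M.ψ_cont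
  have h : ∃ v ∈ feasible M X c ρ,
      IsMinOn (fun v => inner ℝ θ (M.A v) + M.ψ v) (feasible M X c ρ) v :=
    (isCompact_feasible hX c ρ).exists_isMinOn ⟨0, zero_mem_feasible hc ρ⟩ hcont.continuousOn
  rw [leader, dif_pos h]
  exact h.choose_spec

/-- Regret of the regularized leader for linear losses. -/
lemma leader_regret (hX : IsClosed X) (hXc : Convex ℝ X) {c : Vec d} (hc : c ∈ X) (ρ : ℝ)
    (g θ : ℕ → Vec d) (h0 : θ 0 = 0) (hs : ∀ t, θ (t + 1) = θ t + g t) (N : ℕ)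
    {v : Blocks d} (hv : v ∈ feasible M X c ρ) :
    ∑ t ∈ Finset.range N, inner ℝ (g t) (M.A (leader M X c ρ (θ t))) ≤
      inner ℝ (θ N) (M.A v) + M.ψ v + 9 * ∑ t ∈ Finset.range N, M.γ (g t) := by
  induction N generalizing v with
  | zero => simpa [h0] using M.ψ_nonneg v
  | succ m ih =>
    obtain ⟨hl, hmin⟩ := leader_spec (M := M) hX hc ρ (θ m)
    set l := leader M X c ρ (θ m)
    -- Testing minimality of the leader at its midpoint with `v` yields a surplus of twice the
    -- convexity gap. The induction hypothesis is then used with the leader as comparator, not with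
    -- `v`.
    have hmid := hmin (convex_feasible hXc c ρ hl hv (show (0 : ℝ) ≤ 1 / 2 by norm_num)
      (show (0 : ℝ) ≤ 1 / 2 by norm_num) (by norm_num))
    have hgap := M.gap (g m) l hl.1 v hv.1
    simp only [Set.mem_ofPred_eq, map_add, map_smul, inner_add_right, inner_smul_right] at hmid
    have hi := ih hl
    set G := 1 / 2 * M.ψ l + 1 / 2 * M.ψ v - M.ψ ((1 / 2 : ℝ) • l + (1 / 2 : ℝ) • v)
    have hγ := M.γ_nonneg (g m)
    have hstep : inner ℝ (θ m) (M.A l) + M.ψ l ≤ inner ℝ (θ m) (M.A v) + M.ψ v - 2 * G := by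
      simp only [G]; linarith
    rw [map_sub, inner_sub_right] at hgap
    -- The constant 9 comes from `72 γ G = 4 (2 G) (9 γ) ≤ (2 G + 9 γ) ^ 2`; the term `2 G` is paid
    -- by the surplus.
    have hcross : inner ℝ (g m) (M.A l) - inner ℝ (g m) (M.A v) ≤ 2 * G + 9 * M.γ (g m) := by
      have hG : 0 ≤ G := sub_nonneg.2 (M.gap_nonneg l hl.1 v hv.1)
      refine le_of_sq_le_sq ?_ (by positivity)
      nlinarith [sq_nonneg (2 * G - 9 * M.γ (g m))]
    rw [Finset.sum_range_succ, Finset.sum_range_succ, hs, inner_add_left]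
    linarith

variable (M X D Lhat)

open Classical in
/-- The index of a point of the sequence `D` within distance `r` of `x`. -/
def nearIdx (x : Vec d) (r : ℝ) : ℕ :=
  if h : ∃ i, ‖x - D i‖ ≤ r then h.choose else 0

/-- The vector with quantized coordinates `k`. -/
def unquant (τ : ℝ) (k : Fin d → ℤ) : Vec d := WithLp.toLp 2 fun j => τ * k j

/-- Coordinatewise quantization with mesh `τ`. -/
def quant (τ : ℝ) (g : Vec d) : Fin d → ℤ := fun j => ⌊g j / τ⌋

/-- The point played for the quantized accumulated gradient `k`. -/
def playPt (c : Vec d) (ρ : ℝ) (k : Fin d → ℤ) : Vec d :=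
  c + ρ • M.A (leader M X c ρ (unquant M.τ k))

/-- The index of the point of `D` played for the quantized accumulated gradient `k`. -/
def playIdx (c : Vec d) (ρ : ℝ) (k : Fin d → ℤ) : ℕ :=
  -- The tolerance serves two purposes: multiplied by `Lhat` it changes a loss by at most `ρ`, and
  -- multiplied by `M.a` it is small in the geometry.
  nearIdx D (playPt M X c ρ k) (ρ / (Lhat + M.a))

/-- The quantized accumulated gradients along the loss functions `y`. -/
def gradState (c : Vec d) (ρ : ℝ) (y : ℕ → Vec d → ℝ) : ℕ → Fin d → ℤ
  | 0 => 0
  | t + 1 => gradState c ρ y t +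
      quant M.τ (gradient (y t) (D (playIdx M X D Lhat c ρ (gradState c ρ y t))))

variable {M X D Lhat}

lemma nearIdx_spec (hD : ∀ x ∈ X, ∀ ε > 0, ∃ i, ‖x - D i‖ ≤ ε) {x : Vec d} (hx : x ∈ X) {r : ℝ}
    (hr : 0 < r) : ‖x - D (nearIdx D x r)‖ ≤ r := by
  have h := hD x hx r hr
  rw [nearIdx, dif_pos h]
  exact h.choose_spec

lemma abs_sub_unquant_quant_le {τ : ℝ} (hτ : 0 < τ) (g : Vec d) (j : Fin d) :
    |(g - unquant τ (quant τ g)) j| ≤ τ := by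
  have e : (g - unquant τ (quant τ g)) j = τ * Int.fract (g j / τ) := by
    simp only [unquant, quant, PiLp.sub_apply, Int.fract]
    field_simp
  rw [e, abs_mul, abs_of_pos hτ, abs_of_nonneg (Int.fract_nonneg _)]
  nlinarith [Int.fract_lt_one (g j / τ)]

lemma unquant_add (τ : ℝ) (k l : Fin d → ℤ) : unquant τ (k + l) = unquant τ k + unquant τ l := by
  ext j; simp [unquant, mul_add]

lemma playPt_mem (hX : IsClosed X) {c : Vec d} (hc : c ∈ X) (ρ : ℝ) (k : Fin d → ℤ) :
    playPt M X c ρ k ∈ X := (leader_spec hX hc ρ _).1.2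

/-- Regret of the quantized algorithm for convex losses. -/
lemma gradState_regret (hn : 0 < n) (hlam : 0 < lam) (hlamn : lam ≤ n) (hX : IsClosed X)
    (hXc : Convex ℝ X) (hDX : ∀ i, D i ∈ X) (hD : ∀ x ∈ X, ∀ ε > 0, ∃ i, ‖x - D i‖ ≤ ε)
    (hL : 0 < Lhat) {c : Vec d} (hc : c ∈ X) {ρ : ℝ} (hρ : 0 < ρ) {N : ℕ} {y : ℕ → Vec d → ℝ}
    (hy : ∀ t < N, ConvexOn ℝ X (y t)) (hyd : ∀ t < N, ∀ x ∈ X, DifferentiableAt ℝ (y t) x)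
    (hyL : ∀ t < N, ∀ x ∈ X, ‖gradient (y t) x‖ ≤ Lhat) {Γ : ℕ → ℝ}
    (hΓ : ∀ t < N, ∀ i, M.γ (gradient (y t) (D i)) ≤ Γ t) {v : Blocks d}
    (hv : v ∈ feasible M X c ρ) :
    ∑ t ∈ Finset.range N, (y t (D (playIdx M X D Lhat c ρ (gradState M X D Lhat c ρ y t))) -
      y t (c + ρ • M.A v)) ≤ ρ * (4 * n + 23 * N + 18 * ∑ t ∈ Finset.range N, Γ t) := by
  set k := gradState M X D Lhat c ρ y with hk
  set ix : ℕ → ℕ := fun t => playIdx M X D Lhat c ρ (k t) with hix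
  set g : ℕ → Vec d := fun t => gradient (y t) (D (ix t)) with hg
  set gq : ℕ → Vec d := fun t => unquant M.τ (quant M.τ (g t)) with hgq
  set l : ℕ → Blocks d := fun t => leader M X c ρ (unquant M.τ (k t)) with hl
  have hreg := leader_regret (M := M) hX hXc hc ρ gq (fun t => unquant M.τ (k t))
    (by ext j; simp [hk, gradState, unquant])
    (fun t => by simp only [hk, gradState, unquant_add, hgq, hg, hix]) N hv
  have hθ : unquant M.τ (k N) = ∑ t ∈ Finset.range N, gq t := by
    clear hreg hy hyd hyL hΓ
    induction N with
    | zero => ext j; simp [hk, gradState, unquant]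
    | succ m ih =>
      rw [Finset.sum_range_succ, ← ih]
      simp only [hk, gradState, unquant_add, hgq, hg, hix]
  rw [hθ, sum_inner] at hreg
  have hψ := M.ψ_le v hv.1
  have hquant : ∀ t, M.γ (g t - gq t) ≤ lam / n := fun t =>
    M.γ_quant _ fun j => abs_sub_unquant_quant_le M.τ_pos (g t) j
  have hln : lam / n ≤ 1 := (div_le_one hn).2 hlamn
  have hγ : ∀ t < N, M.γ (gq t) ≤ 2 * Γ t + 2 := fun t ht => by
    have h1 := M.γ_add (g t) (-(g t - gq t))
    have h2 : M.γ (-(g t - gq t)) ≤ lam / n := M.γ_quant _ fun j => by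
      have := abs_sub_unquant_quant_le M.τ_pos (g t) j
      rwa [← abs_neg] at this
    have e : g t + -(g t - gq t) = gq t := by abel
    rw [e] at h1
    have := hΓ t ht (ix t)
    linarith
  have herr : ∀ t, ∀ w ∈ unitBlocks d, |inner ℝ (g t - gq t) (M.A w)| ≤ 2 := fun t w hw => by
    refine abs_le_of_sq_le_sq ?_ (by norm_num)
    refine (M.small (g t - gq t) w hw).trans ?_
    have hnl : 0 < n / lam := by positivity
    calc 4 * (n / lam) * M.γ (g t - gq t) ≤ 4 * (n / lam) * (lam / n) := by
          gcongr; exact hquant t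
      _ = 2 ^ 2 := by field_simp; norm_num
  -- Here 5 is 1 for rounding the point plus 2 for the quantization error at the leader and 2 at
  -- `v`. With `γ (gq t) ≤ 2 Γ t + 2` and the regret factor 9, the totals are `5 + 18 = 23` and 18.
  have hpt : ∀ t < N, y t (D (ix t)) - y t (c + ρ • M.A v) ≤
      ρ * (5 + (inner ℝ (gq t) (M.A (l t)) - inner ℝ (gq t) (M.A v))) := fun t ht => by
    have h1 := convexOn_gradient_le (hy t ht) (hDX (ix t)) hv.2 (hyd t ht _ (hDX (ix t)))
    have hlX : c + ρ • M.A (l t) ∈ X := playPt_mem hX hc ρ (k t)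
    have htol : 0 < ρ / (Lhat + M.a) := div_pos hρ (by linarith [M.a_pos])
    have hnear : ‖c + ρ • M.A (l t) - D (ix t)‖ ≤ ρ / (Lhat + M.a) := nearIdx_spec hD hlX htol
    have e : D (ix t) - (c + ρ • M.A v) =
        -(c + ρ • M.A (l t) - D (ix t)) + ρ • (M.A (l t) - M.A v) := by
      rw [smul_sub]; abel
    have h2 : inner ℝ (g t) (-(c + ρ • M.A (l t) - D (ix t))) ≤ ρ := by
      refine (real_inner_le_norm _ _).trans ?_
      rw [norm_neg]
      calc ‖g t‖ * ‖c + ρ • M.A (l t) - D (ix t)‖ ≤ Lhat * (ρ / (Lhat + M.a)) := by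
            gcongr
            exact hyL t ht _ (hDX _)
        _ ≤ ρ := by
            rw [mul_div_assoc', div_le_iff₀ (by linarith [M.a_pos])]
            nlinarith [mul_pos hρ M.a_pos]
    have h3 := (abs_le.1 (herr t (l t) (leader_spec hX hc ρ _).1.1)).2
    have h4 := (abs_le.1 (herr t v hv.1)).1
    rw [inner_sub_left] at h3 h4
    change _ ≤ inner ℝ (g t) (D (ix t) - (c + ρ • M.A v)) at h1
    rw [e, inner_add_right, inner_smul_right, inner_sub_right] at h1
    have h5 : ρ * (inner ℝ (g t) (M.A (l t)) - inner ℝ (g t) (M.A v)) ≤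
        ρ * (4 + (inner ℝ (gq t) (M.A (l t)) - inner ℝ (gq t) (M.A v))) :=
      mul_le_mul_of_nonneg_left (by linarith) hρ.le
    linarith
  have hγs : ∑ t ∈ Finset.range N, M.γ (gq t) ≤ 2 * ∑ t ∈ Finset.range N, Γ t + 2 * N := by
    calc _ ≤ ∑ t ∈ Finset.range N, (2 * Γ t + 2) :=
          Finset.sum_le_sum fun t ht => hγ t (by simpa using ht)
      _ = _ := by rw [Finset.sum_add_distrib, ← Finset.mul_sum]; simp [mul_comm]
  calc _ ≤ ∑ t ∈ Finset.range N,
        ρ * (5 + (inner ℝ (gq t) (M.A (l t)) - inner ℝ (gq t) (M.A v))) :=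
        Finset.sum_le_sum fun t ht => hpt t (by simpa using ht)
    _ = ρ * (5 * N + (∑ t ∈ Finset.range N, inner ℝ (gq t) (M.A (l t)) -
          ∑ t ∈ Finset.range N, inner ℝ (gq t) (M.A v))) := by
        rw [← Finset.mul_sum, Finset.sum_add_distrib, Finset.sum_sub_distrib]
        simp [mul_comm]
    _ ≤ _ := by
        refine mul_le_mul_of_nonneg_left ?_ hρ.le
        linarith

end Leader

end StochOpt
end

/-! ### The known parameters, data-dependent scales, and gauges of the losses. -/

noncomputable section

namespace StochOpt

/-- The known parameters of the problem, in the nondegenerate case. -/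
structure Setup (d : ℕ) where
  n : ℕ
  N : ℕ
  X : Set (Vec d)
  D : ℕ → Vec d
  lam : ℝ
  lamd : ℝ
  Lhat : ℝ
  lhat : Fin d → ℝ
  d_pos : 0 < d
  N_pos : 0 < N
  three_mul_le : 3 * N ≤ n
  le_five_mul : n ≤ 5 * N
  closed : IsClosed X
  convex : Convex ℝ X
  D_mem : ∀ i, D i ∈ X
  D_dense : ∀ x ∈ X, ∀ ε > 0, ∃ i, ‖x - D i‖ ≤ ε
  D_zero : D 0 = 0
  half_le : 1 / 2 ≤ lam
  lam_le : lam ≤ lamd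
  log_le : Real.log (1 + d) ≤ lamd
  lamd_le : lamd ≤ n
  Lhat_pos : 0 < Lhat
  lhat_nonneg : ∀ j, 0 ≤ lhat j
  lhat_sum_pos : 0 < ∑ j, lhat j

/-- Index set of the gauges of gradients: the `2`-norm, the `∞`-norm and the coordinates. -/
abbrev GaugeIdx (d : ℕ) : Type := Option (Option (Fin d))

/-- The gauges of gradients. -/
def gaugeVal {d : ℕ} : GaugeIdx d → Vec d → ℝ
  | none, g => ‖g‖
  | some none, g => supAbs g
  | some (some j), g => |g j|

lemma gaugeVal_nonneg {d : ℕ} (i : GaugeIdx d) (g : Vec d) : 0 ≤ gaugeVal i g := by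
  rcases i with _ | _ | j
  · exact norm_nonneg g
  · exact supAbs_nonneg g
  · exact abs_nonneg _

namespace Setup

variable {d : ℕ} (Q : Setup d)

lemma n_pos : 0 < Q.n := by have := Q.N_pos; have := Q.three_mul_le; omega

lemma n_pos' : (0 : ℝ) < Q.n := by exact_mod_cast Q.n_pos

lemma N_pos' : (0 : ℝ) < Q.N := by exact_mod_cast Q.N_pos

lemma three_mul_le' : 3 * (Q.N : ℝ) ≤ Q.n := by exact_mod_cast Q.three_mul_le

lemma le_five_mul' : (Q.n : ℝ) ≤ 5 * Q.N := by exact_mod_cast Q.le_five_mul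

lemma lam_pos : 0 < Q.lam := by linarith [Q.half_le]

lemma zero_mem : (0 : Vec d) ∈ Q.X := Q.D_zero ▸ Q.D_mem 0

/-- The known upper bounds of the gauges. -/
def hat : GaugeIdx d → ℝ
  | none => Q.Lhat
  | some none => normInf Q.lhat
  -- The added mean keeps the bound positive when `lhat j = 0`, and only doubles the sum over `j`.
  | some (some j) => Q.lhat j + (∑ i, Q.lhat i) / d

/-- The logarithmic factors of the gauges. -/
def logf : GaugeIdx d → ℝ
  | none => Q.lam
  | some _ => Q.lamd

/-- The resolution of the statistics. -/
def res (i : GaugeIdx d) : ℝ := Q.hat i * √(Q.logf i / Q.n)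

/-- The scale that corresponds to the statistics `p`. -/
def scale (p : GaugeIdx d → ℕ) (i : GaugeIdx d) : ℝ := Q.res i * √((p i : ℝ) / Q.N + 1)

/-- The supremum of a gauge of the gradients of `y` over the points `D`. -/
def supGauge (i : GaugeIdx d) (y : Vec d → ℝ) : ℝ := ⨆ k, gaugeVal i (gradient y (Q.D k))

/-- The statistics of the first `N` functions. -/
def stat (y : ℕ → Vec d → ℝ) (i : GaugeIdx d) : ℕ :=
  ∑ t ∈ Finset.range Q.N, ⌈Q.supGauge i (y t) ^ 2 / Q.res i ^ 2⌉₊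

lemma hat_pos (i : GaugeIdx d) : 0 < Q.hat i := by
  have hd : (0 : ℝ) < d := by exact_mod_cast Q.d_pos
  rcases i with _ | _ | j
  · exact Q.Lhat_pos
  · rcases (norm_nonneg Q.lhat).eq_or_lt with h | h
    · have h0 : Q.lhat = 0 := norm_eq_zero.1 h.symm
      have := Q.lhat_sum_pos
      simp [h0] at this
    · exact h
  · have := Q.lhat_nonneg j
    have := div_pos Q.lhat_sum_pos hd
    change 0 < Q.lhat j + _
    linarith

lemma lam_le_logf (i : GaugeIdx d) : Q.lam ≤ Q.logf i := by
  rcases i with _ | i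
  · exact le_rfl
  · exact Q.lam_le

lemma logf_pos (i : GaugeIdx d) : 0 < Q.logf i := Q.lam_pos.trans_le (Q.lam_le_logf i)

lemma res_pos (i : GaugeIdx d) : 0 < Q.res i :=
  mul_pos (Q.hat_pos i) (Real.sqrt_pos.2 (div_pos (Q.logf_pos i) Q.n_pos'))

lemma res_sq (i : GaugeIdx d) : Q.res i ^ 2 = Q.hat i ^ 2 * (Q.logf i / Q.n) := by
  rw [res, mul_pow, Real.sq_sqrt (div_pos (Q.logf_pos i) Q.n_pos').le]

lemma scale_sq (p : GaugeIdx d → ℕ) (i : GaugeIdx d) :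
    Q.scale p i ^ 2 = Q.res i ^ 2 * ((p i : ℝ) / Q.N + 1) := by
  rw [scale, mul_pow, Real.sq_sqrt (by positivity)]

lemma scale_pos (p : GaugeIdx d → ℕ) (i : GaugeIdx d) : 0 < Q.scale p i :=
  mul_pos (Q.res_pos i) (Real.sqrt_pos.2 (by positivity))

lemma res_le_scale (p : GaugeIdx d → ℕ) (i : GaugeIdx d) : Q.res i ^ 2 ≤ Q.scale p i ^ 2 := by
  rw [scale_sq]
  have : 0 ≤ (p i : ℝ) / Q.N := by positivity
  nlinarith [sq_nonneg (Q.res i)]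

/-- The geometry that corresponds to the statistics `p`. -/
def geom (p : GaugeIdx d → ℕ) : MirrorGeom d Q.n Q.lam :=
  stdGeom (lamd := Q.lamd) (a := Q.scale p none) (b := Q.scale p (some none))
    (w := fun j => Q.scale p (some (some j))) Q.d_pos Q.n_pos' Q.half_le Q.lam_le Q.log_le
    (Q.scale_pos p _) (Q.scale_pos p _) fun _ => Q.scale_pos p _

/-- The squared gauge of the function `y`. -/
def sqGauge (p : GaugeIdx d → ℕ) (y : Vec d → ℝ) : ℝ :=
  Q.supGauge none y ^ 2 / Q.scale p none ^ 2 +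
    Q.supGauge (some none) y ^ 2 / Q.scale p (some none) ^ 2 +
    ∑ j, Q.supGauge (some (some j)) y ^ 2 /
      (Q.scale p (some (some j)) * ∑ i, Q.scale p (some (some i)))

/-- `x` has size at most `r` in the geometry `p`. -/
def Small (p : GaugeIdx d → ℕ) (x : Vec d) (r : ℝ) : Prop :=
  ∀ g, (inner ℝ g x) ^ 2 ≤ r ^ 2 * (Q.n / Q.lam) * (Q.geom p).γ g

variable {Q}

lemma Small.add {p : GaugeIdx d → ℕ} {x x' : Vec d} {r r' : ℝ} (hr : 0 ≤ r) (hr' : 0 ≤ r')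
    (h : Q.Small p x r) (h' : Q.Small p x' r') : Q.Small p (x + x') (r + r') := by
  intro g
  have hn := Q.n_pos'
  have hl := Q.lam_pos
  have hγ := (Q.geom p).γ_nonneg g
  set c := Q.n / Q.lam * (Q.geom p).γ g with hc
  have hc0 : 0 ≤ c := by positivity
  have h1 : |inner ℝ g x| ≤ r * √c := by
    refine abs_le_of_sq_le_sq ?_ (by positivity)
    rw [mul_pow, Real.sq_sqrt hc0, hc, ← mul_assoc]; exact h g
  have h2 : |inner ℝ g x'| ≤ r' * √c := by
    refine abs_le_of_sq_le_sq ?_ (by positivity)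
    rw [mul_pow, Real.sq_sqrt hc0, hc, ← mul_assoc]; exact h' g
  rw [inner_add_right, ← sq_abs]
  calc |inner ℝ g x + inner ℝ g x'| ^ 2 ≤ (r * √c + r' * √c) ^ 2 := by
        gcongr
        exact (abs_add_le _ _).trans (add_le_add h1 h2)
    _ = _ := by rw [← add_mul, mul_pow, Real.sq_sqrt hc0, hc, mul_assoc]

lemma Small.neg {p : GaugeIdx d → ℕ} {x : Vec d} {r : ℝ} (h : Q.Small p x r) :
    Q.Small p (-x) r := by
  intro g
  rw [inner_neg_right, neg_sq]
  exact h g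

lemma small_image (p : GaugeIdx d → ℕ) {ρ : ℝ} {v : Blocks d} (hv : v ∈ unitBlocks d) :
    Q.Small p (ρ • (Q.geom p).A v) (2 * ρ) := by
  intro g
  have := (Q.geom p).small g v hv
  rw [inner_smul_right, mul_pow]
  nlinarith [sq_nonneg ρ]

/-- Controls rounding errors in the geometry: the tolerance gives `‖x‖ a ≤ ρ`, the gauge dominates
`‖g‖ ^ 2 / a ^ 2`, and `n / lam ≥ 1`. -/
lemma small_of_norm_le (p : GaugeIdx d → ℕ) {ρ : ℝ} (hρ : 0 ≤ ρ) {x : Vec d}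
    (hx : ‖x‖ ≤ ρ / (Q.Lhat + (Q.geom p).a)) : Q.Small p x ρ := by
  intro g
  have hn := Q.n_pos'
  have hl := Q.lam_pos
  have hγ := (Q.geom p).γ_nonneg g
  have ha := (Q.geom p).a_pos
  have hx' : ‖x‖ * (Q.geom p).a ≤ ρ := by
    rw [le_div_iff₀ (by linarith [Q.Lhat_pos])] at hx
    nlinarith [norm_nonneg x, Q.Lhat_pos]
  have hnl : 1 ≤ Q.n / Q.lam := by
    rw [one_le_div hl]; exact Q.lam_le.trans Q.lamd_le
  calc (inner ℝ g x) ^ 2 ≤ (‖g‖ * ‖x‖) ^ 2 := by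
        rw [← sq_abs]; gcongr; exact abs_real_inner_le_norm g x
    _ ≤ (Q.geom p).a ^ 2 * (Q.geom p).γ g * ‖x‖ ^ 2 := by
        rw [mul_pow]; gcongr; exact (Q.geom p).norm_sq_le g
    _ = (‖x‖ * (Q.geom p).a) ^ 2 * (Q.geom p).γ g := by ring
    _ ≤ ρ ^ 2 * (Q.geom p).γ g := by gcongr
    _ ≤ ρ ^ 2 * (Q.n / Q.lam) * (Q.geom p).γ g := by
        gcongr
        nlinarith [sq_nonneg ρ]

variable (Q)

/-- Losses that satisfy the hypotheses surely, with the known bounds. -/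
structure Regular {𝒮 : Type*} [MeasurableSpace 𝒮] (P : Measure 𝒮) (f : Vec d → 𝒮 → ℝ) :
    Prop where
  meas : ∀ x, Measurable (f x)
  integrable : ∀ x ∈ Q.X, Integrable (f x) P
  convexOn : ∀ s, ConvexOn ℝ Q.X (fun x => f x s)
  diff : ∀ s, ∀ x ∈ Q.X, DifferentiableAt ℝ (fun y => f y s) x
  bound : ∀ s, ∀ x ∈ Q.X, ∀ i, gaugeVal i (gradient (fun y => f y s) x) ≤ Q.hat i

variable {Q} {𝒮 : Type*} [MeasurableSpace 𝒮] {P : Measure 𝒮} {f : Vec d → 𝒮 → ℝ}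

lemma Regular.le_supGauge (hf : Q.Regular P f) (s : 𝒮) (i : GaugeIdx d) (k : ℕ) :
    gaugeVal i (gradient (fun y => f y s) (Q.D k)) ≤ Q.supGauge i (fun y => f y s) :=
  le_ciSup (f := fun k => gaugeVal i (gradient (fun y => f y s) (Q.D k)))
    ⟨Q.hat i, by rintro _ ⟨k, rfl⟩; exact hf.bound s _ (Q.D_mem k) i⟩ k

lemma supGauge_le {y : Vec d → ℝ} {i : GaugeIdx d} {r : ℝ}
    (h : ∀ x ∈ Q.X, gaugeVal i (gradient y x) ≤ r) : Q.supGauge i y ≤ r :=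
  ciSup_le fun k => h _ (Q.D_mem k)

lemma supGauge_nonneg (y : Vec d → ℝ) (i : GaugeIdx d) : 0 ≤ Q.supGauge i y :=
  Real.iSup_nonneg fun _ => gaugeVal_nonneg _ _

lemma Regular.supGauge_le_hat (hf : Q.Regular P f) (s : 𝒮) (i : GaugeIdx d) :
    Q.supGauge i (fun y => f y s) ≤ Q.hat i := supGauge_le fun x hx => hf.bound s x hx i

lemma Regular.norm_gradient_le (hf : Q.Regular P f) (s : 𝒮) {x : Vec d} (hx : x ∈ Q.X) :
    ‖gradient (fun y => f y s) x‖ ≤ Q.Lhat := hf.bound s x hx none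

/-- A partial derivative is a sequential limit of difference quotients, each measurable in the
sample. -/
lemma Regular.measurable_gradient_apply (hf : Q.Regular P f) {x : Vec d} (hx : x ∈ Q.X)
    (j : Fin d) : Measurable fun s => gradient (fun y => f y s) x j := by
  have hlim : ∀ s, Filter.Tendsto (fun m : ℕ => ((m : ℝ) + 1) •
      (f (x + ((m : ℝ) + 1)⁻¹ • EuclideanSpace.single j 1) s - f x s)) Filter.atTop
      (nhds (gradient (fun y => f y s) x j)) := fun s => by
    have h1 := (hf.diff s x hx).hasGradientAt.hasFDerivAt
    have h2 : Filter.Tendsto (fun m : ℕ => ‖(m : ℝ) + 1‖) Filter.atTop Filter.atTop :=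
      tendsto_norm_atTop_atTop.comp
        (Filter.tendsto_atTop_add_const_right _ 1 tendsto_natCast_atTop_atTop)
    have h3 := h1.lim (EuclideanSpace.single j 1) h2
    have e : inner ℝ (gradient (fun y => f y s) x) (EuclideanSpace.single j (1 : ℝ)) =
        gradient (fun y => f y s) x j := by
      rw [EuclideanSpace.inner_single_right]; simp
    rw [InnerProductSpace.toDual_apply_apply, e] at h3
    exact h3
  refine measurable_of_tendsto_metrizable (fun m => ?_) (tendsto_pi_nhds.2 hlim)
  exact ((hf.meas _).sub (hf.meas x)).const_mul ((m : ℝ) + 1)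

lemma Regular.measurable_gaugeVal (hf : Q.Regular P f) {x : Vec d} (hx : x ∈ Q.X)
    (i : GaugeIdx d) : Measurable fun s => gaugeVal i (gradient (fun y => f y s) x) := by
  rcases i with _ | _ | j
  · have : (fun s => gaugeVal none (gradient (fun y => f y s) x)) =
        fun s => √(∑ j, gradient (fun y => f y s) x j ^ 2) := by
      funext s
      rw [← norm_sq_eq_sum, Real.sqrt_sq (norm_nonneg _), gaugeVal]
    rw [this]
    exact (Finset.measurable_sum _ fun j _ =>
      (hf.measurable_gradient_apply hx j).pow_const 2).sqrt
  · exact (measurable_pi_lambda (fun s j => gradient (fun y => f y s) x j)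
      fun j => hf.measurable_gradient_apply hx j).norm
  · exact (hf.measurable_gradient_apply hx j).norm

lemma Regular.measurable_supGauge (hf : Q.Regular P f) (i : GaugeIdx d) :
    Measurable fun s => Q.supGauge i (fun y => f y s) :=
  Measurable.iSup fun k => hf.measurable_gaugeVal (Q.D_mem k) i

lemma Regular.measurable_sqGauge (hf : Q.Regular P f) (p : GaugeIdx d → ℕ) :
    Measurable fun s => Q.sqGauge p (fun y => f y s) := by
  unfold sqGauge
  refine Measurable.add (Measurable.add ?_ ?_) (Finset.measurable_sum _ fun j _ => ?_)
  · exact ((hf.measurable_supGauge _).pow_const 2).div_const _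
  · exact ((hf.measurable_supGauge _).pow_const 2).div_const _
  · exact ((hf.measurable_supGauge _).pow_const 2).div_const _

/-- Taking the supremum inside each gauge gives a bound that does not depend on the point played, so
a block sum concentrates without following the trajectory. -/
lemma Regular.gauge_le_sqGauge (hf : Q.Regular P f) (p : GaugeIdx d → ℕ) (s : 𝒮) (k : ℕ) :
    (Q.geom p).γ (gradient (fun y => f y s) (Q.D k)) ≤ Q.sqGauge p (fun y => f y s) := by
  have hpos := Q.scale_pos p
  have hW : 0 ≤ ∑ i, Q.scale p (some (some i)) := Finset.sum_nonneg fun i _ => (hpos _).le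
  have h1 := hf.le_supGauge s none k
  have h2 := hf.le_supGauge s (some none) k
  change gauge _ _ _ _ ≤ _
  unfold gauge sqGauge
  refine add_le_add (add_le_add ?_ ?_) (Finset.sum_le_sum fun j _ => ?_)
  · exact div_le_div_of_nonneg_right (pow_le_pow_left₀ (norm_nonneg _) h1 2) (sq_nonneg _)
  · exact div_le_div_of_nonneg_right (pow_le_pow_left₀ (supAbs_nonneg _) h2 2) (sq_nonneg _)
  · refine div_le_div_of_nonneg_right ?_ (mul_nonneg (hpos _).le hW)
    rw [← sq_abs]
    exact pow_le_pow_left₀ (abs_nonneg _) (hf.le_supGauge s (some (some j)) k) 2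

lemma sqGauge_nonneg (p : GaugeIdx d → ℕ) (y : Vec d → ℝ) : 0 ≤ Q.sqGauge p y := by
  have hpos := Q.scale_pos p
  have hW : 0 ≤ ∑ i, Q.scale p (some (some i)) := Finset.sum_nonneg fun i _ => (hpos _).le
  have : 0 ≤ ∑ j, Q.supGauge (some (some j)) y ^ 2 /
      (Q.scale p (some (some j)) * ∑ i, Q.scale p (some (some i))) :=
    Finset.sum_nonneg fun j _ => div_nonneg (sq_nonneg _) (mul_nonneg (hpos _).le hW)
  unfold sqGauge
  positivity

lemma scale_sum_pos (p : GaugeIdx d → ℕ) : 0 < ∑ i, Q.scale p (some (some i)) := by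
  have : Nonempty (Fin d) := ⟨⟨0, Q.d_pos⟩⟩
  exact Finset.sum_pos (fun i _ => Q.scale_pos p _) Finset.univ_nonempty

/-- If the squared gauges are bounded relative to the scales, so is their combination. -/
lemma sum_div_scale_le (p : GaugeIdx d → ℕ) {c : ℝ} {m : GaugeIdx d → ℝ}
    (hm : ∀ i, m i ≤ c * Q.scale p i ^ 2) :
    m none / Q.scale p none ^ 2 + m (some none) / Q.scale p (some none) ^ 2 +
      ∑ j, m (some (some j)) / (Q.scale p (some (some j)) * ∑ i, Q.scale p (some (some i))) ≤
      3 * c := by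
  have hpos := Q.scale_pos p
  have hW := scale_sum_pos (Q := Q) p
  have h1 : ∀ i, m i / Q.scale p i ^ 2 ≤ c := fun i => by
    rw [div_le_iff₀ (pow_pos (hpos i) 2)]; exact hm i
  have h3 : ∑ j, m (some (some j)) / (Q.scale p (some (some j)) *
      ∑ i, Q.scale p (some (some i))) ≤ c := by
    calc _ ≤ ∑ j, c * Q.scale p (some (some j)) / ∑ i, Q.scale p (some (some i)) := by
          refine Finset.sum_le_sum fun j _ => ?_
          have := hpos (some (some j))
          rw [div_le_div_iff₀ (by positivity) hW]
          calc _ ≤ (c * Q.scale p (some (some j)) ^ 2) * ∑ i, Q.scale p (some (some i)) := by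
                gcongr; exact hm _
            _ = _ := by ring
      _ = c := by
          rw [← Finset.sum_div, ← Finset.mul_sum, mul_div_assoc, div_self hW.ne', mul_one]
  linarith [h1 none, h1 (some none)]

/-- The sure bound required by the exponential moments: since a scale is never below its resolution,
`hat ^ 2` is at most `n / lam` times its square. -/
lemma Regular.sqGauge_le (hf : Q.Regular P f) (p : GaugeIdx d → ℕ) (s : 𝒮) :
    Q.sqGauge p (fun y => f y s) ≤ 3 * (Q.n / Q.lam) := by
  refine sum_div_scale_le p (m := fun i => Q.supGauge i (fun y => f y s) ^ 2) fun i => ?_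
  have hn := Q.n_pos'
  have hl := Q.lam_pos
  have hli := Q.logf_pos i
  calc Q.supGauge i (fun y => f y s) ^ 2 ≤ Q.hat i ^ 2 :=
        pow_le_pow_left₀ (supGauge_nonneg _ _) (hf.supGauge_le_hat s i) 2
    _ = Q.n / Q.logf i * Q.res i ^ 2 := by rw [res_sq]; field_simp
    _ ≤ Q.n / Q.lam * Q.scale p i ^ 2 := by
        gcongr
        · exact Q.lam_le_logf i
        · exact (Q.res_pos i).le
        · exact le_of_sq_le_sq (Q.res_le_scale p i) (Q.scale_pos p i).le

/-- The scales `p` dominate the second moments. -/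
def Good (Q : Setup d) (P : Measure 𝒮) (f : Vec d → 𝒮 → ℝ) (p : GaugeIdx d → ℕ) : Prop :=
  ∀ i, ∫ s, Q.supGauge i (fun y => f y s) ^ 2 ∂P ≤ 100 * Q.scale p i ^ 2

variable [IsProbabilityMeasure P]

lemma Regular.integrable_supGauge_sq (hf : Q.Regular P f) (i : GaugeIdx d) :
    Integrable (fun s => Q.supGauge i (fun y => f y s) ^ 2) P :=
  integrable_of_abs_le P ((hf.measurable_supGauge i).pow_const 2) (b := Q.hat i ^ 2) fun s => by
    rw [abs_of_nonneg (sq_nonneg _)]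
    exact pow_le_pow_left₀ (supGauge_nonneg _ _) (hf.supGauge_le_hat s i) 2

lemma Regular.integrable_sqGauge (hf : Q.Regular P f) (p : GaugeIdx d → ℕ) :
    Integrable (fun s => Q.sqGauge p (fun y => f y s)) P :=
  integrable_of_abs_le P (hf.measurable_sqGauge p) (b := 3 * (Q.n / Q.lam)) fun s => by
    rw [abs_of_nonneg (sqGauge_nonneg _ _)]
    exact hf.sqGauge_le p s

lemma Regular.integral_sqGauge_le (hf : Q.Regular P f) {p : GaugeIdx d → ℕ}
    (hp : Q.Good P f p) : ∫ s, Q.sqGauge p (fun y => f y s) ∂P ≤ 300 := by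
  have hi := hf.integrable_supGauge_sq
  have e : ∫ s, Q.sqGauge p (fun y => f y s) ∂P =
      (∫ s, Q.supGauge none (fun y => f y s) ^ 2 ∂P) / Q.scale p none ^ 2 +
      (∫ s, Q.supGauge (some none) (fun y => f y s) ^ 2 ∂P) / Q.scale p (some none) ^ 2 +
      ∑ j, (∫ s, Q.supGauge (some (some j)) (fun y => f y s) ^ 2 ∂P) /
        (Q.scale p (some (some j)) * ∑ i, Q.scale p (some (some i))) := by
    have h12 : Integrable (fun s => Q.supGauge none (fun y => f y s) ^ 2 / Q.scale p none ^ 2 +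
        Q.supGauge (some none) (fun y => f y s) ^ 2 / Q.scale p (some none) ^ 2) P :=
      ((hi _).div_const _).add ((hi _).div_const _)
    unfold sqGauge
    rw [integral_add h12
      (integrable_finsetSum _ fun j _ => (hi _).div_const _),
      integral_add ((hi _).div_const _) ((hi _).div_const _),
      integral_finsetSum _ fun j _ => (hi _).div_const _]
    simp only [integral_div]
  rw [e]
  refine (sum_div_scale_le p (c := 100)
    (m := fun i => ∫ s, Q.supGauge i (fun y => f y s) ^ 2 ∂P) hp).trans (by norm_num)

end Setup

end StochOpt
end

/-! ### Runs and candidates as predictable processes, and their concentration. -/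

noncomputable section

namespace StochOpt

namespace Setup

variable {d : ℕ} (Q : Setup d)

instance : NeZero Q.n := ⟨Nat.pos_iff_ne_zero.1 Q.n_pos⟩

/-- The sampled losses as a sequence. -/
def sample {𝒮 : Type*} (f : Vec d → 𝒮 → ℝ) (S : Fin Q.n → 𝒮) (t : ℕ) : Vec d → ℝ :=
  fun x => f x (S (Fin.ofNat Q.n t))

/-- The state of the run on the functions `y lo, y (lo + 1), …` -/
def runState (p : GaugeIdx d → ℕ) (c : Vec d) (ρ : ℝ) (lo : ℕ) (y : ℕ → Vec d → ℝ) (t : ℕ) :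
    Fin d → ℤ :=
  gradState (Q.geom p) Q.X Q.D Q.Lhat c ρ (fun t => y (lo + t)) t

/-- The index of the point played for the state `k`. -/
def runIdx (p : GaugeIdx d → ℕ) (c : Vec d) (ρ : ℝ) (k : Fin d → ℤ) : ℕ :=
  playIdx (Q.geom p) Q.X Q.D Q.Lhat c ρ k

/-- The average of the (unrounded) points played for the states `k`. -/
def avgPt (p : GaugeIdx d → ℕ) (c : Vec d) (ρ : ℝ) (k : Fin Q.N → Fin d → ℤ) : Vec d :=
  (Q.N : ℝ)⁻¹ • ∑ t, playPt (Q.geom p) Q.X c ρ (k t)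

/-- The index of the rounded average point. -/
def avgIdx (p : GaugeIdx d → ℕ) (c : Vec d) (ρ : ℝ) (k : Fin Q.N → Fin d → ℤ) : ℕ :=
  nearIdx Q.D (Q.avgPt p c ρ k) (ρ / (Q.Lhat + (Q.geom p).a))

/-- The candidate at scale `2 ^ k`, computed from the second block of functions. -/
def candIdx (y : ℕ → Vec d → ℝ) (k : ℤ) : ℕ :=
  Q.avgIdx (Q.stat y) 0 (2 ^ k) fun t => Q.runState (Q.stat y) 0 (2 ^ k) Q.N y t

variable {Q} {𝒮 : Type*} [MeasurableSpace 𝒮] {P : Measure 𝒮} {f : Vec d → 𝒮 → ℝ}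

lemma Regular.pred_stat (hf : Q.Regular P f) :
    Pred Q.N (fun S : Fin Q.n → 𝒮 => Q.stat (Q.sample f S)) := by
  refine Pred.pi fun i => ?_
  have hN : Q.N ≤ Q.n := by have := Q.three_mul_le; omega
  have aux : ∀ m ≤ Q.n, Pred m (fun S : Fin Q.n → 𝒮 => ∑ t ∈ Finset.range m,
      ⌈Q.supGauge i (Q.sample f S t) ^ 2 / Q.res i ^ 2⌉₊) := by
    intro m
    induction m with
    | zero => intro _; simpa using Pred.const 0 0
    | succ m ih =>
      intro hm
      simp only [Finset.sum_range_succ]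
      have hmeas : Measurable fun s =>
          ⌈Q.supGauge i (fun y => f y s) ^ 2 / Q.res i ^ 2⌉₊ :=
        Nat.measurable_ceil.comp (((hf.measurable_supGauge i).pow_const 2).div_const _)
      exact (ih (by omega)).step (by omega)
        (φ := fun b s => b + ⌈Q.supGauge i (fun y => f y s) ^ 2 / Q.res i ^ 2⌉₊)
        fun b b' => (measurable_const.add hmeas) (measurableSet_singleton b')
  exact aux Q.N hN

lemma Regular.measurable_quant (hf : Q.Regular P f) (τ : ℝ) {x : Vec d} (hx : x ∈ Q.X) :
    Measurable fun s => quant τ (gradient (fun y => f y s) x) :=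
  measurable_pi_lambda _ fun j =>
    Int.measurable_floor.comp ((hf.measurable_gradient_apply hx j).div_const _)

/-- The geometry is random, so the statistics are carried in the state; for a fixed state, one step
is a measurable function of the new sample. -/
lemma Regular.pred_runState (hf : Q.Regular P f) (c : Vec d) (ρ : ℝ) {lo : ℕ} (hlo : Q.N ≤ lo)
    (t : ℕ) (ht : lo + t ≤ Q.n) :
    Pred (lo + t) (fun S : Fin Q.n → 𝒮 => (Q.stat (Q.sample f S),
      Q.runState (Q.stat (Q.sample f S)) c ρ lo (Q.sample f S) t)) := by
  induction t with
  | zero => exact (hf.pred_stat.mono hlo).map fun p => (p, 0)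
  | succ t ih =>
    refine (ih (by omega)).step (by omega)
      (φ := fun b s => (b.1, b.2 + quant (Q.geom b.1).τ
        (gradient (fun y => f y s) (Q.D (Q.runIdx b.1 c ρ b.2))))) fun b b' => ?_
    have hm := hf.measurable_quant (Q.geom b.1).τ (Q.D_mem (Q.runIdx b.1 c ρ b.2))
    exact (measurable_const.prodMk (measurable_const.add hm)) (measurableSet_singleton b')

lemma Regular.pred_runIdx (hf : Q.Regular P f) (c : Vec d) (ρ : ℝ) {lo : ℕ} (hlo : Q.N ≤ lo)
    (t : ℕ) (ht : lo + t ≤ Q.n) :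
    Pred (lo + t) (fun S : Fin Q.n → 𝒮 => (Q.stat (Q.sample f S),
      Q.runIdx (Q.stat (Q.sample f S)) c ρ
        (Q.runState (Q.stat (Q.sample f S)) c ρ lo (Q.sample f S) t))) :=
  (hf.pred_runState c ρ hlo t ht).map fun b => (b.1, Q.runIdx b.1 c ρ b.2)

lemma Regular.pred_candIdx (hf : Q.Regular P f) (k : ℤ) :
    Pred (2 * Q.N) (fun S : Fin Q.n → 𝒮 => Q.candIdx (Q.sample f S) k) := by
  have h3 := Q.three_mul_le
  have h1 : Pred (2 * Q.N) (fun S : Fin Q.n → 𝒮 => fun t : Fin Q.N =>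
      Q.runState (Q.stat (Q.sample f S)) 0 (2 ^ k) Q.N (Q.sample f S) t) :=
    Pred.pi fun t => ((hf.pred_runState 0 (2 ^ k) le_rfl t (by omega)).map Prod.snd).mono
      (by omega)
  exact (hf.pred_stat.mono (by omega)).map₂ h1 fun p κ => Q.avgIdx p 0 (2 ^ k) κ

/-- The gradient inequality at one of the two points bounds the difference from above, and at the
other from below. -/
lemma Regular.sub_sq_le (hf : Q.Regular P f) {p : GaugeIdx d → ℕ} {i j : ℕ} {r : ℝ}
    (h : Q.Small p (Q.D i - Q.D j) r) (s : 𝒮) :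
    (f (Q.D i) s - f (Q.D j) s) ^ 2 ≤
      r ^ 2 * (Q.n / Q.lam) * Q.sqGauge p (fun y => f y s) := by
  have hn := Q.n_pos'
  have hl := Q.lam_pos
  have hub := convexOn_gradient_le (hf.convexOn s) (Q.D_mem i) (Q.D_mem j)
    (hf.diff s _ (Q.D_mem i))
  have hlb := convexOn_gradient_le (hf.convexOn s) (Q.D_mem j) (Q.D_mem i)
    (hf.diff s _ (Q.D_mem j))
  have hb : ∀ k, (inner ℝ (gradient (fun y => f y s) (Q.D k)) (Q.D i - Q.D j)) ^ 2 ≤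
      r ^ 2 * (Q.n / Q.lam) * Q.sqGauge p (fun y => f y s) := fun k =>
    (h _).trans (by gcongr; exact hf.gauge_le_sqGauge p s k)
  rw [← neg_sub (Q.D i), inner_neg_right] at hlb
  rcases le_total 0 (f (Q.D i) s - f (Q.D j) s) with h0 | h0
  · exact (pow_le_pow_left₀ h0 hub 2).trans (hb i)
  · rw [← neg_sq]
    refine le_trans (pow_le_pow_left₀ (by linarith) (show _ ≤ _ from ?_) 2)
      ((neg_sq _).le.trans (hb j))
    linarith

variable [IsProbabilityMeasure P]

/-- The statistics dominate the second moments with high probability. -/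
lemma Regular.measure_scale_lt_le (hf : Q.Regular P f) (i : GaugeIdx d) :
    (Measure.pi fun _ : Fin Q.n => P) {S | 100 * Q.scale (Q.stat (Q.sample f S)) i ^ 2 <
      ∫ s, Q.supGauge i (fun y => f y s) ^ 2 ∂P} ≤
      ENNReal.ofReal (Real.exp (-(5 * Q.logf i))) := by
  have hh := Q.hat_pos i
  have hres := Q.res_pos i
  have hN := Q.N_pos'
  have hn := Q.n_pos'
  have h5 := Q.le_five_mul'
  set X : 𝒮 → ℝ := fun s => Q.supGauge i (fun y => f y s) ^ 2 / Q.hat i ^ 2 with hX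
  have hXm : Measurable X := ((hf.measurable_supGauge i).pow_const 2).div_const _
  have hX0 : ∀ s, 0 ≤ X s := fun s => by positivity
  have hX1 : ∀ s, X s ≤ 1 := fun s => by
    rw [hX, div_le_one (by positivity)]
    exact pow_le_pow_left₀ (supGauge_nonneg _ _) (hf.supGauge_le_hat s i) 2
  have key := measure_sum_pred_le P (n := Q.n) (lo := 0) (N := Q.N)
    (by have := Q.three_mul_le; omega) (h := fun _ _ => ()) (fun t _ => Pred.const _ ())
    (ξ := fun _ s => (∫ s, X s ∂P) / 4 - X s / 2)
    (fun _ => measurable_const.sub (hXm.div_const 2))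
    (fun _ => lintegral_exp_neg_le_one P hXm hX0 hX1) (5 * Q.logf i)
  refine (measure_mono ?_).trans key
  intro S hS
  simp only [Set.mem_ofPred_eq, zero_add] at hS ⊢
  by_contra hlt
  push Not at hlt
  refine absurd hS (not_lt.2 ?_)
  rw [Finset.sum_sub_distrib, Finset.sum_const, Finset.card_range, nsmul_eq_mul] at hlt
  have eX : ∫ s, X s ∂P = (∫ s, Q.supGauge i (fun y => f y s) ^ 2 ∂P) / Q.hat i ^ 2 :=
    integral_div _ _
  have eS : ∑ t ∈ Finset.range Q.N, X (S (Fin.ofNat Q.n t)) / 2 =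
      (∑ t ∈ Finset.range Q.N, Q.supGauge i (Q.sample f S t) ^ 2) / Q.hat i ^ 2 / 2 := by
    rw [Finset.sum_div, Finset.sum_div]
    rfl
  rw [eX, eS] at hlt
  have hsc : (∑ t ∈ Finset.range Q.N, Q.supGauge i (Q.sample f S t) ^ 2) / Q.N + Q.res i ^ 2 ≤
      Q.scale (Q.stat (Q.sample f S)) i ^ 2 := by
    have hle : (∑ t ∈ Finset.range Q.N, Q.supGauge i (Q.sample f S t) ^ 2) / Q.res i ^ 2 ≤
        Q.stat (Q.sample f S) i := by
      rw [stat, Finset.sum_div]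
      push_cast
      exact Finset.sum_le_sum fun t _ => Nat.le_ceil _
    rw [div_le_iff₀ (by positivity)] at hle
    rw [scale_sq, mul_add, mul_one, mul_div_assoc']
    gcongr
    linarith
  set m := ∫ s, Q.supGauge i (fun y => f y s) ^ 2 ∂P
  set V := ∑ t ∈ Finset.range Q.N, Q.supGauge i (Q.sample f S t) ^ 2
  have hV : 0 ≤ V := Finset.sum_nonneg fun _ _ => sq_nonneg _
  have h1 : Q.N * m / 4 - V / 2 < 5 * Q.logf i * Q.hat i ^ 2 := by
    have := mul_lt_mul_of_pos_right hlt (show 0 < Q.hat i ^ 2 by positivity)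
    have e : (Q.N * (m / Q.hat i ^ 2 / 4) - V / Q.hat i ^ 2 / 2) * Q.hat i ^ 2 =
      Q.N * m / 4 - V / 2 := by field_simp
    rwa [e] at this
  have h2 : Q.logf i * Q.hat i ^ 2 = Q.n * Q.res i ^ 2 := by
    rw [res_sq]; field_simp
  have h3 : Q.n * Q.res i ^ 2 ≤ 5 * Q.N * Q.res i ^ 2 := by gcongr
  -- Multiplying `h1` by `4 / N` turns `5 n` into `20 n / N ≤ 100`.
  have h4 : m ≤ 2 * (V / Q.N) + 100 * Q.res i ^ 2 := by
    rw [← sub_le_iff_le_add, mul_div_assoc', le_div_iff₀ hN]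
    nlinarith
  have : 0 ≤ V / Q.N := by positivity
  linarith

/-- The squared gauges of a block of samples are bounded with high probability. -/
lemma Regular.measure_sum_sqGauge_le (hf : Q.Regular P f) {lo : ℕ} (hlo : Q.N ≤ lo)
    (hlo' : lo + Q.N ≤ Q.n) :
    (Measure.pi fun _ : Fin Q.n => P) {S | Q.Good P f (Q.stat (Q.sample f S)) ∧
      216 * Q.n ≤ ∑ t ∈ Finset.range Q.N,
        Q.sqGauge (Q.stat (Q.sample f S)) (Q.sample f S (lo + t))} ≤
      ENNReal.ofReal (Real.exp (-(5 * Q.lam))) := by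
  classical
  have hn := Q.n_pos'
  have hl := Q.lam_pos
  set c := Q.lam / (3 * Q.n) with hc
  have hc0 : 0 < c := by positivity
  have hXm : ∀ p, Measurable fun s => c * Q.sqGauge p (fun y => f y s) := fun p =>
    (hf.measurable_sqGauge p).const_mul c
  have key := measure_sum_pred_le P (n := Q.n) (lo := lo) (N := Q.N) hlo'
    (h := fun _ S => Q.stat (Q.sample f S)) (fun t _ => hf.pred_stat.mono (by omega))
    -- Setting the summand to zero at bad statistics makes the moment bound valid for every state,
    -- so no conditioning on the good event is needed.
    (ξ := fun p s => if Q.Good P f p then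
      c * Q.sqGauge p (fun y => f y s) - 2 * (100 * Q.lam / Q.n) else 0)
    (fun p => by
      by_cases hp : Q.Good P f p
      · simp only [if_pos hp]; exact (hXm p).sub_const _
      · simp only [if_neg hp]; exact measurable_const)
    (fun p => by
      by_cases hp : Q.Good P f p
      · simp only [if_pos hp]
        refine lintegral_exp_nonneg_le_one P (hXm p)
          (fun s => mul_nonneg hc0.le (sqGauge_nonneg _ _)) (fun s => ?_) ?_
        · calc c * Q.sqGauge p (fun y => f y s) ≤ c * (3 * (Q.n / Q.lam)) := by
                gcongr; exact hf.sqGauge_le p s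
            _ = 1 := by rw [hc]; field_simp
        · rw [integral_const_mul]
          calc c * _ ≤ c * 300 := by gcongr; exact hf.integral_sqGauge_le hp
            _ = 100 * Q.lam / Q.n := by rw [hc]; field_simp; norm_num
      · simp [if_neg hp]) (5 * Q.lam)
  refine (measure_mono ?_).trans key
  rintro S ⟨hp, hS⟩
  simp only [Set.mem_ofPred_eq, if_pos hp]
  rw [Finset.sum_sub_distrib, Finset.sum_const, Finset.card_range, nsmul_eq_mul,
    ← Finset.mul_sum]
  -- The threshold 216 becomes `72 lam` after scaling: at most `67 lam` compensates the means, and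
  -- `5 lam` is left for the tail.
  have h1 := mul_le_mul_of_nonneg_left hS hc0.le
  have h2 : c * (216 * Q.n) = 72 * Q.lam := by rw [hc]; field_simp; norm_num
  have h3 : (Q.N : ℝ) * (2 * (100 * Q.lam / Q.n)) ≤ 67 * Q.lam := by
    rw [show (Q.N : ℝ) * (2 * (100 * Q.lam / Q.n)) = 200 * Q.lam * Q.N / Q.n by ring,
      div_le_iff₀ hn]
    nlinarith [Q.three_mul_le']
  rw [h2] at h1
  change 72 * Q.lam ≤ c * ∑ t ∈ Finset.range Q.N, Q.sqGauge (Q.stat (Q.sample f S))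
    (fun y => f y (S (Fin.ofNat Q.n (lo + t)))) at h1
  linarith

/-- Concentration of the sampled differences at predictable pairs of points. -/
lemma Regular.measure_deviation_le (hf : Q.Regular P f) {lo : ℕ} (hlo : Q.N ≤ lo)
    (hlo' : lo + Q.N ≤ Q.n) {r : ℝ} (hr : 0 < r) {u v : ℕ → (Fin Q.n → 𝒮) → ℕ}
    (hu : ∀ t < Q.N, Pred (lo + t) (u t)) (hv : ∀ t < Q.N, Pred (lo + t) (v t)) (c : ℝ) :
    (Measure.pi fun _ : Fin Q.n => P) {S | Q.Good P f (Q.stat (Q.sample f S)) ∧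
      (∀ t < Q.N, Q.Small (Q.stat (Q.sample f S)) (Q.D (u t S) - Q.D (v t S)) r) ∧
      2 * r * Q.n * (25 + c / Q.lam) ≤ ∑ t ∈ Finset.range Q.N,
        ((Q.sample f S (lo + t) (Q.D (u t S)) - Q.sample f S (lo + t) (Q.D (v t S))) -
          (risk P f (Q.D (u t S)) - risk P f (Q.D (v t S))))} ≤
      ENNReal.ofReal (Real.exp (-c)) := by
  classical
  have hn := Q.n_pos'
  have hl := Q.lam_pos
  -- With this factor the squared increments are at most `3 / 4`, and their means at most `75 lam /
  -- n`, which over a block add up to at most `25 lam`.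
  set θ := Q.lam / (2 * r * Q.n) with hθ
  have hθ0 : 0 < θ := by positivity
  set X : ℕ × ℕ → 𝒮 → ℝ := fun b s => θ * (f (Q.D b.1) s - f (Q.D b.2) s) with hX
  have hXm : ∀ b, Measurable (X b) := fun b =>
    ((hf.meas _).sub (hf.meas _)).const_mul θ
  have hXi : ∀ b, ∫ s, X b s ∂P = θ * (risk P f (Q.D b.1) - risk P f (Q.D b.2)) := fun b => by
    rw [hX, integral_const_mul, integral_sub (hf.integrable _ (Q.D_mem _))
      (hf.integrable _ (Q.D_mem _))]
    rfl
  have hXsq : ∀ p b, Q.Small p (Q.D b.1 - Q.D b.2) r → ∀ s,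
      X b s ^ 2 ≤ Q.lam / (4 * Q.n) * Q.sqGauge p (fun y => f y s) := fun p b hb s => by
    have := hf.sub_sq_le hb s
    calc X b s ^ 2 = θ ^ 2 * (f (Q.D b.1) s - f (Q.D b.2) s) ^ 2 := by rw [hX, mul_pow]
      _ ≤ θ ^ 2 * (r ^ 2 * (Q.n / Q.lam) * Q.sqGauge p (fun y => f y s)) := by gcongr
      _ = _ := by rw [hθ]; field_simp; ring
  set Ok : (GaugeIdx d → ℕ) × ℕ × ℕ → Prop := fun b =>
    Q.Good P f b.1 ∧ Q.Small b.1 (Q.D b.2.1 - Q.D b.2.2) r with hOk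
  have key := measure_sum_pred_le P (n := Q.n) (lo := lo) (N := Q.N) hlo'
    (h := fun t S => (Q.stat (Q.sample f S), u t S, v t S))
    (fun t ht => (hf.pred_stat.mono (by omega)).map₂
      ((hu t ht).map₂ (hv t ht) Prod.mk) Prod.mk)
    (ξ := fun b s => if Ok b then X b.2 s - ∫ s, X b.2 s ∂P - 75 * Q.lam / Q.n else 0)
    (fun b => by
      by_cases hp : Ok b
      · simp only [if_pos hp]; exact ((hXm b.2).sub_const _).sub_const _
      · simp only [if_neg hp]; exact measurable_const)
    (fun b => by
      by_cases hp : Ok b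
      · simp only [if_pos hp]
        refine lintegral_exp_centered_le_one P (hXm b.2) (fun s => ?_) ?_
        · rw [← sq_le_one_iff_abs_le_one]
          calc X b.2 s ^ 2 ≤ Q.lam / (4 * Q.n) * Q.sqGauge b.1 (fun y => f y s) :=
                hXsq _ _ hp.2 s
            _ ≤ Q.lam / (4 * Q.n) * (3 * (Q.n / Q.lam)) := by
                gcongr; exact hf.sqGauge_le b.1 s
            _ ≤ 1 := by
                rw [show Q.lam / (4 * Q.n) * (3 * (Q.n / Q.lam)) = 3 / 4 by field_simp]
                norm_num
        · calc ∫ s, X b.2 s ^ 2 ∂P ≤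
                ∫ s, Q.lam / (4 * Q.n) * Q.sqGauge b.1 (fun y => f y s) ∂P := by
                refine integral_mono_of_nonneg (ae_of_all _ fun s => sq_nonneg _)
                  ((hf.integrable_sqGauge b.1).const_mul _) (ae_of_all _ fun s => ?_)
                exact hXsq _ _ hp.2 s
            _ ≤ Q.lam / (4 * Q.n) * 300 := by
                rw [integral_const_mul]; gcongr; exact hf.integral_sqGauge_le hp.1
            _ = 75 * Q.lam / Q.n := by field_simp; norm_num
      · simp [if_neg hp]) c
  refine (measure_mono ?_).trans key
  rintro S ⟨hp, hsm, hS⟩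
  simp only [Set.mem_ofPred_eq]
  have hsum : ∑ t ∈ Finset.range Q.N, (if Ok (Q.stat (Q.sample f S), u t S, v t S) then
      X (u t S, v t S) (S (Fin.ofNat Q.n (lo + t))) - ∫ s, X (u t S, v t S) s ∂P -
        75 * Q.lam / Q.n else 0) =
      θ * ∑ t ∈ Finset.range Q.N,
        ((Q.sample f S (lo + t) (Q.D (u t S)) - Q.sample f S (lo + t) (Q.D (v t S))) -
          (risk P f (Q.D (u t S)) - risk P f (Q.D (v t S)))) - Q.N * (75 * Q.lam / Q.n) := by
    rw [Finset.mul_sum, ← nsmul_eq_mul, ← Finset.card_range Q.N, ← Finset.sum_const,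
      Finset.card_range, ← Finset.sum_sub_distrib]
    refine Finset.sum_congr rfl fun t ht => ?_
    rw [if_pos ⟨hp, hsm t (by simpa using ht)⟩, hXi]
    simp only [hX, sample]
    ring
  rw [hsum]
  have h1 := mul_le_mul_of_nonneg_left hS hθ0.le
  have h2 : θ * (2 * r * Q.n * (25 + c / Q.lam)) = 25 * Q.lam + c := by
    rw [hθ]; field_simp
  have h3 : (Q.N : ℝ) * (75 * Q.lam / Q.n) ≤ 25 * Q.lam := by
    rw [show (Q.N : ℝ) * (75 * Q.lam / Q.n) = 75 * Q.lam * Q.N / Q.n by ring,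
      div_le_iff₀ hn]
    nlinarith [Q.three_mul_le']
  rw [h2] at h1
  linarith

end Setup

end StochOpt
end

/-! ### Validation scores, online-to-batch conversion, and lower bounds at large scales. -/

noncomputable section

namespace StochOpt

namespace Setup

variable {d : ℕ} (Q : Setup d)

/-- The validation score of a candidate, from the third block of functions. -/
def score (y : ℕ → Vec d → ℝ) : Option ℤ → ℝ
  | none => 0
  | some k => ∑ t ∈ Finset.range Q.N,
      (y (2 * Q.N + t) (Q.D (Q.candIdx y k)) - y (2 * Q.N + t) (Q.D 0)) + 8300 * Q.n * 2 ^ k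

/-- The tolerance in the choice of the candidate. -/
def slack : Option ℤ → ℝ
  | none => 0
  | some k => Q.n * 2 ^ k

/-- The index of the candidates, including the origin. -/
def choiceIdx (y : ℕ → Vec d → ℝ) : Option ℤ → ℕ
  | none => 0
  | some k => Q.candIdx y k

open Classical in
/-- The index of the point that the algorithm returns. -/
def outIdx (y : ℕ → Vec d → ℝ) : ℕ :=
  if h : ∃ w, ∀ v, Q.score y w - Q.slack w ≤ Q.score y v then Q.choiceIdx y h.choose else 0

/-- There are infinitely many scales, so the infimum `m` may not be attained, and the slack vanishes
at small scales. If `m < 0`, a score below `m / 2` forces `2 ^ k ≥ -m / (2 κ)`, so near-minimizers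
have slack bounded away from zero; if `m = 0`, the origin is an exact choice. -/
lemma exists_choice {T : Option ℤ → ℝ} (h0 : T none = 0) {κ B : ℝ} (hκ : 0 < κ)
    (hT : ∀ k : ℤ, -(κ * 2 ^ k) ≤ T (some k)) (hB : ∀ v, B ≤ T v) :
    ∃ w, ∀ v, T w - Q.slack w ≤ T v := by
  have hn := Q.n_pos'
  have hbdd : BddBelow (Set.range T) := ⟨B, by rintro _ ⟨v, rfl⟩; exact hB v⟩
  set m := ⨅ v, T v with hm
  have hle : ∀ v, m ≤ T v := fun v => ciInf_le hbdd v
  have hm0 : m ≤ 0 := h0 ▸ hle none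
  rcases hm0.eq_or_lt with h | h
  · exact ⟨none, fun v => by simpa [slack, h0, ← h] using hle v⟩
  · obtain ⟨v, hv⟩ := exists_lt_of_ciInf_lt
      (show ⨅ v, T v < m + min (-m / 2) (Q.n * (-m / (2 * κ))) by
        rw [← hm]
        have : 0 < min (-m / 2) (Q.n * (-m / (2 * κ))) :=
          lt_min (by linarith) (mul_pos hn (div_pos (by linarith) (by linarith)))
        linarith)
    have h1 : T v < m / 2 := by
      have := min_le_left (-m / 2) (Q.n * (-m / (2 * κ)))
      linarith
    rcases v with _ | k
    · rw [h0] at h1; linarith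
    · refine ⟨some k, fun v => le_trans ?_ (hle v)⟩
      have h2 : -m / (2 * κ) ≤ 2 ^ k := by
        rw [div_le_iff₀ (by linarith)]
        have := hT k
        linarith
      have h3 := min_le_right (-m / 2) (Q.n * (-m / (2 * κ)))
      have h4 := mul_le_mul_of_nonneg_left h2 hn.le
      simp only [slack]
      linarith

variable {Q} {𝒮 : Type*} [MeasurableSpace 𝒮] {P : Measure 𝒮} {f : Vec d → 𝒮 → ℝ}

lemma Regular.risk_convexOn (hf : Q.Regular P f) : ConvexOn ℝ Q.X (risk P f) := by
  refine ⟨Q.convex, fun x hx y hy a b ha hb hab => ?_⟩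
  have hxy := Q.convex hx hy ha hb hab
  have e : a • risk P f x + b • risk P f y = ∫ s, (a * f x s + b * f y s) ∂P := by
    rw [integral_add ((hf.integrable x hx).const_mul a) ((hf.integrable y hy).const_mul b),
      integral_const_mul, integral_const_mul]
    rfl
  rw [e]
  exact integral_mono (hf.integrable _ hxy)
    (((hf.integrable x hx).const_mul a).add ((hf.integrable y hy).const_mul b))
    fun s => (hf.convexOn s).2 hx hy ha hb hab

lemma Regular.risk_sub_le [IsProbabilityMeasure P] (hf : Q.Regular P f) {x u : Vec d}
    (hx : x ∈ Q.X) (hu : u ∈ Q.X) :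
    risk P f x - risk P f u ≤ Q.Lhat * ‖x - u‖ := by
  have h1 : risk P f x - risk P f u = ∫ s, (f x s - f u s) ∂P :=
    (integral_sub (hf.integrable x hx) (hf.integrable u hu)).symm
  rw [h1]
  calc ∫ s, (f x s - f u s) ∂P ≤ ∫ _s, Q.Lhat * ‖x - u‖ ∂P :=
        integral_mono ((hf.integrable x hx).sub (hf.integrable u hu)) (integrable_const _)
          fun s => convexOn_sub_le_norm (hf.convexOn s) hx hu (hf.diff s x hx)
            (hf.norm_gradient_le s hx)
    _ = _ := by simp

lemma tol_pos (p : GaugeIdx d → ℕ) {ρ : ℝ} (hρ : 0 < ρ) : 0 < ρ / (Q.Lhat + (Q.geom p).a) :=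
  div_pos hρ (by linarith [Q.Lhat_pos, (Q.geom p).a_pos])

lemma Lhat_mul_tol_le (p : GaugeIdx d → ℕ) {ρ : ℝ} (hρ : 0 < ρ) :
    Q.Lhat * (ρ / (Q.Lhat + (Q.geom p).a)) ≤ ρ := by
  have ha := (Q.geom p).a_pos
  have hL := Q.Lhat_pos
  rw [mul_div_assoc', div_le_iff₀ (by linarith)]
  nlinarith [mul_pos hρ ha]

lemma norm_playPt_sub_le (p : GaugeIdx d → ℕ) {c : Vec d} (hc : c ∈ Q.X) {ρ : ℝ} (hρ : 0 < ρ)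
    (k : Fin d → ℤ) :
    ‖playPt (Q.geom p) Q.X c ρ k - Q.D (Q.runIdx p c ρ k)‖ ≤ ρ / (Q.Lhat + (Q.geom p).a) :=
  nearIdx_spec Q.D_dense (playPt_mem Q.closed hc ρ k) (tol_pos p hρ)

lemma small_runIdx (p : GaugeIdx d → ℕ) {c : Vec d} (hc : c ∈ Q.X) {ρ : ℝ} (hρ : 0 < ρ)
    (k : Fin d → ℤ) : Q.Small p (Q.D (Q.runIdx p c ρ k) - c) (3 * ρ) := by
  have h1 := small_of_norm_le p hρ.le (norm_playPt_sub_le (Q := Q) p hc hρ k)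
  have h2 := small_image (Q := Q) p (ρ := ρ)
    (leader_spec (M := Q.geom p) Q.closed hc ρ (unquant (Q.geom p).τ k)).1.1
  have h3 := h2.add (by positivity) hρ.le h1.neg
  have e : Q.D (Q.runIdx p c ρ k) - c =
      ρ • (Q.geom p).A (leader (Q.geom p) Q.X c ρ (unquant (Q.geom p).τ k)) +
        -(playPt (Q.geom p) Q.X c ρ k - Q.D (Q.runIdx p c ρ k)) := by
    rw [playPt]; abel
  rw [e, show 3 * ρ = 2 * ρ + ρ by ring]
  exact h3

lemma avgPt_eq (p : GaugeIdx d → ℕ) {c : Vec d} (hc : c ∈ Q.X) (ρ : ℝ)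
    (k : Fin Q.N → Fin d → ℤ) :
    ∃ v ∈ feasible (Q.geom p) Q.X c ρ, Q.avgPt p c ρ k = c + ρ • (Q.geom p).A v := by
  have hN := Q.N_pos'
  refine ⟨∑ t, (Q.N : ℝ)⁻¹ • leader (Q.geom p) Q.X c ρ (unquant (Q.geom p).τ (k t)), ?_, ?_⟩
  · exact (convex_feasible Q.convex c ρ).sum_mem (fun _ _ => by positivity)
      (by simp [hN.ne']) fun t _ => (leader_spec Q.closed hc ρ _).1
  · simp only [avgPt, playPt, Finset.sum_add_distrib, Finset.sum_const, Finset.card_univ,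
      Fintype.card_fin, smul_add, map_sum, map_smul, Finset.smul_sum]
    rw [← Nat.cast_smul_eq_nsmul ℝ, smul_smul, inv_mul_cancel₀ hN.ne', one_smul]
    congr 1
    exact Finset.sum_congr rfl fun t _ => smul_comm _ _ _

lemma avgPt_mem (p : GaugeIdx d → ℕ) {c : Vec d} (hc : c ∈ Q.X) (ρ : ℝ)
    (k : Fin Q.N → Fin d → ℤ) : Q.avgPt p c ρ k ∈ Q.X := by
  obtain ⟨v, hv, e⟩ := avgPt_eq p hc ρ k
  rw [e]
  exact hv.2

lemma norm_avgPt_sub_le (p : GaugeIdx d → ℕ) {c : Vec d} (hc : c ∈ Q.X) {ρ : ℝ} (hρ : 0 < ρ)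
    (k : Fin Q.N → Fin d → ℤ) :
    ‖Q.avgPt p c ρ k - Q.D (Q.avgIdx p c ρ k)‖ ≤ ρ / (Q.Lhat + (Q.geom p).a) :=
  nearIdx_spec Q.D_dense (avgPt_mem p hc ρ k) (tol_pos p hρ)

lemma small_candIdx (y : ℕ → Vec d → ℝ) (k : ℤ) :
    Q.Small (Q.stat y) (Q.D (Q.candIdx y k)) (3 * 2 ^ k) := by
  have hρ : (0 : ℝ) < 2 ^ k := by positivity
  set κ : Fin Q.N → Fin d → ℤ := fun t => Q.runState (Q.stat y) 0 (2 ^ k) Q.N y t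
  have h1 := small_of_norm_le (Q.stat y) hρ.le
    (norm_avgPt_sub_le (Q := Q) (Q.stat y) Q.zero_mem hρ κ)
  obtain ⟨v, hv, e⟩ := avgPt_eq (Q := Q) (Q.stat y) Q.zero_mem (2 ^ k) κ
  have h2 := small_image (Q := Q) (Q.stat y) (ρ := 2 ^ k) hv.1
  have h3 := h2.add (by positivity) hρ.le h1.neg
  rw [e, zero_add] at h3
  have e' : Q.D (Q.candIdx y k) = (2 : ℝ) ^ k • (Q.geom (Q.stat y)).A v +
      -((2 : ℝ) ^ k • (Q.geom (Q.stat y)).A v - Q.D (Q.avgIdx (Q.stat y) 0 (2 ^ k) κ)) := by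
    rw [candIdx]; abel
  rw [e', show (3 : ℝ) * 2 ^ k = 2 * 2 ^ k + 2 ^ k by ring]
  exact h3

/-- Regret of a run on a block of samples with bounded squared gauges. -/
lemma Regular.run_regret (hf : Q.Regular P f) (S : Fin Q.n → 𝒮) (p : GaugeIdx d → ℕ) {c : Vec d}
    (hc : c ∈ Q.X) {ρ : ℝ} (hρ : 0 < ρ) (lo : ℕ) {v : Blocks d}
    (hv : v ∈ feasible (Q.geom p) Q.X c ρ)
    (hG : ∑ t ∈ Finset.range Q.N, Q.sqGauge p (Q.sample f S (lo + t)) < 216 * Q.n) :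
    ∑ t ∈ Finset.range Q.N,
      (Q.sample f S (lo + t) (Q.D (Q.runIdx p c ρ (Q.runState p c ρ lo (Q.sample f S) t))) -
        Q.sample f S (lo + t) (c + ρ • (Q.geom p).A v)) ≤ 3900 * ρ * Q.n := by
  have hn := Q.n_pos'
  have := gradState_regret (M := Q.geom p) (D := Q.D) (Lhat := Q.Lhat) hn Q.lam_pos
    (Q.lam_le.trans Q.lamd_le) Q.closed Q.convex Q.D_mem Q.D_dense Q.Lhat_pos hc hρ (N := Q.N)
    (y := fun t => Q.sample f S (lo + t)) (fun t _ => hf.convexOn _) (fun t _ => hf.diff _)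
    (fun t _ x hx => hf.norm_gradient_le _ hx)
    (Γ := fun t => Q.sqGauge p (Q.sample f S (lo + t)))
    (fun t _ i => hf.gauge_le_sqGauge p _ i) hv
  refine this.trans ?_
  have h3 := Q.three_mul_le'
  calc ρ * (4 * Q.n + 23 * Q.N +
        18 * ∑ t ∈ Finset.range Q.N, Q.sqGauge p (Q.sample f S (lo + t)))
      ≤ ρ * (3900 * Q.n) := by gcongr; linarith
    _ = _ := by ring

/-- The sampled deviation of differences from their means on the block that starts at `lo`. -/
def deviation (P : Measure 𝒮) (f : Vec d → 𝒮 → ℝ) (S : Fin Q.n → 𝒮) (lo : ℕ) (u v : ℕ → ℕ) : ℝ :=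
  ∑ t ∈ Finset.range Q.N,
    ((Q.sample f S (lo + t) (Q.D (u t)) - Q.sample f S (lo + t) (Q.D (v t))) -
      (risk P f (Q.D (u t)) - risk P f (Q.D (v t))))

/-- The candidate at the right scale is nearly optimal. -/
lemma Regular.risk_candIdx_le [IsProbabilityMeasure P] (hf : Q.Regular P f)
    (S : Fin Q.n → 𝒮) (k : ℤ) {m : ℕ} {p : GaugeIdx d → ℕ} (hp : p = Q.stat (Q.sample f S))
    {v : Blocks d}
    (hv : v ∈ unitBlocks d) (hm : Q.D m = (2 : ℝ) ^ k • (Q.geom p).A v)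
    (hG : ∑ t ∈ Finset.range Q.N, Q.sqGauge p (Q.sample f S (Q.N + t)) < 216 * Q.n)
    (hdev : deviation P f S Q.N (fun _ => m) (fun t => Q.runIdx p 0 (2 ^ k)
      (Q.runState p 0 (2 ^ k) Q.N (Q.sample f S) t)) < 300 * 2 ^ k * Q.n) :
    risk P f (Q.D (Q.candIdx (Q.sample f S) k)) ≤ risk P f (Q.D m) + 21010 * 2 ^ k := by
  have hρ : (0 : ℝ) < 2 ^ k := by positivity
  have hN := Q.N_pos'
  have h5 := Q.le_five_mul'
  set ρ : ℝ := 2 ^ k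
  set y := Q.sample f S
  set st : ℕ → Fin d → ℤ := fun t => Q.runState p 0 ρ Q.N y t with hst
  set ix : ℕ → ℕ := fun t => Q.runIdx p 0 ρ (st t) with hix
  have hvf : v ∈ feasible (Q.geom p) Q.X 0 ρ := ⟨hv, by rw [zero_add, ← hm]; exact Q.D_mem m⟩
  have hreg := hf.run_regret S p Q.zero_mem hρ Q.N hvf hG
  rw [zero_add, ← hm] at hreg
  rw [deviation] at hdev
  have hsum : ∑ t ∈ Finset.range Q.N, (risk P f (Q.D (ix t)) - risk P f (Q.D m)) ≤
      4200 * ρ * Q.n := by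
    have e : ∑ t ∈ Finset.range Q.N, (risk P f (Q.D (ix t)) - risk P f (Q.D m)) =
        ∑ t ∈ Finset.range Q.N, ((y (Q.N + t) (Q.D m) - y (Q.N + t) (Q.D (ix t))) -
          (risk P f (Q.D m) - risk P f (Q.D (ix t)))) +
        ∑ t ∈ Finset.range Q.N, (y (Q.N + t) (Q.D (ix t)) - y (Q.N + t) (Q.D m)) := by
      rw [← Finset.sum_add_distrib]
      exact Finset.sum_congr rfl fun t _ => by ring
    rw [e]
    linarith
  -- Jensen applies to the average of the rounded points, while the candidate is the rounded average
  -- of the unrounded ones; they are at most two tolerances apart.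
  set xbar : Vec d := ∑ t ∈ Finset.range Q.N, (Q.N : ℝ)⁻¹ • Q.D (ix t) with hxbar
  have hw1 : ∑ _t ∈ Finset.range Q.N, (Q.N : ℝ)⁻¹ = 1 := by simp [hN.ne']
  have hxmem : xbar ∈ Q.X := Q.convex.sum_mem (fun _ _ => by positivity) hw1
    fun t _ => Q.D_mem _
  have hjen : risk P f xbar ≤ risk P f (Q.D m) + 21000 * ρ := by
    have h1 := hf.risk_convexOn.map_sum_le (t := Finset.range Q.N) (w := fun _ => (Q.N : ℝ)⁻¹)
      (p := fun t => Q.D (ix t)) (fun _ _ => by positivity) hw1 fun t _ => Q.D_mem _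
    simp only [smul_eq_mul] at h1
    rw [← Finset.mul_sum] at h1
    rw [Finset.sum_sub_distrib, Finset.sum_const, Finset.card_range, nsmul_eq_mul] at hsum
    refine h1.trans ?_
    rw [inv_mul_le_iff₀ hN]
    nlinarith
  have hnear1 : ‖Q.avgPt p 0 ρ (fun t => st t) - Q.D (Q.candIdx y k)‖ ≤
      ρ / (Q.Lhat + (Q.geom p).a) := by
    have := norm_avgPt_sub_le (Q := Q) p Q.zero_mem hρ (fun t => st t)
    rw [candIdx, ← hp]
    exact this
  have hnear2 : ‖Q.avgPt p 0 ρ (fun t => st t) - xbar‖ ≤ ρ / (Q.Lhat + (Q.geom p).a) := by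
    have e : Q.avgPt p 0 ρ (fun t => st t) - xbar = (Q.N : ℝ)⁻¹ • ∑ t ∈ Finset.range Q.N,
        (playPt (Q.geom p) Q.X 0 ρ (st t) - Q.D (ix t)) := by
      rw [avgPt, Fin.sum_univ_eq_sum_range (fun t => playPt (Q.geom p) Q.X 0 ρ (st t)) Q.N,
        hxbar, ← Finset.smul_sum, ← smul_sub, Finset.sum_sub_distrib]
    rw [e, norm_smul, Real.norm_eq_abs, abs_of_pos (by positivity), inv_mul_le_iff₀ hN]
    refine (norm_sum_le _ _).trans ?_
    calc _ ≤ ∑ _t ∈ Finset.range Q.N, ρ / (Q.Lhat + (Q.geom p).a) :=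
          Finset.sum_le_sum fun t _ => norm_playPt_sub_le p Q.zero_mem hρ (st t)
      _ = _ := by simp
  have hlip := hf.risk_sub_le (Q.D_mem (Q.candIdx y k)) hxmem
  have hdist : ‖Q.D (Q.candIdx y k) - xbar‖ ≤ 2 * (ρ / (Q.Lhat + (Q.geom p).a)) := by
    have e : Q.D (Q.candIdx y k) - xbar = (Q.avgPt p 0 ρ (fun t => st t) - xbar) -
        (Q.avgPt p 0 ρ (fun t => st t) - Q.D (Q.candIdx y k)) := by abel
    rw [e]
    refine (norm_sub_le _ _).trans ?_
    linarith
  have := mul_le_mul_of_nonneg_left hdist Q.Lhat_pos.le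
  have h2 := Lhat_mul_tol_le (Q := Q) p hρ
  linarith

/-- On the third block, no point at the right scale is much better than `Q.D m`. -/
lemma Regular.sum_sub_le_of_feasible (hf : Q.Regular P f) (S : Fin Q.n → 𝒮) {m : ℕ}
    {p : GaugeIdx d → ℕ} {ρ : ℝ} (hρ : 0 < ρ)
    (hopt : ∀ x ∈ Q.X, risk P f (Q.D m) ≤ risk P f x + ρ)
    (hG : ∑ t ∈ Finset.range Q.N, Q.sqGauge p (Q.sample f S (2 * Q.N + t)) < 216 * Q.n)
    (hdev : deviation P f S (2 * Q.N) (fun _ => m) (fun t => Q.runIdx p (Q.D m) ρ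
      (Q.runState p (Q.D m) ρ (2 * Q.N) (Q.sample f S) t)) < 180 * ρ * Q.n)
    {v : Blocks d} (hv : v ∈ feasible (Q.geom p) Q.X (Q.D m) ρ) :
    ∑ t ∈ Finset.range Q.N, (Q.sample f S (2 * Q.N + t) (Q.D m) -
      Q.sample f S (2 * Q.N + t) (Q.D m + ρ • (Q.geom p).A v)) ≤ 4100 * ρ * Q.n := by
  have hN := Q.N_pos'
  have h3 := Q.three_mul_le'
  set y := Q.sample f S
  set ix : ℕ → ℕ := fun t => Q.runIdx p (Q.D m) ρ (Q.runState p (Q.D m) ρ (2 * Q.N) y t) with hix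
  -- This run uses the unknown point `Q.D m` and belongs to the analysis only. Its iterates do not
  -- beat `Q.D m` in risk by more than `ρ`, hence not by much on the block; by regret, neither does
  -- any fixed point of the body.
  have hreg := hf.run_regret S p (Q.D_mem m) hρ (2 * Q.N) hv hG
  rw [deviation] at hdev
  have hrisk : ∑ t ∈ Finset.range Q.N, (risk P f (Q.D m) - risk P f (Q.D (ix t))) ≤ Q.N * ρ := by
    calc _ ≤ ∑ _t ∈ Finset.range Q.N, ρ :=
          Finset.sum_le_sum fun t _ => by linarith [hopt _ (Q.D_mem (ix t))]
      _ = _ := by simp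
  have e : ∑ t ∈ Finset.range Q.N, (y (2 * Q.N + t) (Q.D m) -
      y (2 * Q.N + t) (Q.D m + ρ • (Q.geom p).A v)) =
      ∑ t ∈ Finset.range Q.N, ((y (2 * Q.N + t) (Q.D m) - y (2 * Q.N + t) (Q.D (ix t))) -
          (risk P f (Q.D m) - risk P f (Q.D (ix t)))) +
        ∑ t ∈ Finset.range Q.N, (risk P f (Q.D m) - risk P f (Q.D (ix t))) +
        ∑ t ∈ Finset.range Q.N, (y (2 * Q.N + t) (Q.D (ix t)) -
          y (2 * Q.N + t) (Q.D m + ρ • (Q.geom p).A v)) := by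
    rw [← Finset.sum_add_distrib, ← Finset.sum_add_distrib]
    exact Finset.sum_congr rfl fun t _ => by ring
  rw [e]
  nlinarith

/-- The lower bound at one scale extends to larger scales by convexity. -/
lemma Regular.sum_sub_le_of_le_scale (hf : Q.Regular P f) (S : Fin Q.n → 𝒮) {m : ℕ}
    {p : GaugeIdx d → ℕ} {ρ ρ' : ℝ} (hρ : 0 < ρ) (hρ' : ρ ≤ ρ') {v v' : Blocks d}
    (hv : v ∈ unitBlocks d) (hm : Q.D m = ρ • (Q.geom p).A v)
    (hv' : v' ∈ feasible (Q.geom p) Q.X 0 ρ')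
    (hlow : ∀ w ∈ feasible (Q.geom p) Q.X (Q.D m) ρ,
      ∑ t ∈ Finset.range Q.N, (Q.sample f S (2 * Q.N + t) (Q.D m) -
        Q.sample f S (2 * Q.N + t) (Q.D m + ρ • (Q.geom p).A w)) ≤ 4100 * ρ * Q.n) :
    ∑ t ∈ Finset.range Q.N, (Q.sample f S (2 * Q.N + t) (Q.D m) -
      Q.sample f S (2 * Q.N + t) (ρ' • (Q.geom p).A v')) ≤ 8200 * ρ' * Q.n := by
  have hρ'0 : 0 < ρ' := hρ.trans_le hρ'
  have hn := Q.n_pos'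
  set θ := ρ / (2 * ρ') with hθ
  have hθ0 : 0 < θ := by positivity
  have hθ1 : θ ≤ 1 / 2 := by rw [hθ, div_le_iff₀ (by positivity)]; linarith
  have hx' : ρ' • (Q.geom p).A v' ∈ Q.X := by simpa using hv'.2
  -- Chosen so that `Q.D m + ρ • A w` is the point at fraction `θ = ρ / (2 ρ')` of the segment from
  -- `Q.D m` to `ρ' • A v'`. A gain at the far end would give `θ` times that gain within the small
  -- body.
  set w : Blocks d := (1 / 2 : ℝ) • v' + (1 / 2 : ℝ) • ((ρ / ρ') • -v) with hw
  have hρρ : ρ / ρ' ≤ 1 := (div_le_one hρ'0).2 hρ'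
  have hwu : w ∈ unitBlocks d := by
    refine convex_unitBlocks hv'.1 ?_ (by norm_num) (by norm_num) (by norm_num)
    have := convex_unitBlocks (neg_mem_unitBlocks hv) (zero_mem_unitBlocks (d := d))
      (show 0 ≤ ρ / ρ' by positivity) (sub_nonneg.2 hρρ) (by ring)
    simpa using this
  have hpt : Q.D m + ρ • (Q.geom p).A w = (1 - θ) • Q.D m + θ • (ρ' • (Q.geom p).A v') := by
    have e1 : θ * ρ' = ρ * (1 / 2) := by rw [hθ]; field_simp
    have e2 : ρ * (1 / 2 * (ρ / ρ')) = θ * ρ := by rw [hθ]; field_simp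
    simp only [hw, map_add, map_smul, map_neg, smul_add, smul_neg, smul_smul, sub_smul, one_smul]
    rw [e1, e2, hm, smul_smul]
    abel
  have hwf : w ∈ feasible (Q.geom p) Q.X (Q.D m) ρ := by
    refine ⟨hwu, ?_⟩
    rw [hpt]
    exact Q.convex (Q.D_mem m) hx' (by linarith) hθ0.le (by ring)
  have h := hlow w hwf
  have hle : θ * ∑ t ∈ Finset.range Q.N, (Q.sample f S (2 * Q.N + t) (Q.D m) -
      Q.sample f S (2 * Q.N + t) (ρ' • (Q.geom p).A v')) ≤
      ∑ t ∈ Finset.range Q.N, (Q.sample f S (2 * Q.N + t) (Q.D m) -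
        Q.sample f S (2 * Q.N + t) (Q.D m + ρ • (Q.geom p).A w)) := by
    rw [Finset.mul_sum]
    refine Finset.sum_le_sum fun t _ => ?_
    have := (hf.convexOn (S (Fin.ofNat Q.n (2 * Q.N + t)))).2 (Q.D_mem m) hx'
      (show 0 ≤ 1 - θ by linarith) hθ0.le (by ring)
    rw [hpt]
    simp only [smul_eq_mul, sample] at this ⊢
    linarith
  have h2 := hle.trans h
  have e3 : 4100 * ρ * Q.n = θ * (8200 * ρ' * Q.n) := by rw [hθ]; field_simp; norm_num
  rw [e3] at h2
  exact le_of_mul_le_mul_left h2 hθ0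

end Setup

end StochOpt
end

/-! ### Selection among the candidates and the union of the bad events. -/

noncomputable section

namespace StochOpt

namespace Setup

variable {d : ℕ} {Q : Setup d} {𝒮 : Type*} [MeasurableSpace 𝒮] {P : Measure 𝒮}
  {f : Vec d → 𝒮 → ℝ}

lemma deviation_const (S : Fin Q.n → 𝒮) (lo i j : ℕ) :
    deviation P f S lo (fun _ => i) (fun _ => j) = ∑ t ∈ Finset.range Q.N,
      (Q.sample f S (lo + t) (Q.D i) - Q.sample f S (lo + t) (Q.D j)) -
      Q.N * (risk P f (Q.D i) - risk P f (Q.D j)) := by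
  rw [deviation, Finset.sum_sub_distrib, Finset.sum_const, Finset.card_range, nsmul_eq_mul]

/-- On the good event, candidates at large scales are not much better than `Q.D m` on the third
block. -/
lemma Regular.sum_sub_candIdx_le (hf : Q.Regular P f) (S : Fin Q.n → 𝒮) {m : ℕ} {k k' : ℤ}
    (hkk : k ≤ k') {p : GaugeIdx d → ℕ} (hp : p = Q.stat (Q.sample f S)) {v : Blocks d}
    (hv : v ∈ unitBlocks d) (hm : Q.D m = (2 : ℝ) ^ k • (Q.geom p).A v)
    (hlow : ∀ w ∈ feasible (Q.geom p) Q.X (Q.D m) (2 ^ k),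
      ∑ t ∈ Finset.range Q.N, (Q.sample f S (2 * Q.N + t) (Q.D m) -
        Q.sample f S (2 * Q.N + t) (Q.D m + (2 : ℝ) ^ k • (Q.geom p).A w)) ≤
          4100 * 2 ^ k * Q.n) :
    ∑ t ∈ Finset.range Q.N, (Q.sample f S (2 * Q.N + t) (Q.D m) -
      Q.sample f S (2 * Q.N + t) (Q.D (Q.candIdx (Q.sample f S) k'))) ≤ 8201 * 2 ^ k' * Q.n := by
  have hρ : (0 : ℝ) < 2 ^ k := by positivity
  have hρ' : (0 : ℝ) < 2 ^ k' := by positivity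
  have hle : (2 : ℝ) ^ k ≤ 2 ^ k' := zpow_le_zpow_right₀ (by norm_num) hkk
  set y := Q.sample f S
  set κ : Fin Q.N → Fin d → ℤ := fun t => Q.runState p 0 (2 ^ k') Q.N y t with hκ
  obtain ⟨v', hv', e⟩ := avgPt_eq (Q := Q) p Q.zero_mem (2 ^ k') κ
  have h1 := hf.sum_sub_le_of_le_scale S hρ hle hv hm hv' hlow
  have hnear := norm_avgPt_sub_le (Q := Q) p Q.zero_mem hρ' κ
  have hcand : Q.candIdx y k' = Q.avgIdx p 0 (2 ^ k') κ := by rw [candIdx, hκ, hp]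
  rw [zero_add] at e
  have hx : (2 : ℝ) ^ k' • (Q.geom p).A v' ∈ Q.X := e ▸ avgPt_mem p Q.zero_mem _ κ
  have hdiff : ∀ t, y (2 * Q.N + t) ((2 : ℝ) ^ k' • (Q.geom p).A v') -
      y (2 * Q.N + t) (Q.D (Q.candIdx y k')) ≤ 2 ^ k' := fun t => by
    have := convexOn_sub_le_norm (hf.convexOn (S (Fin.ofNat Q.n (2 * Q.N + t)))) hx
      (Q.D_mem (Q.candIdx y k')) (hf.diff _ _ hx) (hf.norm_gradient_le _ hx)
    refine this.trans ((mul_le_mul_of_nonneg_left ?_ Q.Lhat_pos.le).trans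
      (Lhat_mul_tol_le (Q := Q) p hρ'))
    rw [hcand, ← e]
    exact hnear
  have h2 : ∑ t ∈ Finset.range Q.N, (y (2 * Q.N + t) ((2 : ℝ) ^ k' • (Q.geom p).A v') -
      y (2 * Q.N + t) (Q.D (Q.candIdx y k'))) ≤ Q.N * 2 ^ k' := by
    calc _ ≤ ∑ _t ∈ Finset.range Q.N, (2 : ℝ) ^ k' := Finset.sum_le_sum fun t _ => hdiff t
      _ = _ := by simp
  have h3 := Q.three_mul_le'
  have e2 : ∑ t ∈ Finset.range Q.N, (y (2 * Q.N + t) (Q.D m) -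
      y (2 * Q.N + t) (Q.D (Q.candIdx y k'))) =
      ∑ t ∈ Finset.range Q.N, (y (2 * Q.N + t) (Q.D m) -
        y (2 * Q.N + t) ((2 : ℝ) ^ k' • (Q.geom p).A v')) +
      ∑ t ∈ Finset.range Q.N, (y (2 * Q.N + t) ((2 : ℝ) ^ k' • (Q.geom p).A v') -
        y (2 * Q.N + t) (Q.D (Q.candIdx y k'))) := by
    rw [← Finset.sum_add_distrib]
    exact Finset.sum_congr rfl fun t _ => by ring
  rw [e2]
  nlinarith [Q.N_pos']

/-- A crude sure bound, linear in the scale; it serves only to show that a choice exists. -/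
lemma Regular.neg_le_score (hf : Q.Regular P f) (S : Fin Q.n → 𝒮) (k : ℤ) :
    -(Q.N * (6 * (Q.n / Q.lam)) * 2 ^ k) ≤ Q.score (Q.sample f S) (some k) := by
  have hn := Q.n_pos'
  have hl := Q.lam_pos
  have hρ : (0 : ℝ) < 2 ^ k := by positivity
  have hsm := small_candIdx (Q := Q) (Q.sample f S) k
  rw [← sub_zero (Q.D (Q.candIdx (Q.sample f S) k)), ← Q.D_zero] at hsm
  have h : ∀ t, -(6 * (Q.n / Q.lam) * 2 ^ k) ≤
      Q.sample f S (2 * Q.N + t) (Q.D (Q.candIdx (Q.sample f S) k)) -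
        Q.sample f S (2 * Q.N + t) (Q.D 0) := fun t => by
    refine (abs_le.1 (abs_le_of_sq_le_sq ?_ (by positivity))).1
    refine (hf.sub_sq_le hsm (S (Fin.ofNat Q.n (2 * Q.N + t)))).trans ?_
    have := hf.sqGauge_le (Q.stat (Q.sample f S)) (S (Fin.ofNat Q.n (2 * Q.N + t)))
    calc _ ≤ (3 * 2 ^ k) ^ 2 * (Q.n / Q.lam) * (3 * (Q.n / Q.lam)) := by gcongr
      _ = 27 * ((Q.n / Q.lam) * 2 ^ k) ^ 2 := by ring
      _ ≤ 36 * ((Q.n / Q.lam) * 2 ^ k) ^ 2 := by gcongr; norm_num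
      _ = _ := by ring
  have hs : -(Q.N * (6 * (Q.n / Q.lam)) * 2 ^ k) ≤ ∑ t ∈ Finset.range Q.N,
      (Q.sample f S (2 * Q.N + t) (Q.D (Q.candIdx (Q.sample f S) k)) -
        Q.sample f S (2 * Q.N + t) (Q.D 0)) := by
    calc _ = ∑ _t ∈ Finset.range Q.N, -(6 * (Q.n / Q.lam) * 2 ^ k) := by simp; ring
      _ ≤ _ := Finset.sum_le_sum fun t _ => h t
  have : (0 : ℝ) ≤ 8300 * Q.n * 2 ^ k := by positivity
  simp only [score]
  linarith

/-- The deterministic part of the analysis of the choice among the candidates. -/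
lemma Regular.risk_outIdx_le (hf : Q.Regular P f) (S : Fin Q.n → 𝒮) {m : ℕ} {k : ℤ}
    (hcand : risk P f (Q.D (Q.candIdx (Q.sample f S) k)) ≤ risk P f (Q.D m) + 21010 * 2 ^ k)
    (hlarge : ∀ k' ≥ k, ∑ t ∈ Finset.range Q.N, (Q.sample f S (2 * Q.N + t) (Q.D m) -
      Q.sample f S (2 * Q.N + t) (Q.D (Q.candIdx (Q.sample f S) k'))) ≤ 8201 * 2 ^ k' * Q.n)
    (hval : deviation P f S (2 * Q.N) (fun _ => Q.candIdx (Q.sample f S) k) (fun _ => m) <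
      300 * 2 ^ k * Q.n)
    (hzero : deviation P f S (2 * Q.N) (fun _ => m) (fun _ => 0) < 120 * 2 ^ k * Q.n)
    (hsmall : ∀ j : ℕ, deviation P f S (2 * Q.N) (fun _ => 0)
      (fun _ => Q.candIdx (Q.sample f S) (k + 8 - j)) <
        6 * 2 ^ (k + 8 - j : ℤ) * Q.n * (30 + j)) :
    risk P f (Q.D (Q.outIdx (Q.sample f S))) ≤ risk P f (Q.D m) + 320000 * 2 ^ k := by
  have hn := Q.n_pos'
  have hN := Q.N_pos'
  have hl := Q.lam_pos
  have h3 := Q.three_mul_le'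
  have h5 := Q.le_five_mul'
  set y := Q.sample f S with hy
  set ρ : ℝ := 2 ^ k with hρdef
  have hρ : 0 < ρ := by positivity
  set s : ℕ → ℝ := fun i => ∑ t ∈ Finset.range Q.N, y (2 * Q.N + t) (Q.D i) with hs
  have hsub : ∀ i j, ∑ t ∈ Finset.range Q.N, (y (2 * Q.N + t) (Q.D i) - y (2 * Q.N + t) (Q.D j)) =
      s i - s j := fun i j => Finset.sum_sub_distrib _ _
  simp only [deviation_const, ← hy, hsub] at hval hzero hsmall hlarge
  have hscore : ∀ k', Q.score y (some k') =
      s (Q.candIdx y k') - s 0 + 8300 * Q.n * 2 ^ k' := fun k' => by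
    simp only [score, hsub]
  -- the score is bounded below, so that a choice exists
  have hex : ∃ w, ∀ v, Q.score y w - Q.slack w ≤ Q.score y v := by
    refine Q.exists_choice (T := Q.score y) rfl (κ := Q.N * (6 * (Q.n / Q.lam)))
      (B := min 0 (min (s m - s 0) (-(Q.N * (6 * (Q.n / Q.lam)) * ρ)))) (by positivity)
      (fun k' => hf.neg_le_score S k') ?_
    rintro (_ | k')
    · exact min_le_left _ _
    · rcases le_total k k' with h | h
      · refine (min_le_right _ _).trans ((min_le_left _ _).trans ?_)
        have := hlarge k' h
        have hpos : (0 : ℝ) < Q.n * 2 ^ k' := by positivity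
        rw [hscore]
        linarith
      · refine (min_le_right _ _).trans ((min_le_right _ _).trans ?_)
        refine le_trans ?_ (hf.neg_le_score S k')
        have hle : (2 : ℝ) ^ k' ≤ ρ := zpow_le_zpow_right₀ (by norm_num) h
        have : Q.N * (6 * (Q.n / Q.lam)) * 2 ^ k' ≤ Q.N * (6 * (Q.n / Q.lam)) * ρ := by gcongr
        linarith
  have hw := hex.choose_spec (some k)
  set w := hex.choose with hwdef
  have hout : Q.outIdx y = Q.choiceIdx y w := by rw [outIdx, dif_pos hex]
  rw [hout]
  rw [hscore, ← hρdef] at hw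
  have hρn : 0 < ρ * Q.n := by positivity
  have hρN : 0 < ρ * Q.N := by positivity
  have hNc : Q.N * (risk P f (Q.D (Q.candIdx y k)) - risk P f (Q.D m)) ≤ 7004 * ρ * Q.n := by
    have : (Q.N : ℝ) * (risk P f (Q.D (Q.candIdx y k)) - risk P f (Q.D m)) ≤
        Q.N * (21010 * ρ) := by gcongr; linarith
    nlinarith
  -- the chosen candidate on the third block
  have hup : s (Q.choiceIdx y w) + 8299 * Q.slack w ≤ s m + 15700 * ρ * Q.n ∧
      Q.N * (risk P f (Q.D (Q.choiceIdx y w)) - risk P f (Q.D 0)) ≤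
        s (Q.choiceIdx y w) - s 0 + 47000 * ρ * Q.n := by
    rcases w with _ | k'
    · simp only [score, slack, choiceIdx, sub_self, mul_zero] at hw ⊢
      refine ⟨by linarith, ?_⟩
      have : 0 ≤ ρ * Q.n := by positivity
      linarith
    · rw [hscore] at hw
      simp only [slack, choiceIdx] at hw ⊢
      have hup : s (Q.candIdx y k') + 8299 * (Q.n * 2 ^ k') ≤ s m + 15700 * ρ * Q.n := by
        linarith
      refine ⟨hup, ?_⟩
      -- The penalty 8299 exceeds the possible advantage 8201 by 98, so `98 * 2 ^ k' ≤ 15700 ρ`;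
      -- this is impossible once `2 ^ k' ≥ 256 ρ`.
      have hk' : k' ≤ k + 8 := by
        by_contra hlt
        push Not at hlt
        have hl' := hlarge k' (by omega)
        have hge : ρ * 256 ≤ 2 ^ k' := by
          calc ρ * 256 = 2 ^ (k + 8) := by rw [zpow_add₀ (by norm_num), hρdef]; norm_num
            _ ≤ 2 ^ k' := zpow_le_zpow_right₀ (by norm_num) hlt.le
        have := mul_le_mul_of_nonneg_right hge hn.le
        have : 0 < ρ * Q.n := by positivity
        linarith
      obtain ⟨j, hj⟩ : ∃ j : ℕ, k' = k + 8 - j := ⟨(k + 8 - k').toNat, by omega⟩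
      have hdev := hsmall j
      rw [← hj] at hdev
      have hpow : (2 : ℝ) ^ k' * 2 ^ j = ρ * 256 := by
        rw [← zpow_natCast (2 : ℝ) j, ← zpow_add₀ (by norm_num), hj,
          show k + 8 - (j : ℤ) + j = k + 8 by ring, zpow_add₀ (by norm_num), hρdef]
        norm_num
      have hj2 : (30 + j : ℝ) ≤ 30 * 2 ^ j := by
        have h1 : ((j + 1 : ℕ) : ℝ) ≤ ((2 ^ j : ℕ) : ℝ) := Nat.cast_le.2 Nat.lt_two_pow_self
        push_cast at h1
        have h0 : (0 : ℝ) ≤ j := Nat.cast_nonneg j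
        linarith
      -- The confidence cost grows linearly in `j`, while the scale decays like `2 ^ (-j)`, so the
      -- bound is uniform over all smaller scales.
      have hbd : 6 * (2 : ℝ) ^ k' * Q.n * (30 + j) ≤ 47000 * ρ * Q.n := by
        calc 6 * (2 : ℝ) ^ k' * Q.n * (30 + j) ≤ 6 * (2 : ℝ) ^ k' * Q.n * (30 * 2 ^ j) := by
              gcongr
          _ = 180 * ((2 : ℝ) ^ k' * 2 ^ j) * Q.n := by ring
          _ = 46080 * (ρ * Q.n) := by rw [hpow]; ring
          _ ≤ 47000 * (ρ * Q.n) := by gcongr; norm_num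
          _ = _ := by ring
      linarith
  have hsl : 0 ≤ Q.slack w := by
    rcases w with _ | k'
    · exact le_rfl
    · simp only [slack]; positivity
  obtain ⟨hu1, hu2⟩ := hup
  have hfin : Q.N * (risk P f (Q.D (Q.choiceIdx y w)) - risk P f (Q.D m)) ≤
      Q.N * (320000 * ρ) := by
    have : ρ * Q.n ≤ ρ * (5 * Q.N) := by gcongr
    linarith
  have := le_of_mul_le_mul_left hfin hN
  linarith

variable [IsProbabilityMeasure P]

/-- The analysis of the algorithm for one reference point. -/
theorem Regular.measure_risk_outIdx_le (hf : Q.Regular P f) {δ : ℝ} (hδ : 0 < δ)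
    (hδ2 : δ ≤ 1 / 2) (hlam : Real.exp (-Q.lam) = δ) (hlamd : Real.exp (-Q.lamd) = δ / d)
    {m : ℕ} {k : ℤ}
    (hrep : ∀ S : Fin Q.n → 𝒮, ∃ v ∈ unitBlocks d,
      Q.D m = (2 : ℝ) ^ k • (Q.geom (Q.stat (Q.sample f S))).A v)
    (hopt : ∀ x ∈ Q.X, risk P f (Q.D m) ≤ risk P f x + 2 ^ k) :
    (Measure.pi fun _ : Fin Q.n => P)
      {S | risk P f (Q.D m) + 320000 * 2 ^ k < risk P f (Q.D (Q.outIdx (Q.sample f S)))} ≤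
      ENNReal.ofReal δ := by
  have hρ : (0 : ℝ) < 2 ^ k := by positivity
  have hl := Q.lam_pos
  have h3 := Q.three_mul_le
  set μ := Measure.pi fun _ : Fin Q.n => P with hμ
  set p : (Fin Q.n → 𝒮) → GaugeIdx d → ℕ := fun S => Q.stat (Q.sample f S) with hp
  have hsm : ∀ S, Q.Small (p S) (Q.D m) (2 * 2 ^ k) := fun S => by
    obtain ⟨v, hv, e⟩ := hrep S
    rw [e]
    exact small_image _ hv
  have hzsm : ∀ k' S, Q.Small (p S) (Q.D (Q.candIdx (Q.sample f S) k')) (3 * 2 ^ k') :=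
    fun k' S => small_candIdx _ _
  have hzP : ∀ k' t, Pred (2 * Q.N + t) (fun S => Q.candIdx (Q.sample f S) k') :=
    fun k' t => (hf.pred_candIdx k').mono (by omega)
  have hdev : ∀ (lo : ℕ), Q.N ≤ lo → lo + Q.N ≤ Q.n → ∀ r > 0, ∀ u v : ℕ → (Fin Q.n → 𝒮) → ℕ,
      (∀ t < Q.N, Pred (lo + t) (u t)) → (∀ t < Q.N, Pred (lo + t) (v t)) → ∀ j : ℕ,
      ∃ E, μ E ≤ ENNReal.ofReal (δ ^ 5 * δ ^ j) ∧ ∀ S ∉ E, Q.Good P f (p S) →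
        (∀ t < Q.N, Q.Small (p S) (Q.D (u t S) - Q.D (v t S)) r) →
        deviation P f S lo (fun t => u t S) (fun t => v t S) < 2 * r * Q.n * (30 + j) := by
    intro lo h1 h2 r hr u v hu hv j
    -- The parameter `j` gives failure probability `δ ^ (5 + j)`, summable over the smaller scales;
    -- single events use `j = 0`.
    have hB := hf.measure_deviation_le h1 h2 hr hu hv ((5 + j) * Q.lam)
    rw [show -((5 + j) * Q.lam) = (5 + j : ℕ) * (-Q.lam) by push_cast; ring, Real.exp_nat_mul,
      hlam, pow_add] at hB
    refine ⟨_, hB, fun S hS hg hs => ?_⟩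
    by_contra hle
    push Not at hle
    refine hS ⟨hg, hs, ?_⟩
    rw [mul_div_cancel_right₀ _ hl.ne', ← add_assoc, show (25 : ℝ) + 5 = 30 by norm_num]
    exact hle
  have hgau : ∀ (lo : ℕ), Q.N ≤ lo → lo + Q.N ≤ Q.n →
      ∃ E, μ E ≤ ENNReal.ofReal (δ ^ 5) ∧ ∀ S ∉ E, Q.Good P f (p S) →
        ∑ t ∈ Finset.range Q.N, Q.sqGauge (p S) (Q.sample f S (lo + t)) < 216 * Q.n := by
    intro lo h1 h2
    have hB := hf.measure_sum_sqGauge_le h1 h2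
    rw [show -(5 * Q.lam) = (5 : ℕ) * (-Q.lam) by push_cast; ring, Real.exp_nat_mul, hlam] at hB
    refine ⟨_, hB, fun S hS hg => ?_⟩
    by_contra hle
    push Not at hle
    exact hS ⟨hg, hle⟩
  obtain ⟨E1, hE1, hE1'⟩ : ∃ E, μ E ≤ ENNReal.ofReal (3 * δ ^ 5) ∧
      ∀ S ∉ E, Q.Good P f (p S) := by
    refine ⟨⋃ i, {S | 100 * Q.scale (p S) i ^ 2 <
      ∫ s, Q.supGauge i (fun y => f y s) ^ 2 ∂P}, ?_, fun S hS i => ?_⟩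
    · refine (measure_iUnion_le _).trans ?_
      rw [tsum_fintype]
      refine (Finset.sum_le_sum fun i _ => hf.measure_scale_lt_le i).trans ?_
      rw [← ENNReal.ofReal_sum_of_nonneg fun i _ => (Real.exp_pos _).le]
      refine ENNReal.ofReal_le_ofReal ?_
      rw [Fintype.sum_option]
      have hd1 : (1 : ℝ) ≤ d := by exact_mod_cast Q.d_pos
      have e1 : Real.exp (-(5 * Q.logf none)) = δ ^ 5 := by
        rw [show -(5 * Q.logf none) = (5 : ℕ) * (-Q.lam) by simp [logf], Real.exp_nat_mul, hlam]
      have e2 : ∀ i : Option (Fin d), Real.exp (-(5 * Q.logf (some i))) = (δ / d) ^ 5 :=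
        fun i => by
          rw [show -(5 * Q.logf (some i)) = (5 : ℕ) * (-Q.lamd) by simp [logf],
            Real.exp_nat_mul, hlamd]
      rw [e1, Finset.sum_congr rfl fun i _ => e2 i, Finset.sum_const, Finset.card_univ,
        Fintype.card_option, Fintype.card_fin, nsmul_eq_mul, div_pow]
      have h5 : 0 < δ ^ 5 := by positivity
      -- The union over the `d + 1` non-Euclidean gauges is affordable because they were given
      -- confidence `lamd`.
      have : ((d + 1 : ℕ) : ℝ) * (δ ^ 5 / d ^ 5) ≤ 2 * δ ^ 5 := by
        rw [mul_div_assoc', div_le_iff₀ (by positivity)]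
        have h1 : (d : ℝ) ≤ d ^ 5 := le_self_pow₀ hd1 (by norm_num)
        push_cast
        nlinarith
      linarith
    · by_contra hlt
      push Not at hlt
      exact hS (Set.mem_iUnion.2 ⟨i, hlt⟩)
  obtain ⟨E2, hE2, hE2'⟩ := hgau Q.N le_rfl (by omega)
  obtain ⟨E3, hE3, hE3'⟩ := hgau (2 * Q.N) (by omega) (by omega)
  obtain ⟨E4, hE4, hE4'⟩ := hdev Q.N le_rfl (by omega) (5 * 2 ^ k) (by positivity) (fun _ _ => m)
    (fun t S => Q.runIdx (p S) 0 (2 ^ k) (Q.runState (p S) 0 (2 ^ k) Q.N (Q.sample f S) t))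
    (fun _ _ => Pred.const _ _)
    (fun t ht => (hf.pred_runIdx 0 (2 ^ k) le_rfl t (by omega)).map Prod.snd) 0
  obtain ⟨E5, hE5, hE5'⟩ := hdev (2 * Q.N) (by omega) (by omega) (3 * 2 ^ k) (by positivity)
    (fun _ _ => m) (fun t S => Q.runIdx (p S) (Q.D m) (2 ^ k)
      (Q.runState (p S) (Q.D m) (2 ^ k) (2 * Q.N) (Q.sample f S) t))
    (fun _ _ => Pred.const _ _)
    (fun t ht => (hf.pred_runIdx (Q.D m) (2 ^ k) (by omega) t (by omega)).map Prod.snd) 0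
  obtain ⟨E6, hE6, hE6'⟩ := hdev (2 * Q.N) (by omega) (by omega) (5 * 2 ^ k) (by positivity)
    (fun _ S => Q.candIdx (Q.sample f S) k) (fun _ _ => m) (fun t _ => hzP k t)
    (fun _ _ => Pred.const _ _) 0
  obtain ⟨E7, hE7, hE7'⟩ := hdev (2 * Q.N) (by omega) (by omega) (2 * 2 ^ k) (by positivity)
    (fun _ _ => m) (fun _ _ => 0) (fun _ _ => Pred.const _ _) (fun _ _ => Pred.const _ _) 0
  choose E8 hE8 hE8' using fun j : ℕ => hdev (2 * Q.N) (by omega) (by omega)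
    (3 * 2 ^ (k + 8 - j : ℤ)) (by positivity) (fun _ _ => 0)
    (fun _ S => Q.candIdx (Q.sample f S) (k + 8 - j)) (fun _ _ => Pred.const _ _)
    (fun t _ => hzP _ t) j
  have hsub : {S | risk P f (Q.D m) + 320000 * 2 ^ k < risk P f (Q.D (Q.outIdx (Q.sample f S)))} ⊆
      E1 ∪ E2 ∪ E3 ∪ E4 ∪ E5 ∪ E6 ∪ E7 ∪ ⋃ j, E8 j := by
    intro S hS
    by_contra hnot
    simp only [Set.mem_union, Set.mem_iUnion, not_or, not_exists] at hnot
    obtain ⟨⟨⟨⟨⟨⟨⟨n1, n2⟩, n3⟩, n4⟩, n5⟩, n6⟩, n7⟩, n8⟩ := hnot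
    have hg := hE1' S n1
    obtain ⟨v, hv, hm⟩ := hrep S
    have hzm := hzsm k S
    have hG3 := hE3' S n3 hg
    have d4 := hE4' S n4 hg fun t _ => by
      have h1 := small_runIdx (Q := Q) (p S) Q.zero_mem hρ
        (Q.runState (p S) 0 (2 ^ k) Q.N (Q.sample f S) t)
      rw [sub_zero] at h1
      have h2 := (hsm S).add (by positivity) (by positivity) h1.neg
      rw [← sub_eq_add_neg, ← add_mul, show (2 : ℝ) + 3 = 5 by norm_num] at h2
      exact h2
    have d5 := hE5' S n5 hg fun t _ => by
      have h1 := small_runIdx (Q := Q) (p S) (Q.D_mem m) hρ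
        (Q.runState (p S) (Q.D m) (2 ^ k) (2 * Q.N) (Q.sample f S) t)
      have h2 := h1.neg
      rw [neg_sub] at h2
      exact h2
    have d6 := hE6' S n6 hg fun t _ => by
      have h2 := hzm.add (by positivity) (by positivity) (hsm S).neg
      rw [← sub_eq_add_neg, ← add_mul, show (3 : ℝ) + 2 = 5 by norm_num] at h2
      exact h2
    have d7 := hE7' S n7 hg fun t _ => by rw [Q.D_zero, sub_zero]; exact hsm S
    have d8 := fun j => hE8' j S (n8 j) hg fun t _ => by
      rw [Q.D_zero, zero_sub]; exact (hzsm _ S).neg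
    rw [Nat.cast_zero, add_zero] at d4 d5 d6 d7
    have hc := hf.risk_candIdx_le S k rfl hv hm (hE2' S n2 hg) (by linarith)
    have hlow := fun w hw => hf.sum_sub_le_of_feasible S (p := p S) hρ hopt hG3
      (by linarith) (v := w) hw
    have hfin := hf.risk_outIdx_le S hc
      (fun k' hk' => hf.sum_sub_candIdx_le S hk' rfl hv hm hlow) (by linarith) (by linarith)
      (fun j => by
        have := d8 j
        linarith)
    exact absurd hS (not_lt.2 hfin)
  have hE8s : μ (⋃ j, E8 j) ≤ ENNReal.ofReal (2 * δ ^ 5) := by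
    refine (measure_iUnion_le _).trans ((ENNReal.tsum_le_tsum hE8).trans ?_)
    have hsum : Summable fun j : ℕ => δ ^ 5 * δ ^ j :=
      (summable_geometric_of_lt_one hδ.le (by linarith)).mul_left _
    rw [← ENNReal.ofReal_tsum_of_nonneg (fun j => by positivity) hsum, tsum_mul_left,
      tsum_geometric_of_lt_one hδ.le (by linarith), mul_comm]
    refine ENNReal.ofReal_le_ofReal (mul_le_mul_of_nonneg_right ?_ (by positivity))
    rw [inv_le_comm₀ (by linarith) (by norm_num)]
    linarith
  rw [pow_zero, mul_one] at hE4 hE5 hE6 hE7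
  refine (measure_mono hsub).trans ?_
  have u1 := (measure_union_le E1 E2).trans (add_le_add hE1 hE2)
  have u2 := (measure_union_le (E1 ∪ E2) E3).trans (add_le_add u1 hE3)
  have u3 := (measure_union_le _ E4).trans (add_le_add u2 hE4)
  have u4 := (measure_union_le _ E5).trans (add_le_add u3 hE5)
  have u5 := (measure_union_le _ E6).trans (add_le_add u4 hE6)
  have u6 := (measure_union_le _ E7).trans (add_le_add u5 hE7)
  have u7 := (measure_union_le _ (⋃ j, E8 j)).trans (add_le_add u6 hE8s)
  refine u7.trans ?_
  have h5 : 0 ≤ δ ^ 5 := by positivity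
  rw [← ENNReal.ofReal_add (by positivity) h5, ← ENNReal.ofReal_add (by positivity) h5,
    ← ENNReal.ofReal_add (by positivity) h5, ← ENNReal.ofReal_add (by positivity) h5,
    ← ENNReal.ofReal_add (by positivity) h5, ← ENNReal.ofReal_add (by positivity) h5,
    ← ENNReal.ofReal_add (by positivity) (by positivity)]
  refine ENNReal.ofReal_le_ofReal ?_
  -- The events add up to `11 δ ^ 5`, and `11 / 16 < 1`.
  have h4 : δ ^ 4 ≤ (1 / 2) ^ 4 := pow_le_pow_left₀ hδ.le hδ2 4
  have : δ ^ 5 = δ ^ 4 * δ := by ring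
  nlinarith

end Setup

end StochOpt
end

/-! ### Comparison of the scales with the unknown constants. -/

noncomputable section

namespace StochOpt

namespace Setup

variable {d : ℕ} {Q : Setup d}

/-- Each ceiling adds at most one unit of `res ^ 2`, and the offset in `scale` adds another. -/
lemma scale_sq_le {y : ℕ → Vec d → ℝ} {i : GaugeIdx d} {c : ℝ}
    (h : ∀ t, Q.supGauge i (y t) ≤ c) :
    Q.scale (Q.stat y) i ^ 2 ≤ c ^ 2 + 2 * Q.res i ^ 2 := by
  have hr : 0 < Q.res i ^ 2 := pow_pos (Q.res_pos i) 2
  have hN := Q.N_pos'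
  have h1 : (Q.stat y i : ℝ) ≤ Q.N * (c ^ 2 / Q.res i ^ 2 + 1) := by
    rw [stat, Nat.cast_sum, ← nsmul_eq_mul, ← Finset.card_range Q.N, Finset.card_range]
    refine (Finset.sum_le_card_nsmul _ _ (c ^ 2 / Q.res i ^ 2 + 1) fun t _ => ?_).trans
      (by rw [Finset.card_range])
    refine (Nat.ceil_lt_add_one (by positivity)).le.trans ?_
    gcongr
    · exact supGauge_nonneg _ _
    · exact h t
  rw [scale_sq]
  have h2 : (Q.stat y i : ℝ) / Q.N ≤ c ^ 2 / Q.res i ^ 2 + 1 := by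
    rw [div_le_iff₀ hN]; linarith
  calc Q.res i ^ 2 * ((Q.stat y i : ℝ) / Q.N + 1)
      ≤ Q.res i ^ 2 * ((c ^ 2 / Q.res i ^ 2 + 1) + 1) := by gcongr
    _ = c ^ 2 + 2 * Q.res i ^ 2 := by
        rw [add_assoc, mul_add, mul_div_cancel₀ _ hr.ne']; ring

/-- Turns the hypotheses on the known bounds into the statement that the resolution is below the
true constant. -/
lemma mul_sqrt_div_le {a b u v : ℝ} (hu : 0 < u) (hv : 0 < v) (h : a ≤ b * √(u / v)) :
    a * √(v / u) ≤ b := by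
  have e : √(u / v) * √(v / u) = 1 := by
    rw [← Real.sqrt_mul (by positivity)]
    field_simp
    exact Real.sqrt_one
  calc a * √(v / u) ≤ b * √(u / v) * √(v / u) := by gcongr
    _ = b := by rw [mul_assoc, e, mul_one]

lemma scale_le_two_mul {y : ℕ → Vec d → ℝ} {i : GaugeIdx d} {c : ℝ} (hc : 0 ≤ c)
    (h : ∀ t, Q.supGauge i (y t) ≤ c) (hr : Q.res i ≤ c) : Q.scale (Q.stat y) i ≤ 2 * c := by
  refine le_of_sq_le_sq ?_ (by linarith)
  have h1 := scale_sq_le (Q := Q) h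
  have h2 := pow_le_pow_left₀ (Q.res_pos i).le hr 2
  nlinarith

/-- Used for the coordinates, where the resolution contains the mean of `lhat` and is comparable
with `ℓ` only after summation. -/
lemma scale_le_add {y : ℕ → Vec d → ℝ} {i : GaugeIdx d} {c : ℝ} (hc : 0 ≤ c)
    (h : ∀ t, Q.supGauge i (y t) ≤ c) : Q.scale (Q.stat y) i ≤ c + 2 * Q.res i := by
  have hr := Q.res_pos i
  refine le_of_sq_le_sq ?_ (by linarith)
  have h1 := scale_sq_le (Q := Q) h
  nlinarith [mul_nonneg hc hr.le]

/-- Bounds on the scales in terms of the unknown parameters. -/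
structure ScaleBounds (Q : Setup d) (p : GaugeIdx d → ℕ) (L : ℝ) (ℓ : Fin d → ℝ) : Prop where
  euclidean : Q.scale p none ≤ 2 * L
  sup : Q.scale p (some none) ≤ 2 * normInf ℓ
  coord : ∑ j, Q.scale p (some (some j)) ≤ 5 * norm1 ℓ

lemma scaleBounds {y : ℕ → Vec d → ℝ} {L : ℝ} {ℓ : Fin d → ℝ}
    (hL0 : 0 ≤ L) (hℓ0 : ∀ j, 0 ≤ ℓ j)
    (hL : ∀ t, ∀ x ∈ Q.X, ‖gradient (y t) x‖ ≤ L)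
    (hℓ : ∀ t, ∀ x ∈ Q.X, ∀ j, |gradient (y t) x j| ≤ ℓ j)
    (hLhat : Q.Lhat ≤ L * √(Q.n / Q.lam)) (hlhat : ∀ j, Q.lhat j ≤ ℓ j * √(Q.n / Q.lamd)) :
    ScaleBounds Q (Q.stat y) L ℓ := by
  have hn := Q.n_pos'
  have hl := Q.lam_pos
  have hld : 0 < Q.lamd := hl.trans_le Q.lam_le
  have hd : (0 : ℝ) < d := by exact_mod_cast Q.d_pos
  have hle : ∀ j, ℓ j ≤ normInf ℓ := fun j => (le_abs_self _).trans (norm_le_pi_norm ℓ j)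
  refine ⟨?_, ?_, ?_⟩
  · exact scale_le_two_mul hL0 (fun t => supGauge_le fun x hx => hL t x hx)
      (mul_sqrt_div_le hn hl hLhat)
  · refine scale_le_two_mul (norm_nonneg _)
      (fun t => supGauge_le fun x hx => supAbs_le (norm_nonneg _) fun j =>
        (hℓ t x hx j).trans (hle j)) (mul_sqrt_div_le hn hld ?_)
    refine (pi_norm_le_iff_of_nonneg (mul_nonneg (norm_nonneg _) (Real.sqrt_nonneg _))).2
      fun j => ?_
    rw [Real.norm_eq_abs, abs_of_nonneg (Q.lhat_nonneg j)]
    exact (hlhat j).trans (mul_le_mul_of_nonneg_right (hle j) (Real.sqrt_nonneg _))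
  · have h1 : ∀ j, Q.scale (Q.stat y) (some (some j)) ≤ ℓ j + 2 * Q.res (some (some j)) :=
      fun j => scale_le_add (hℓ0 j) fun t => supGauge_le fun x hx => hℓ t x hx j
    have h2 : ∑ j, Q.lhat j * √(Q.lamd / Q.n) ≤ ∑ j, ℓ j :=
      Finset.sum_le_sum fun j _ => mul_sqrt_div_le hn hld (hlhat j)
    have h3 : ∑ j, Q.res (some (some j)) = 2 * ∑ j, Q.lhat j * √(Q.lamd / Q.n) := by
      simp only [res, hat, logf]
      rw [← Finset.sum_mul, ← Finset.sum_mul, Finset.sum_add_distrib, Finset.sum_const,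
        Finset.card_univ, Fintype.card_fin, nsmul_eq_mul]
      field_simp
      ring
    have h4 : norm1 ℓ = ∑ j, ℓ j := Finset.sum_congr rfl fun j _ => abs_of_nonneg (hℓ0 j)
    calc _ ≤ ∑ j, (ℓ j + 2 * Q.res (some (some j))) := Finset.sum_le_sum fun j _ => h1 j
      _ = ∑ j, ℓ j + 2 * ∑ j, Q.res (some (some j)) := by
          rw [Finset.sum_add_distrib, ← Finset.mul_sum]
      _ ≤ 5 * norm1 ℓ := by rw [h3, h4]; linarith

lemma geom_A_apply (p : GaugeIdx d → ℕ) (v : Blocks d) (j : Fin d) :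
    (Q.geom p).A v j = √(Q.n / Q.lam) / Q.scale p none * v.1 j +
      √(Q.n / Q.lamd) / Q.scale p (some none) * v.2.1 j +
      √(Q.n / Q.lam) / (√(Q.scale p (some (some j))) *
        √(∑ i, Q.scale p (some (some i)))) * v.2.2 j := rfl

/-- Only the block whose rate attains the minimum is used, the others being zero; the 5 is the
largest of the three constants in `ScaleBounds`. -/
lemma ScaleBounds.exists_rep {p : GaugeIdx d → ℕ} {L : ℝ} {ℓ : Fin d → ℝ}
    (h : ScaleBounds Q p L ℓ) {δ : ℝ} (hlam : Real.log (1 / δ) = Q.lam)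
    (hlamd : Real.log (d / δ) = Q.lamd) {y : Vec d} {ρ : ℝ} (hρ : 0 < ρ)
    (hy : 5 * rate Q.n δ L ℓ y ≤ ρ) : ∃ v ∈ unitBlocks d, y = ρ • (Q.geom p).A v := by
  have hn := Q.n_pos'
  have hl := Q.lam_pos
  have hld : 0 < Q.lamd := hl.trans_le Q.lam_le
  have ha := Q.scale_pos p none
  have hb := Q.scale_pos p (some none)
  have hw := fun j => Q.scale_pos p (some (some j))
  have hW := scale_sum_pos (Q := Q) p
  have hL0 : 0 ≤ L := by linarith [h.euclidean]
  have hs : 0 < √(Q.n : ℝ) := Real.sqrt_pos.2 hn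
  have hsl : 0 < √Q.lam := Real.sqrt_pos.2 hl
  have hsld : 0 < √Q.lamd := Real.sqrt_pos.2 hld
  rw [rate, hlam, hlamd] at hy
  set a := Q.scale p none
  set b := Q.scale p (some none)
  set W := ∑ i, Q.scale p (some (some i))
  have hsW : 0 < √W := Real.sqrt_pos.2 hW
  rcases min_choice (L * ‖y‖ * √Q.lam / √(Q.n : ℝ))
    (min (normInf ℓ * norm1 y * √Q.lamd / √(Q.n : ℝ))
      (norm1 ℓ * normInf y * √Q.lam / √(Q.n : ℝ))) with e | e
  · rw [e] at hy
    refine ⟨(fun j => a * (√Q.lam / √(Q.n : ℝ)) / ρ * y j, 0, 0), ⟨?_, by simp, by simp⟩, ?_⟩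
    · simp only [mul_pow]
      rw [← Finset.mul_sum, ← norm_sq_eq_sum, ← mul_pow]
      refine pow_le_one₀ (by positivity) ?_
      rw [div_mul_eq_mul_div, div_le_one hρ]
      calc a * (√Q.lam / √(Q.n : ℝ)) * ‖y‖ ≤ 2 * L * (√Q.lam / √(Q.n : ℝ)) * ‖y‖ := by
            gcongr; exact h.euclidean
        _ = 2 * (L * ‖y‖ * √Q.lam / √(Q.n : ℝ)) := by ring
        _ ≤ 5 * (L * ‖y‖ * √Q.lam / √(Q.n : ℝ)) := by gcongr; norm_num
        _ ≤ ρ := hy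
    · ext j
      rw [PiLp.smul_apply, geom_A_apply, Real.sqrt_div hn.le]
      simp only [Pi.zero_apply, mul_zero, add_zero, smul_eq_mul]
      change y j = ρ * (√(Q.n : ℝ) / √Q.lam / a * _)
      field_simp
  rcases min_choice (normInf ℓ * norm1 y * √Q.lamd / √(Q.n : ℝ))
      (norm1 ℓ * normInf y * √Q.lam / √(Q.n : ℝ)) with e' | e'
  · rw [e, e'] at hy
    refine ⟨(0, fun j => b * (√Q.lamd / √(Q.n : ℝ)) / ρ * y j, 0), ⟨by simp, ?_, by simp⟩, ?_⟩
    · simp only [abs_mul]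
      rw [← Finset.mul_sum, abs_of_pos (by positivity), div_mul_eq_mul_div, div_le_one hρ]
      have h0 : 0 ≤ norm1 y := Finset.sum_nonneg fun j _ => abs_nonneg _
      have h1 : 0 ≤ normInf ℓ := norm_nonneg _
      change b * (√Q.lamd / √(Q.n : ℝ)) * norm1 y ≤ ρ
      calc b * (√Q.lamd / √(Q.n : ℝ)) * norm1 y
          ≤ 2 * normInf ℓ * (√Q.lamd / √(Q.n : ℝ)) * norm1 y := by
            gcongr; exact h.sup
        _ = 2 * (normInf ℓ * norm1 y * √Q.lamd / √(Q.n : ℝ)) := by ring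
        _ ≤ 5 * (normInf ℓ * norm1 y * √Q.lamd / √(Q.n : ℝ)) := by gcongr; norm_num
        _ ≤ ρ := hy
    · ext j
      rw [PiLp.smul_apply, geom_A_apply, Real.sqrt_div hn.le]
      simp only [Pi.zero_apply, mul_zero, add_zero, zero_add, smul_eq_mul]
      rw [Real.sqrt_div hn.le]
      change y j = ρ * (√(Q.n : ℝ) / √Q.lamd / b * _)
      field_simp
  · rw [e, e'] at hy
    have h0 : 0 ≤ normInf y := norm_nonneg _
    have h1 : 0 ≤ norm1 ℓ := Finset.sum_nonneg fun j _ => abs_nonneg _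
    refine ⟨(0, 0, fun j => √(Q.scale p (some (some j))) * √W * (√Q.lam / √(Q.n : ℝ)) / ρ * y j),
      ⟨by simp, by simp, ?_⟩, ?_⟩
    · have key : W * (√Q.lam / √(Q.n : ℝ)) * normInf y ≤ ρ := by
        calc W * (√Q.lam / √(Q.n : ℝ)) * normInf y
            ≤ 5 * norm1 ℓ * (√Q.lam / √(Q.n : ℝ)) * normInf y := by
              gcongr; exact h.coord
          _ = 5 * (norm1 ℓ * normInf y * √Q.lam / √(Q.n : ℝ)) := by ring
          _ ≤ ρ := hy
      calc ∑ j, (√(Q.scale p (some (some j))) * √W * (√Q.lam / √(Q.n : ℝ)) / ρ * y j) ^ 2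
          ≤ ∑ j, Q.scale p (some (some j)) *
              (W * ((√Q.lam / √(Q.n : ℝ)) / ρ * normInf y) ^ 2) := by
            refine Finset.sum_le_sum fun j _ => ?_
            have hyj : y j ^ 2 ≤ normInf y ^ 2 := by
              rw [← sq_abs]
              exact pow_le_pow_left₀ (abs_nonneg _) (norm_le_pi_norm (fun j => y j) j) 2
            calc (√(Q.scale p (some (some j))) * √W * (√Q.lam / √(Q.n : ℝ)) / ρ * y j) ^ 2
                = √(Q.scale p (some (some j))) ^ 2 *
                    (√W ^ 2 * (((√Q.lam / √(Q.n : ℝ)) / ρ) ^ 2 * y j ^ 2)) := by ring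
              _ ≤ Q.scale p (some (some j)) *
                    (W * (((√Q.lam / √(Q.n : ℝ)) / ρ) ^ 2 * normInf y ^ 2)) := by
                  have := (hw j).le
                  rw [Real.sq_sqrt (hw j).le, Real.sq_sqrt hW.le]
                  gcongr
              _ = _ := by ring
        _ = (W * (√Q.lam / √(Q.n : ℝ)) * normInf y / ρ) ^ 2 := by
            rw [← Finset.sum_mul]; ring
        _ ≤ 1 := by
            refine pow_le_one₀ (by positivity) ?_
            rwa [div_le_one hρ]
    · ext j
      have hsw : 0 < √(Q.scale p (some (some j))) := Real.sqrt_pos.2 (hw j)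
      rw [PiLp.smul_apply, geom_A_apply, Real.sqrt_div hn.le]
      simp only [Pi.zero_apply, mul_zero, add_zero, zero_add, smul_eq_mul]
      change y j = ρ * (√(Q.n : ℝ) / √Q.lam / (√(Q.scale p (some (some j))) * √W) * _)
      field_simp

end Setup

end StochOpt
end

/-! ### From near-minimizers in the dense sequence to all minimizers. -/

noncomputable section

namespace StochOpt

variable {d : ℕ}

lemma norm1_nonneg (v : Fin d → ℝ) : 0 ≤ norm1 v := Finset.sum_nonneg fun _ _ => abs_nonneg _

lemma normInf_nonneg (v : Fin d → ℝ) : 0 ≤ normInf v := norm_nonneg v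

lemma continuous_rate (n : ℕ) (δ L : ℝ) (ℓ : Fin d → ℝ) : Continuous (rate n δ L ℓ) := by
  have h1 : Continuous fun x : Vec d => norm1 x := by unfold norm1; fun_prop
  have h2 : Continuous fun x : Vec d => normInf x := by unfold normInf; fun_prop
  unfold rate
  fun_prop

lemma rate_nonneg (n : ℕ) (δ : ℝ) {L : ℝ} (hL : 0 ≤ L) (ℓ : Fin d → ℝ) (x : Vec d) :
    0 ≤ rate n δ L ℓ x := by
  have := norm1_nonneg ℓ
  have := normInf_nonneg ℓ
  have := norm1_nonneg x.ofLp
  have := normInf_nonneg x.ofLp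
  exact le_min (by positivity) (le_min (by positivity) (by positivity))

lemma optValue_eq {𝒮 : Type*} [MeasurableSpace 𝒮] {X : Set (Vec d)} {P : Measure 𝒮}
    {f : Vec d → 𝒮 → ℝ} {x : Vec d} (hx : x ∈ minimizers X P f) :
    optValue X P f = risk P f x :=
  IsLeast.csInf_eq ⟨⟨x, hx.1, rfl⟩, by rintro _ ⟨y, hy, rfl⟩; exact hx.2 y hy⟩

namespace Setup

variable {Q : Setup d} {𝒮 : Type*} [MeasurableSpace 𝒮] {P : Measure 𝒮} [IsProbabilityMeasure P]
  {f : Vec d → 𝒮 → ℝ} {δ L : ℝ} {ℓ : Fin d → ℝ}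

/-- The minimizer need not belong to the sequence `D`. A close enough `Q.D m` keeps the strict bound
on the rate by continuity and loses at most `2 ^ k` in risk by the Lipschitz bound. -/
lemma Regular.measure_minimizer_lt (hf : Q.Regular P f) (hδ : 0 < δ) (hδ2 : δ ≤ 1 / 2)
    (hlam : Real.log (1 / δ) = Q.lam) (hlamd : Real.log (d / δ) = Q.lamd)
    (hb : ∀ S, ScaleBounds Q (Q.stat (Q.sample f S)) L ℓ) {x : Vec d}
    (hx : x ∈ minimizers Q.X P f) {k : ℤ} (hk : 5 * rate Q.n δ L ℓ x < 2 ^ k) :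
    Measure.pi (fun _ : Fin Q.n => P)
      {S | risk P f x + 320001 * 2 ^ k < risk P f (Q.D (Q.outIdx (Q.sample f S)))} ≤
      ENNReal.ofReal δ := by
  have hd : (0 : ℝ) < d := by exact_mod_cast Q.d_pos
  have hρ : (0 : ℝ) < 2 ^ k := by positivity
  have hev : ∀ᶠ y in nhds x, 5 * rate Q.n δ L ℓ y < 2 ^ k :=
    ((continuous_rate Q.n δ L ℓ).const_mul 5).continuousAt.eventually_lt_const hk
  obtain ⟨ε, hε, hball⟩ := Metric.eventually_nhds_iff.1 hev
  obtain ⟨m, hm⟩ := Q.D_dense x hx.1 (min (ε / 2) (2 ^ k / Q.Lhat))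
    (lt_min (by linarith) (div_pos hρ Q.Lhat_pos))
  have hm1 : dist (Q.D m) x < ε := by
    rw [dist_comm, dist_eq_norm]
    have := hm.trans (min_le_left _ _)
    linarith
  have hm2 : risk P f (Q.D m) ≤ risk P f x + 2 ^ k := by
    have h1 := hf.risk_sub_le (Q.D_mem m) hx.1
    have h2 := hm.trans (min_le_right _ _)
    rw [norm_sub_rev, le_div_iff₀ Q.Lhat_pos] at h2
    linarith
  have e1 : Real.exp (-Q.lam) = δ := by
    rw [← hlam, one_div, Real.log_inv, neg_neg, Real.exp_log hδ]
  have e2 : Real.exp (-Q.lamd) = δ / d := by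
    rw [← hlamd, ← Real.log_inv, inv_div, Real.exp_log (by positivity)]
  refine (measure_mono ?_).trans (hf.measure_risk_outIdx_le hδ hδ2 e1 e2 (m := m) (k := k)
    (fun S => (hb S).exists_rep hlam hlamd hρ (hball hm1).le)
    fun y hy => hm2.trans (by linarith [hx.2 y hy]))
  intro S hS
  rw [Set.mem_ofPred_eq] at hS ⊢
  linarith

/-- All minimizers share one risk, so only the infimum `R` of their rates matters. The bad event is
covered by the increasing events with threshold `R + 1 / (i + 1)`, and continuity of the measure
gives the bound without a union over minimizers. -/
lemma Regular.measure_not_le (hf : Q.Regular P f) (hδ : 0 < δ) (hδ2 : δ ≤ 1 / 2)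
    (hlam : Real.log (1 / δ) = Q.lam) (hlamd : Real.log (d / δ) = Q.lamd) (hL0 : 0 ≤ L)
    (hb : ∀ S, ScaleBounds Q (Q.stat (Q.sample f S)) L ℓ) :
    Measure.pi (fun _ : Fin Q.n => P)
      {S | ¬ ∀ x ∈ minimizers Q.X P f, risk P f (Q.D (Q.outIdx (Q.sample f S))) -
        optValue Q.X P f ≤ 3200010 * rate Q.n δ L ℓ x} ≤ ENNReal.ofReal δ := by
  rcases (minimizers Q.X P f).eq_empty_or_nonempty with h0 | ⟨x₀, hx₀⟩
  · simp [h0]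
  set R := sInf (rate Q.n δ L ℓ '' minimizers Q.X P f) with hR
  have hbdd : BddBelow (rate Q.n δ L ℓ '' minimizers Q.X P f) :=
    ⟨0, by rintro _ ⟨y, -, rfl⟩; exact rate_nonneg _ _ hL0 _ _⟩
  have hR0 : 0 ≤ R := le_csInf ⟨_, x₀, hx₀, rfl⟩
    (by rintro _ ⟨y, -, rfl⟩; exact rate_nonneg _ _ hL0 _ _)
  set B : ℕ → Set (Fin Q.n → 𝒮) := fun i => {S | risk P f x₀ + 3200010 * (R + 1 / ((i : ℝ) + 1)) <
    risk P f (Q.D (Q.outIdx (Q.sample f S)))} with hB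
  have hmono : Monotone B := by
    intro i j hij S hS
    rw [hB, Set.mem_ofPred_eq] at hS ⊢
    have : 1 / ((j : ℝ) + 1) ≤ 1 / ((i : ℝ) + 1) := by gcongr
    linarith
  have hsub : {S | ¬ ∀ x ∈ minimizers Q.X P f, risk P f (Q.D (Q.outIdx (Q.sample f S))) -
      optValue Q.X P f ≤ 3200010 * rate Q.n δ L ℓ x} ⊆ ⋃ i, B i := by
    intro S hS
    rw [Set.mem_ofPred_eq] at hS
    push Not at hS
    obtain ⟨x, hx, hlt⟩ := hS
    rw [optValue_eq hx₀] at hlt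
    have hRx : R ≤ rate Q.n δ L ℓ x := csInf_le hbdd ⟨x, hx, rfl⟩
    obtain ⟨i, hi⟩ := exists_nat_one_div_lt
      (show 0 < (risk P f (Q.D (Q.outIdx (Q.sample f S))) - risk P f x₀ - 3200010 * R) / 3200010
        by apply div_pos _ (by norm_num); linarith)
    rw [lt_div_iff₀ (by norm_num)] at hi
    refine Set.mem_iUnion.2 ⟨i, ?_⟩
    rw [hB, Set.mem_ofPred_eq]
    linarith
  refine (measure_mono hsub).trans ?_
  rw [hmono.measure_iUnion]
  refine iSup_le fun i => ?_
  have hi : 0 < 1 / ((i : ℝ) + 1) := by positivity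
  obtain ⟨_, ⟨x, hx, rfl⟩, hlt⟩ := exists_lt_of_csInf_lt
    (⟨_, x₀, hx₀, rfl⟩ : (rate Q.n δ L ℓ '' minimizers Q.X P f).Nonempty)
    (show sInf (rate Q.n δ L ℓ '' minimizers Q.X P f) < R + 1 / ((i : ℝ) + 1) by
      rw [← hR]; linarith)
  -- Dyadic rounding costs a factor 2, whence the final constant `3200010 = 2 * 5 * 320001`.
  obtain ⟨k, hk1, hk2⟩ := exists_mem_Ioc_zpow
    (show 0 < 5 * (R + 1 / ((i : ℝ) + 1)) by positivity) (one_lt_two (α := ℝ))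
  refine (measure_mono ?_).trans (hf.measure_minimizer_lt hδ hδ2 hlam hlamd hb hx (k := k + 1)
    (by linarith))
  intro S hS
  rw [hB, Set.mem_ofPred_eq] at hS
  rw [Set.mem_ofPred_eq]
  rw [zpow_add_one₀ two_ne_zero]
  have := hx.2 x₀ hx₀.1
  linarith

end Setup

/-! ### Reduction of almost sure hypotheses to sure ones, and degenerate parameters. -/

/-- The loss `f`, replaced by `0` outside the event `A`. -/
def restrictLoss {𝒮 : Type*} (A : Set 𝒮) (f : Vec d → 𝒮 → ℝ) (x : Vec d) : 𝒮 → ℝ :=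
  A.indicator (f x)

section restrictLoss

variable {𝒮 : Type*} {A : Set 𝒮} {f : Vec d → 𝒮 → ℝ} {s : 𝒮}

lemma restrictLoss_of_mem (hs : s ∈ A) : (fun x => restrictLoss A f x s) = fun x => f x s :=
  funext fun _ => Set.indicator_of_mem hs _

lemma restrictLoss_of_notMem (hs : s ∉ A) : (fun x => restrictLoss A f x s) = fun _ => 0 :=
  funext fun _ => Set.indicator_of_notMem hs _

lemma risk_restrictLoss [MeasurableSpace 𝒮] {P : Measure 𝒮} (hA : ∀ᵐ s ∂P, s ∈ A) :
    risk P (restrictLoss A f) = risk P f :=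
  funext fun x => integral_congr_ae <| by
    filter_upwards [hA] with s hs
    exact Set.indicator_of_mem hs _

end restrictLoss

lemma gradient_const_zero (x : Vec d) : gradient (fun _ : Vec d => (0 : ℝ)) x = 0 := by
  simp [gradient]

section bounds

variable {𝒮 : Type*} [MeasurableSpace 𝒮] {P : Measure 𝒮} [IsProbabilityMeasure P]
  {X : Set (Vec d)} {f : Vec d → 𝒮 → ℝ} {L Lhat : ℝ} {ℓ ℓhat : Fin d → ℝ}

lemma LipschitzEstimates.nonneg (hl : LipschitzEstimates X P f L Lhat ℓ ℓhat)
    (h0 : (0 : Vec d) ∈ X) : 0 ≤ L ∧ ∀ j, 0 ≤ ℓ j := by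
  obtain ⟨s, hs1, hs2⟩ := (hl.norm_gradient_le.and hl.abs_gradient_le).exists
  exact ⟨(norm_nonneg _).trans (hs1 0 h0), fun j => (abs_nonneg _).trans (hs2 0 h0 j)⟩

/-- Measures the cost of returning the origin, the output in degenerate cases: the gradient
inequality at `0` and three Hölder bounds. -/
lemma LipschitzEstimates.risk_zero_sub_le (hl : LipschitzEstimates X P f L Lhat ℓ ℓhat)
    (hc : IsStochConvex X P f) (h0 : (0 : Vec d) ∈ X) {x : Vec d} (hx : x ∈ X) :
    risk P f 0 - risk P f x ≤
      min (L * ‖x‖) (min (normInf ℓ * norm1 x) (norm1 ℓ * normInf x)) := by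
  have hxj : ∀ j, |x j| ≤ normInf x := fun j => norm_le_pi_norm (fun j => x j) j
  have hℓj : ∀ j, ℓ j ≤ normInf ℓ := fun j => (le_abs_self _).trans (norm_le_pi_norm ℓ j)
  have hnn := (hl.nonneg h0).2
  have key : ∀ᵐ s ∂P, f 0 s - f x s ≤
      min (L * ‖x‖) (min (normInf ℓ * norm1 x) (norm1 ℓ * normInf x)) := by
    filter_upwards [hc.convex, hl.differentiable, hl.norm_gradient_le, hl.abs_gradient_le]
      with s h1 h2 h3 h4
    have h5 := convexOn_gradient_le h1 h0 hx (h2 0 h0)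
    have h6 : inner ℝ (gradient (fun y => f y s) 0) (0 - x) ≤ ∑ j, ℓ j * |x j| := by
      rw [inner_eq_sum]
      refine Finset.sum_le_sum fun j _ => (le_abs_self _).trans ?_
      rw [abs_mul, zero_sub, PiLp.neg_apply, abs_neg]
      exact mul_le_mul_of_nonneg_right (h4 0 h0 j) (abs_nonneg _)
    refine h5.trans (le_min ?_ (le_min (h6.trans ?_) (h6.trans ?_)))
    · refine (real_inner_le_norm _ _).trans ?_
      rw [zero_sub, norm_neg]
      exact mul_le_mul_of_nonneg_right (h3 0 h0) (norm_nonneg _)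
    · rw [norm1, Finset.mul_sum]
      exact Finset.sum_le_sum fun j _ => mul_le_mul_of_nonneg_right (hℓj j) (abs_nonneg _)
    · rw [norm1, Finset.sum_mul]
      exact Finset.sum_le_sum fun j _ =>
        mul_le_mul (le_abs_self _) (hxj j) (abs_nonneg _) (abs_nonneg _)
  unfold risk
  rw [← integral_sub (hc.integrable 0 h0) (hc.integrable x hx)]
  refine (integral_mono_ae ((hc.integrable 0 h0).sub (hc.integrable x hx))
    (integrable_const _) key).trans ?_
  simp

lemma min_le_two_mul_rate {n : ℕ} (hn : 0 < n) (hn3 : n < 3) (hd : 0 < d) {δ : ℝ} (hδ : 0 < δ)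
    (hδ2 : δ ≤ 1 / 2) (hL : 0 ≤ L) (x : Vec d) :
    min (L * ‖x‖) (min (normInf ℓ * norm1 x) (norm1 ℓ * normInf x)) ≤
      2 * rate n δ L ℓ x := by
  have hn' : (0 : ℝ) < n := by exact_mod_cast hn
  have hn2 : (n : ℝ) ≤ 2 := by exact_mod_cast Nat.le_of_lt_succ hn3
  have hd' : (1 : ℝ) ≤ d := by exact_mod_cast hd
  have hl : 1 / 2 ≤ Real.log (1 / δ) := by
    have h1 : (2 : ℝ) ≤ 1 / δ := by rw [le_div_iff₀ hδ]; linarith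
    have := Real.log_le_log (by norm_num) h1
    linarith [Real.log_two_gt_d9]
  have hld : 1 / 2 ≤ Real.log (d / δ) :=
    hl.trans (Real.log_le_log (by positivity) (by gcongr))
  have key : ∀ c t : ℝ, 0 ≤ c → 1 / 2 ≤ t → c ≤ 2 * (c * √t / √(n : ℝ)) := by
    intro c t hc ht
    have h1 : √(n : ℝ) ≤ 2 * √t := by
      rw [show (2 : ℝ) * √t = √(4 * t) by
        rw [Real.sqrt_mul (by norm_num), show (4 : ℝ) = 2 ^ 2 by norm_num,
          Real.sqrt_sq (by norm_num)]]
      exact Real.sqrt_le_sqrt (by linarith)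
    have hs : 0 < √(n : ℝ) := Real.sqrt_pos.2 hn'
    rw [← mul_div_assoc, le_div_iff₀ hs]
    nlinarith
  have a1 := norm1_nonneg ℓ
  have a2 := normInf_nonneg ℓ
  have a3 := norm1_nonneg x.ofLp
  have a4 := normInf_nonneg x.ofLp
  rw [rate, mul_min_of_nonneg _ _ (by norm_num), mul_min_of_nonneg _ _ (by norm_num)]
  exact min_le_min (key _ _ (by positivity) hl)
    (min_le_min (key _ _ (by positivity) hld) (key _ _ (by positivity) hl))

lemma exists_dense_seq {X : Set (Vec d)} (h0 : (0 : Vec d) ∈ X) :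
    ∃ D : ℕ → Vec d, (∀ i, D i ∈ X) ∧ (∀ x ∈ X, ∀ ε > 0, ∃ i, ‖x - D i‖ ≤ ε) ∧ D 0 = 0 := by
  have : Nonempty X := ⟨⟨0, h0⟩⟩
  refine ⟨fun i => Nat.casesOn i 0 fun i => (TopologicalSpace.denseSeq X i : Vec d), ?_, ?_, rfl⟩
  · rintro (_ | i)
    · exact h0
    · exact (TopologicalSpace.denseSeq X i).2
  · intro x hx ε hε
    obtain ⟨i, hi⟩ := (TopologicalSpace.denseRange_denseSeq X).exists_dist_lt ⟨x, hx⟩ hε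
    refine ⟨i + 1, ?_⟩
    rw [Subtype.dist_eq, dist_eq_norm] at hi
    exact hi.le

lemma exists_setup (hd : 0 < d) {n : ℕ} (hn : 3 ≤ n) {X : Set (Vec d)} (hXc : IsClosed X)
    (hX : Convex ℝ X) (h0 : (0 : Vec d) ∈ X) {δ : ℝ} (hδ : 0 < δ) (hδ2 : δ ≤ 1 / 2) {Lhat : ℝ}
    {ℓhat : Fin d → ℝ} (hL : 0 < Lhat) (hℓ : ∀ j, 0 ≤ ℓhat j) (hsum : 0 < ∑ j, ℓhat j)
    (hlog : Real.log (d / δ) ≤ n) :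
    ∃ Q : Setup d, Q.n = n ∧ Q.X = X ∧ Q.Lhat = Lhat ∧ Q.lhat = ℓhat ∧
      Q.lam = Real.log (1 / δ) ∧ Q.lamd = Real.log (d / δ) := by
  obtain ⟨D, hD1, hD2, hD3⟩ := exists_dense_seq h0
  have hd' : (1 : ℝ) ≤ d := by exact_mod_cast hd
  have h2 : (2 : ℝ) ≤ 1 / δ := by rw [le_div_iff₀ hδ]; linarith
  exact ⟨{
    n := n, N := n / 3, X := X, D := D, lam := Real.log (1 / δ), lamd := Real.log (d / δ)
    Lhat := Lhat, lhat := ℓhat, d_pos := hd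
    N_pos := by omega
    three_mul_le := by omega
    le_five_mul := by omega
    closed := hXc, convex := hX, D_mem := hD1, D_dense := hD2, D_zero := hD3
    half_le := by
      have := Real.log_le_log (by norm_num) h2
      linarith [Real.log_two_gt_d9]
    lam_le := Real.log_le_log (by positivity) (by gcongr)
    log_le := by
      refine Real.log_le_log (by positivity) ?_
      rw [div_eq_mul_one_div]
      nlinarith
    lamd_le := hlog
    Lhat_pos := hL, lhat_nonneg := hℓ, lhat_sum_pos := hsum }, rfl, rfl, rfl, rfl, rfl, rfl⟩

/-- In the nondegenerate case, the output of the algorithm has the stated risk. -/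
lemma Setup.measure_not_le (Q : Setup d) {δ : ℝ} (hδ : 0 < δ) (hδ2 : δ ≤ 1 / 2)
    (hlam : Real.log (1 / δ) = Q.lam) (hlamd : Real.log (d / δ) = Q.lamd)
    (hc : IsStochConvex Q.X P f) (hl : LipschitzEstimates Q.X P f L Q.Lhat ℓ Q.lhat)
    (hL : Q.Lhat ≤ L * √(Q.n / Q.lam)) (hℓ : ∀ j, Q.lhat j ≤ ℓ j * √(Q.n / Q.lamd)) :
    Measure.pi (fun _ : Fin Q.n => P)
      {S | ¬ ∀ x ∈ minimizers Q.X P f, risk P f (Q.D (Q.outIdx (Q.sample f S))) -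
        optValue Q.X P f ≤ 3200010 * rate Q.n δ L ℓ x} ≤ ENNReal.ofReal δ := by
  obtain ⟨hL0, hℓ0⟩ := hl.nonneg Q.zero_mem
  have hae := hc.convex.and (hl.differentiable.and (hl.norm_gradient_le.and hl.abs_gradient_le))
  -- The exceptional set need not be measurable; enlarging it to a measurable null set keeps the
  -- restricted losses measurable.
  obtain ⟨T, hTsub, hTm, hT⟩ := exists_measurable_superset_of_null (ae_iff.1 hae)
  set A := Tᶜ with hA_def
  have hA : ∀ᵐ s ∂P, s ∈ A := measure_eq_zero_iff_ae_notMem.1 hT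
  have hp := fun s (hs : s ∈ A) => not_not.1 fun h => hs (hTsub h)
  have hL' : ∀ s, ∀ x ∈ Q.X, ‖gradient (fun y => restrictLoss A f y s) x‖ ≤ L := by
    intro s x hx
    by_cases hs : s ∈ A
    · rw [restrictLoss_of_mem hs]; exact (hp s hs).2.2.1 x hx
    · rw [restrictLoss_of_notMem hs, gradient_const_zero, norm_zero]; exact hL0
  have hℓ' : ∀ s, ∀ x ∈ Q.X, ∀ j, |gradient (fun y => restrictLoss A f y s) x j| ≤ ℓ j := by
    intro s x hx j
    by_cases hs : s ∈ A
    · rw [restrictLoss_of_mem hs]; exact (hp s hs).2.2.2 x hx j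
    · rw [restrictLoss_of_notMem hs, gradient_const_zero, PiLp.zero_apply, abs_zero]
      exact hℓ0 j
  have hreg : Q.Regular P (restrictLoss A f) := by
    refine ⟨fun x => (hc.measurable x).indicator hTm.compl,
      fun x hx => (hc.integrable x hx).indicator hTm.compl, fun s => ?_, fun s x hx => ?_,
      fun s x hx i => ?_⟩
    · by_cases hs : s ∈ A
      · rw [restrictLoss_of_mem hs]; exact (hp s hs).1
      · rw [restrictLoss_of_notMem hs]; exact convexOn_const 0 Q.convex
    · by_cases hs : s ∈ A
      · rw [restrictLoss_of_mem hs]; exact (hp s hs).2.1 x hx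
      · rw [restrictLoss_of_notMem hs]; exact differentiableAt_const 0
    · have hj := fun j => (hℓ' s x hx j).trans (hl.le_ℓhat j)
      rcases i with _ | _ | j
      · exact (hL' s x hx).trans hl.le_Lhat
      · exact supAbs_le (norm_nonneg _) fun j =>
          (hj j).trans ((le_abs_self _).trans (norm_le_pi_norm Q.lhat j))
      · exact (hj j).trans (le_add_of_nonneg_right
          (div_nonneg Q.lhat_sum_pos.le (Nat.cast_nonneg d)))
  have hmain := hreg.measure_not_le hδ hδ2 hlam hlamd hL0 fun S =>
    Setup.scaleBounds hL0 hℓ0 (fun t => hL' _) (fun t => hℓ' _) hL hℓ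
  refine le_trans (measure_mono_ae ?_) hmain
  have hall : ∀ᵐ S ∂Measure.pi (fun _ : Fin Q.n => P), ∀ i, S i ∈ A :=
    ae_all_iff.2 fun i =>
      (measurePreserving_eval (fun _ : Fin Q.n => P) i).quasiMeasurePreserving.ae hA
  filter_upwards [hall] with S hS hbad
  have hr := risk_restrictLoss (f := f) hA
  have hsam : Q.sample (restrictLoss A f) S = Q.sample f S :=
    funext fun t => restrictLoss_of_mem (hS _)
  change ¬ ∀ x ∈ minimizers Q.X P (restrictLoss A f), _
  rw [hsam]
  unfold minimizers optValue
  rw [hr]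
  exact hbad

end bounds

end StochOpt
end

/-! ### The main theorem, with the degenerate cases. -/

theorem mainTheorem1 :
    ∃ C : ℝ, 0 < C ∧
      ∀ (d n : ℕ), 0 < d → 0 < n →
      ∀ X : Set (StochOpt.Vec d), IsClosed X → Convex ℝ X → (0 : StochOpt.Vec d) ∈ X →
      ∀ δ : ℝ, 0 < δ → δ ≤ 1 / 2 →
      ∀ (Lhat : ℝ) (ℓhat : Fin d → ℝ),
      ∃ alg : (Fin n → StochOpt.Vec d → ℝ) → StochOpt.Vec d,
        (∀ g, alg g ∈ X) ∧
        ∀ (𝒮 : Type*) [MeasurableSpace 𝒮] (P : MeasureTheory.Measure 𝒮)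
          [MeasureTheory.IsProbabilityMeasure P]
          (f : StochOpt.Vec d → 𝒮 → ℝ) (L : ℝ) (ℓ : Fin d → ℝ),
          StochOpt.IsStochConvex X P f →
          StochOpt.LipschitzEstimates X P f L Lhat ℓ ℓhat →
          Lhat ≤ L * √((n : ℝ) / Real.log (1 / δ)) →
          (∀ j, ℓhat j ≤ ℓ j * √((n : ℝ) / Real.log ((d : ℝ) / δ))) →
          (MeasureTheory.Measure.pi fun _ : Fin n => P)
            {S | ¬ ∀ xstar ∈ StochOpt.minimizers X P f,
              StochOpt.risk P f (alg fun i x => f x (S i)) - StochOpt.optValue X P f ≤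
                C * StochOpt.rate n δ L ℓ xstar} ≤ ENNReal.ofReal δ := by
  refine ⟨3200010, by norm_num, fun d n hd hn X hXc hX h0 δ hδ hδ2 Lhat ℓhat => ?_⟩
  by_cases hdeg : 3 ≤ n ∧ 0 < Lhat ∧ (∀ j, 0 ≤ ℓhat j) ∧ 0 < ∑ j, ℓhat j ∧
      Real.log (d / δ) ≤ n
  · obtain ⟨hn3, hLp, hℓn, hℓp, hld⟩ := hdeg
    obtain ⟨Q, rfl, rfl, rfl, rfl, hlam, hlamd⟩ :=
      StochOpt.exists_setup hd hn3 hXc hX h0 hδ hδ2 hLp hℓn hℓp hld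
    refine ⟨fun g => Q.D (Q.outIdx fun t => g (Fin.ofNat Q.n t)), fun g => Q.D_mem _,
      fun 𝒮 _ P _ f L ℓ hc hl hL hℓ => ?_⟩
    rw [← hlam] at hL
    rw [← hlamd] at hℓ
    exact Q.measure_not_le hδ hδ2 hlam.symm hlamd.symm hc hl hL hℓ
  · refine ⟨fun _ => 0, fun _ => h0, fun 𝒮 _ P _ f L ℓ hc hl hL hℓ => ?_⟩
    refine le_of_eq_of_le ?_ zero_le
    rw [Set.eq_empty_of_forall_notMem (s := {S : Fin n → 𝒮 | _}) ?_, measure_empty]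
    intro S hS
    refine hS fun x hx => ?_
    obtain ⟨hL0, hℓ0⟩ := hl.nonneg h0
    have hle := hl.risk_zero_sub_le hc h0 hx.1
    have hrate := StochOpt.rate_nonneg n δ hL0 ℓ x
    rw [StochOpt.optValue_eq hx]
    by_cases hn3 : n < 3
    · linarith [StochOpt.min_le_two_mul_rate (ℓ := ℓ) hn hn3 hd hδ hδ2 hL0 x]
    -- For `n ≥ 3`, a nonzero `L` and a nonzero `ℓ j` would make all known parameters nondegenerate;
    -- in particular `ℓ j ≤ ℓhat j ≤ ℓ j √(n / ln(d/δ))` forces `ln(d/δ) ≤ n`. Otherwise one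
    -- Lipschitz bound vanishes and the origin is optimal.
    suffices h : L = 0 ∨ ∀ j, ℓ j = 0 by
      rcases h with h | h
      · have := hle.trans (min_le_left _ _)
        rw [h, zero_mul] at this
        linarith
      · have := hle.trans ((min_le_right _ _).trans (min_le_right _ _))
        rw [show StochOpt.norm1 ℓ = 0 by simp [StochOpt.norm1, h], zero_mul] at this
        linarith
    by_contra! hcon
    obtain ⟨hL1, j, hj⟩ := hcon
    have hjp : 0 < ℓ j := lt_of_le_of_ne (hℓ0 j) (Ne.symm hj)
    have hhat : ∀ j, 0 ≤ ℓhat j := fun j => (hℓ0 j).trans (hl.le_ℓhat j)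
    refine hdeg ⟨not_lt.1 hn3, (lt_of_le_of_ne hL0 (Ne.symm hL1)).trans_le hl.le_Lhat, hhat,
      Finset.sum_pos' (fun j _ => hhat j) ⟨j, Finset.mem_univ j, hjp.trans_le (hl.le_ℓhat j)⟩, ?_⟩
    have h1 : ℓ j * 1 ≤ ℓ j * √((n : ℝ) / Real.log ((d : ℝ) / δ)) := by
      rw [mul_one]; exact (hl.le_ℓhat j).trans (hℓ j)
    have h2 := Real.one_le_sqrt.1 (le_of_mul_le_mul_left h1 hjp)
    by_contra! hlt
    have hn' : (0 : ℝ) ≤ n := n.cast_nonneg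
    rw [one_le_div (hn'.trans_lt hlt)] at h2
    linarith
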